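/- Let $0<\rho<1$ and $K(j)=\mathcal C_K\,j^{-(1+\rho)}$, $j\ge 1$, with $\mathcal C_K$ such that $\sum_{j\ge1}K(j)=1$. Let $\lambda>0$, let $\Lambda\subset\mathbb Z$ be a finite interval and let $\tau\in\{0,1\}^{\mathbb Z}$. The heat bath dynamics in $\Lambda$ with boundary condition $\tau$ is the continuous-time Markov chain on $\{0,1\}^\Lambda$ that flips each site $x\in\Lambda$ independently of the others at the following rate. Consider the configuration equal to the current one on $\Lambda$ and to $\tau$ on $\Lambda^c$, let $a,b\in\{1,2,\dots\}\cup\{\infty\}$ be the distances from $x$ to the nearest particle strictly to its left and strictly to its right, and let $r=K(a)K(b)/K(a+b)$. A particle is created at $x$ at rate $\lambda r/(1+\lambda r)$ if $x$ is empty, and destroyed at rate $1/(1+\lambda r)$ if $x$ is occupied. If $a$ or $b$ is infinite, $r$ is understood as the corresponding limit: $r=K(a)$ if only $b=\infty$, $r=K(b)$ if only $a=\infty$, and $r=0$ if $a=b=\infty$. Let $\mu^{\sigma;\tau}_t$ be the law at time $t$ of the chain started from $\sigma$. Let $d(\sigma,\sigma')=\sum_{x\in\Lambda}|\sigma_x-\sigma'_x|$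 and let $d_K(\mu,\nu)=\inf \mathbb E\,d(X,Y)$ be the Kantorovich distance, the infimum being over all couplings $(X,Y)$ of $\mu$ and $\nu$. For $\beta>0$ put $$T_\beta(\Lambda,\tau)=\inf\Big\{t>0:\ \sup_{d(\sigma,\sigma')=1}d_K\big(\mu^{\sigma;\tau}_t,\mu^{\sigma';\tau}_t\big)\le|\Lambda|^{-\beta}\Big\},\qquad \mathbf T_\beta(\Lambda)=\sup_{\tau\in\{0,1\}^{\mathbb Z}}T_\beta(\Lambda,\tau),$$ and let $\mathbf T_\beta(L)=\mathbf T_\beta(\{1,\dots,L\})$. **Proposition.** Let $0<\rho<1$ and $\frac1{1+\rho}<\zeta<1$. There is $\beta_0\in(0,\zeta(1+\rho)-1]$, depending only on $\rho$ and $\zeta$, such that for every $0<\beta<\beta_0$ there is a constant $C_4>0$, depending only on $\rho$, $\zeta$ and $\beta$ (and not on $\lambda$), with the following property. For every $0<\lambda<1$ and every $c_2>0$ (which may depend on $\lambda$) there is an integer $L_0$ such that, with $\ell(L)=\lfloor c_2L^\zeta\rfloor$, for all integers $L\ge L_0$, $$\mathbf T_\beta(L)\le C_4\,\mathbf T_\beta(\ell(L))<\infty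 .$$ -/

import Mathlib

open scoped ENNReal

noncomputable section

/-- The inter-arrival law on the positive integers, proportional to `j ^ (-(1 + ρ))` and
normalised to have total mass one. Only its values at `j ≥ 1` are ever used. -/
def renewalK (ρ : ℝ) (j : ℕ) : ℝ :=
  (j : ℝ) ^ (-(1 + ρ)) / ∑' i : ℕ, ((i + 1 : ℕ) : ℝ) ^ (-(1 + ρ))

/-- Distance from `x` to the nearest particle of `ω` strictly to its left,
`⊤` if there is none. -/
def leftDist (ω : ℤ → Bool) (x : ℤ) : ℕ∞ :=
  ⨅ (d : ℕ) (_ : 1 ≤ d ∧ ω (x - d) = true), (d : ℕ∞)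

/-- Distance from `x` to the nearest particle of `ω` strictly to its right,
`⊤` if there is none. -/
def rightDist (ω : ℤ → Bool) (x : ℤ) : ℕ∞ :=
  ⨅ (d : ℕ) (_ : 1 ≤ d ∧ ω (x + d) = true), (d : ℕ∞)

/-- The ratio `K(a) K(b) / K(a + b)` for a site whose nearest particles are at distance `a` to the
left and `b` to the right. If one (or both) of the distances is infinite, this is the limit of the
ratio as that distance (both distances) tends to infinity; see the `tendsto_gapRatio` lemmas below. -/
def gapRatio (ρ : ℝ) : ℕ∞ → ℕ∞ → ℝ
  | (a : ℕ), (b : ℕ) => renewalK ρ a * renewalK ρ b / renewalK ρ (a + b)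
  | (a : ℕ), ⊤ => renewalK ρ a
  | ⊤, (b : ℕ) => renewalK ρ b
  | ⊤, ⊤ => 0

theorem gapRatio_eq {ρ : ℝ} (hρ : 0 < ρ) {a b : ℕ} (ha : 1 ≤ a) (hb : 1 ≤ b) :
    gapRatio ρ a b = renewalK ρ 1 * ((a : ℝ)⁻¹ + (b : ℝ)⁻¹) ^ (1 + ρ) := by
  have ha' : (0 : ℝ) < a := by exact_mod_cast ha
  have hb' : (0 : ℝ) < b := by exact_mod_cast hb
  have hS : 0 < ∑' i : ℕ, ((i + 1 : ℕ) : ℝ) ^ (-(1 + ρ)) := by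
    have h1 : Summable fun i : ℕ => ((i + 1 : ℕ) : ℝ) ^ (-(1 + ρ)) :=
      (summable_nat_add_iff 1).2 (Real.summable_nat_rpow.2 (by linarith))
    exact h1.tsum_pos (fun i => by positivity) 0 (by simp)
  change renewalK ρ a * renewalK ρ b / renewalK ρ (a + b) = _
  unfold renewalK
  have h : ((a : ℝ)⁻¹ + (b : ℝ)⁻¹) = (a + b) / (a * b) := by field_simp; ring
  rw [h, Real.div_rpow (by positivity) (by positivity), Real.mul_rpow ha'.le hb'.le,
    Real.rpow_neg ha'.le, Real.rpow_neg hb'.le, Real.rpow_neg (by positivity)]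
  push_cast
  rw [Real.one_rpow]
  have := Real.rpow_pos_of_pos ha' (1 + ρ)
  have := Real.rpow_pos_of_pos hb' (1 + ρ)
  have := Real.rpow_pos_of_pos (add_pos ha' hb') (1 + ρ)
  field_simp

theorem gapRatio_comm (ρ : ℝ) (a b : ℕ∞) : gapRatio ρ a b = gapRatio ρ b a := by
  cases a <;> cases b <;> first | rfl | skip
  rename_i a b
  change renewalK ρ a * renewalK ρ b / renewalK ρ (a + b) =
    renewalK ρ b * renewalK ρ a / renewalK ρ (b + a)
  rw [mul_comm, add_comm]

theorem tendsto_gapRatio_right {ρ : ℝ} (hρ : 0 < ρ) {a : ℕ} (ha : 1 ≤ a) :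
    Filter.Tendsto (fun n : ℕ => gapRatio ρ a n) Filter.atTop (nhds (gapRatio ρ a ⊤)) := by
  have ha' : (0 : ℝ) < a := by exact_mod_cast ha
  have h0 : Filter.Tendsto (fun n : ℕ => renewalK ρ 1 * ((a : ℝ)⁻¹ + (n : ℝ)⁻¹) ^ (1 + ρ))
      Filter.atTop (nhds (renewalK ρ 1 * ((a : ℝ)⁻¹ + 0) ^ (1 + ρ))) :=
    ((tendsto_const_nhds.add tendsto_inv_atTop_nhds_zero_nat).rpow_const
      (Or.inr (by linarith))).const_mul _
  have h1 : gapRatio ρ a ⊤ = renewalK ρ 1 * ((a : ℝ)⁻¹ + 0) ^ (1 + ρ) := by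
    change renewalK ρ a = _
    unfold renewalK
    rw [add_zero, Real.rpow_neg ha'.le, Real.inv_rpow ha'.le, Nat.cast_one, Real.one_rpow]
    ring
  rw [h1]
  refine h0.congr' ?_
  filter_upwards [Filter.eventually_ge_atTop 1] with n hn
  exact (gapRatio_eq hρ ha hn).symm

theorem tendsto_gapRatio_left {ρ : ℝ} (hρ : 0 < ρ) {b : ℕ} (hb : 1 ≤ b) :
    Filter.Tendsto (fun n : ℕ => gapRatio ρ n b) Filter.atTop (nhds (gapRatio ρ ⊤ b)) := by
  simp only [gapRatio_comm ρ _ (b : ℕ∞)]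
  exact tendsto_gapRatio_right hρ hb

theorem tendsto_gapRatio_both {ρ : ℝ} (hρ : 0 < ρ) :
    Filter.Tendsto (fun p : ℕ × ℕ => gapRatio ρ p.1 p.2) Filter.atTop
      (nhds (gapRatio ρ ⊤ ⊤)) := by
  have hi : Filter.Tendsto (fun n : ℕ => (n : ℝ)⁻¹) Filter.atTop (nhds 0) :=
    tendsto_inv_atTop_nhds_zero_nat
  have h0 : Filter.Tendsto
      (fun p : ℕ × ℕ => renewalK ρ 1 * ((p.1 : ℝ)⁻¹ + (p.2 : ℝ)⁻¹) ^ (1 + ρ))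
      Filter.atTop (nhds (renewalK ρ 1 * (0 + 0) ^ (1 + ρ))) := by
    rw [← Filter.prod_atTop_atTop_eq]
    exact (((hi.comp Filter.tendsto_fst).add (hi.comp Filter.tendsto_snd)).rpow_const
      (Or.inr (by linarith))).const_mul _
  have h1 : gapRatio ρ ⊤ ⊤ = renewalK ρ 1 * (0 + 0) ^ (1 + ρ) := by
    rw [add_zero, Real.zero_rpow (by linarith), mul_zero]
    rfl
  rw [h1]
  refine h0.congr' ?_
  filter_upwards [Filter.eventually_ge_atTop ((1, 1) : ℕ × ℕ)] with p hp
  exact (gapRatio_eq hρ hp.1 hp.2).symm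

/-- Configurations on the finite set of sites `Λ` (`true` means that a particle is present). -/
abbrev Config (Λ : Finset ℤ) : Type := Λ → Bool

/-- The configuration on `ℤ` equal to `σ` on `Λ` and to the boundary condition `τ` off `Λ`. -/
def glue {Λ : Finset ℤ} (τ : ℤ → Bool) (σ : Config Λ) : ℤ → Bool :=
  fun y => if h : y ∈ Λ then σ ⟨y, h⟩ else τ y

/-- The configuration `σ` with the site `x` flipped. -/
def flipAt {Λ : Finset ℤ} (σ : Config Λ) (x : Λ) : Config Λ :=
  Function.update σ x (!(σ x))

/-- The heat-bath rate at which site `x` is flipped. With `r = K(a) K(b) / K(a + b)`, a particle is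
created at rate `lam / (lam + 1 / r) = lam * r / (1 + lam * r)` and destroyed at rate
`1 / (1 + lam * r)`. -/
def flipRate (ρ lam : ℝ) {Λ : Finset ℤ} (τ : ℤ → Bool) (σ : Config Λ) (x : Λ) : ℝ :=
  let r := gapRatio ρ (leftDist (glue τ σ) x) (rightDist (glue τ σ) x)
  if σ x then 1 / (1 + lam * r) else lam * r / (1 + lam * r)

/-- The generator of the heat-bath dynamics in `Λ` with boundary condition `τ`, as a matrix:
`(𝓛 f) σ = ∑ x ∈ Λ, flipRate σ x * (f (flipAt σ x) - f σ)`. -/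
def generator (ρ lam : ℝ) (Λ : Finset ℤ) (τ : ℤ → Bool) : Matrix (Config Λ) (Config Λ) ℝ :=
  Matrix.of fun σ σ' => ∑ x : Λ, flipRate ρ lam τ σ x *
    ((if σ' = flipAt σ x then 1 else 0) - (if σ' = σ then 1 else 0))

/-- The law at time `t` (as a probability vector) of the dynamics in `Λ` with boundary
condition `τ` started from `σ`. -/
def law (ρ lam : ℝ) (Λ : Finset ℤ) (τ : ℤ → Bool) (t : ℝ) (σ : Config Λ) : Config Λ → ℝ :=
  fun η => NormedSpace.exp (t • generator ρ lam Λ τ) σ η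

/-- `γ` is (the joint law of) a coupling of `μ` and `ν`. -/
structure IsCoupling {E : Type} [Fintype E] (γ : E → E → ℝ) (μ ν : E → ℝ) : Prop where
  nonneg : ∀ x y, 0 ≤ γ x y
  fst : ∀ x, ∑ y, γ x y = μ x
  snd : ∀ y, ∑ x, γ x y = ν y

/-- The Kantorovich distance associated with the Hamming distance. -/
def kantorovich {Λ : Finset ℤ} (μ ν : Config Λ → ℝ) : ℝ≥0∞ :=
  ⨅ (γ : Config Λ → Config Λ → ℝ) (_ : IsCoupling γ μ ν),
    ENNReal.ofReal (∑ σ, ∑ σ', γ σ σ' * (hammingDist σ σ' : ℝ))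

/-- `T_β(Λ, τ)`: the first time at which the laws started from any two configurations that differ
at exactly one site are within Kantorovich distance `|Λ| ^ (-β)`. -/
def contractionTimeBC (ρ lam β : ℝ) (Λ : Finset ℤ) (τ : ℤ → Bool) : ℝ≥0∞ :=
  ⨅ (t : ℝ) (_ : 0 < t ∧
      (⨆ (σ : Config Λ) (σ' : Config Λ) (_ : hammingDist σ σ' = 1),
          kantorovich (law ρ lam Λ τ t σ) (law ρ lam Λ τ t σ')) ≤
        ENNReal.ofReal (1 / (Λ.card : ℝ) ^ β)),
    ENNReal.ofReal t

/-- `T_β(Λ)`: the supremum of `T_β(Λ, τ)` over all boundary conditions `τ`. -/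
def contractionTime (ρ lam β : ℝ) (Λ : Finset ℤ) : ℝ≥0∞ :=
  ⨆ τ : ℤ → Bool, contractionTimeBC ρ lam β Λ τ

/-- `T_β(L)`: the value of `T_β` for the interval `{1, …, L}`. -/
def contractionTimeLen (ρ lam β : ℝ) (L : ℕ) : ℝ≥0∞ :=
  contractionTime ρ lam β (Finset.Icc 1 (L : ℤ))

end

/-!
Write `P_t` for the semigroup of a box dynamics, and `occ x` for the occupation number of `x`. The
rates are monotone in the configuration, because `K(a) K(b) / K(a + b) = K(1) (1/a + 1/b) ^ (1 + ρ)`,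
so two dynamics with ordered initial and boundary conditions can be coupled so as to stay ordered
(`Dominated.coupled_exp`). Two consequences carry the proof. The Kantorovich distance of the laws
started from neighbouring configurations is at most the sum over all sites of the difference of
`P_t (occ x)` between the full and the empty initial configuration (`contractsAt_of_evolve_occ`); and
`P_t (occ x)` may be compared with the same quantity in a smaller box around `x` whose surroundings
are frozen in the full, or in the empty, state (`Dominated.evolve_occ_le`).

Let `n` be the length of the smaller boxes. Since contraction is submultiplicative, after `j`
contraction times of such a box, whatever its boundary condition, `P_t (occ x)` is within
`n ^ (1 - j β)` of its equilibrium value (`ContractsAt.osc_evolve_occ` and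
`BoxBoundary.abs_evolve_occ_sub_boxProb_le`). With `j` large, depending on `β` and `ζ` only, the sum
over `L` sites of these errors is below `L ^ (-β)`. What remains is an equilibrium estimate.

The equilibrium in a box is a renewal process with inter-arrival law `K` and a weight `lam < 1` per
particle. As `K` is subexponential and `lam < 1`, the partition function between two pinned particles
at distance `d` is at most a constant times `K(d)` (`exists_pinnedSum_le`): particles are
present only near the ends of the box.

* A site at distance of order `n` from the complement of `{1, …, L}` is put in the middle of a box
  surrounded by particles. There it is occupied with probability `O(n ^ (-(1 + ρ)))`; summed over `L`
  sites this is small because `ζ (1 + ρ) > 1`.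
* A site close to an end of `{1, …, L}` is put in a box at that end, and one has to show that the
  equilibrium there does not feel whether the other end of the box is frozen full or empty. With high
  probability there is no particle in a long stretch `(m, M]`, and given this event the conditional
  law of the configuration in `[1, m]` is nearly independent of what lies beyond `M`, for `K(v - u)`
  hardly depends on `u ≤ m` when `v > M` (`boxProb_sub_boxProb_le`). Taking `m` of order
  `n ^ (1 / 2)` and `M = n / 2` yields an error of order `n ^ (-ρ ^ 2 / 16)`, which is where
  the value of `β₀` comes from.

The contraction time is finite, uniformly in the boundary condition, since the empty configuration is
reached in unit time with probability bounded below (`contractionTimeLen_lt_top`).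
-/

/-! ### Exponentials of finite matrices -/

section MatrixExp

variable {X Y : Type*} [Fintype X] [DecidableEq X] [Fintype Y] [DecidableEq Y]

attribute [local instance] Matrix.linftyOpNormedRing Matrix.linftyOpNormedAlgebra

theorem hasSum_matrix_exp_apply (A : Matrix X X ℝ) (p q : X) :
    HasSum (fun n : ℕ => ((n.factorial : ℝ)⁻¹) * (A ^ n) p q) (NormedSpace.exp A p q) := by
  have h := NormedSpace.exp_series_hasSum_exp' (𝕂 := ℝ) A
  have h1 : Continuous fun M : Matrix X X ℝ => M p q := by fun_prop
  exact h.map (⟨⟨fun M : Matrix X X ℝ => M p q, rfl⟩, fun _ _ => rfl⟩ : Matrix X X ℝ →+ ℝ) h1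

theorem matrix_exp_add_smul (A : Matrix X X ℝ) (s t : ℝ) :
    NormedSpace.exp ((s + t) • A) = NormedSpace.exp (s • A) * NormedSpace.exp (t • A) := by
  rw [add_smul]
  exact Matrix.exp_add_of_commute _ _ (((Commute.refl A).smul_left s).smul_right t)

theorem matrix_exp_eq_exp_neg_smul (A : Matrix X X ℝ) (c : ℝ) :
    NormedSpace.exp A = Real.exp (-c) • NormedSpace.exp (A + c • (1 : Matrix X X ℝ)) := by
  have h : A = (A + c • (1 : Matrix X X ℝ)) + (-c) • (1 : Matrix X X ℝ) := by
    rw [neg_smul]; abel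
  conv_lhs => rw [h]
  rw [Matrix.exp_add_of_commute _ _ ((Commute.one_right _).smul_right _)]
  have h2 : NormedSpace.exp ((-c) • (1 : Matrix X X ℝ)) =
      Real.exp (-c) • (1 : Matrix X X ℝ) := by
    have := (NormedSpace.algebraMap_exp_comm (𝕂 := ℝ) (𝔸 := Matrix X X ℝ) (-c)).symm
    rw [Algebra.algebraMap_eq_smul_one, Algebra.algebraMap_eq_smul_one] at this
    rw [Real.exp_eq_exp_ℝ]
    exact this
  rw [h2, mul_smul_comm, mul_one]

/-- The exponential of a matrix whose rows indexed by `O` have nonnegative off-diagonal entries and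
no entry outside `O` is nonnegative on these rows, and has no entry outside `O` there either. -/
theorem matrix_exp_apply_of_invariant {A : Matrix X X ℝ} {O : Set X}
    (hA : ∀ p ∈ O, ∀ q, q ≠ p → 0 ≤ A p q) (hO : ∀ p ∈ O, ∀ q, q ∉ O → A p q = 0)
    {p : X} (hp : p ∈ O) (q : X) :
    0 ≤ NormedSpace.exp A p q ∧ (q ∉ O → NormedSpace.exp A p q = 0) := by
  classical
  set c : ℝ := ∑ x, |A x x| with hc
  set M := A + c • (1 : Matrix X X ℝ) with hM
  have hM0 : ∀ p ∈ O, ∀ q, 0 ≤ M p q := by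
    intro p hp q
    by_cases hq : q = p
    · subst hq
      have h1 : |A q q| ≤ c := Finset.single_le_sum (f := fun x => |A x x|)
        (fun x _ => abs_nonneg _) (Finset.mem_univ q)
      simp only [hM, Matrix.add_apply, Matrix.smul_apply, Matrix.one_apply_eq, smul_eq_mul, mul_one]
      linarith [neg_abs_le (A q q)]
    · simp only [hM, Matrix.add_apply, Matrix.smul_apply, Matrix.one_apply_ne' hq, smul_zero,
        add_zero]
      exact hA p hp q hq
  have hMO : ∀ p ∈ O, ∀ q, q ∉ O → M p q = 0 := by
    intro p hp q hq
    have hne : p ≠ q := fun h => hq (h ▸ hp)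
    simp only [hM, Matrix.add_apply, Matrix.smul_apply, Matrix.one_apply_ne hne, smul_zero,
      add_zero]
    exact hO p hp q hq
  have hpow : ∀ n : ℕ, ∀ p ∈ O, ∀ q, 0 ≤ (M ^ n) p q ∧ (q ∉ O → (M ^ n) p q = 0) := by
    intro n
    induction n with
    | zero =>
      intro p hp q
      rw [pow_zero, Matrix.one_apply]
      refine ⟨by split_ifs <;> norm_num, fun hq => if_neg fun h : p = q => hq (h ▸ hp)⟩
    | succ n ih =>
      intro p hp q
      rw [pow_succ', Matrix.mul_apply]
      constructor
      · refine Finset.sum_nonneg fun x _ => ?_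
        by_cases hx : x ∈ O
        · exact mul_nonneg (hM0 p hp x) (ih x hx q).1
        · rw [hMO p hp x hx, zero_mul]
      · intro hq
        refine Finset.sum_eq_zero fun x _ => ?_
        by_cases hx : x ∈ O
        · rw [(ih x hx q).2 hq, mul_zero]
        · rw [hMO p hp x hx, zero_mul]
  have hs := hasSum_matrix_exp_apply M p q
  rw [matrix_exp_eq_exp_neg_smul A c, ← hM, Matrix.smul_apply, smul_eq_mul]
  refine ⟨mul_nonneg (Real.exp_pos _).le (hs.nonneg fun n =>
    mul_nonneg (by positivity) (hpow n p hp q).1), fun hq => ?_⟩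
  have h0 : (fun n : ℕ => ((n.factorial : ℝ)⁻¹) * (M ^ n) p q) = fun _ => 0 := by
    ext n
    rw [(hpow n p hp q).2 hq, mul_zero]
  rw [h0] at hs
  rw [hs.unique hasSum_zero, mul_zero]

theorem matrix_pow_apply_nonneg {M : Matrix X X ℝ} (h : ∀ p q, 0 ≤ M p q) (j : ℕ) (p q : X) :
    0 ≤ (M ^ j) p q := by
  induction j generalizing p q with
  | zero => rw [pow_zero, Matrix.one_apply]; split_ifs <;> norm_num
  | succ j ih =>
    rw [pow_succ', Matrix.mul_apply]
    exact Finset.sum_nonneg fun x _ => mul_nonneg (h _ _) (ih _ _)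

/-- Intertwined matrices have intertwined exponentials. -/
theorem matrix_exp_mul_comm_of_intertwine {A : Matrix X X ℝ} {B : Matrix Y Y ℝ} {J : Matrix X Y ℝ}
    (h : A * J = J * B) : NormedSpace.exp A * J = J * NormedSpace.exp B := by
  have hpow : ∀ n : ℕ, A ^ n * J = J * B ^ n := by
    intro n
    induction n with
    | zero => simp
    | succ n ih => rw [pow_succ, Matrix.mul_assoc, h, ← Matrix.mul_assoc, ih, Matrix.mul_assoc,
        ← pow_succ]
  ext p q
  have h1 : HasSum (fun n : ℕ => ((n.factorial : ℝ)⁻¹) * (A ^ n * J) p q)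
      ((NormedSpace.exp A * J) p q) := by
    simp only [Matrix.mul_apply, Finset.mul_sum, ← mul_assoc]
    exact hasSum_sum fun x _ => (hasSum_matrix_exp_apply A p x).mul_right _
  have h2 : HasSum (fun n : ℕ => ((n.factorial : ℝ)⁻¹) * (J * B ^ n) p q)
      ((J * NormedSpace.exp B) p q) := by
    simp only [Matrix.mul_apply, Finset.mul_sum, mul_left_comm _ (J p _)]
    exact hasSum_sum fun x _ => (hasSum_matrix_exp_apply B x q).mul_left _
  simp only [hpow] at h1
  exact h1.unique h2

theorem sum_matrix_exp_apply {A : Matrix X X ℝ} (h : ∀ p, ∑ q, A p q = 0) (p : X) :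
    ∑ q, NormedSpace.exp A p q = 1 := by
  have h1 : A * (Matrix.of fun (_ : X) (_ : Unit) => (1 : ℝ)) =
      (Matrix.of fun (_ : X) (_ : Unit) => (1 : ℝ)) * (0 : Matrix Unit Unit ℝ) := by
    ext p q
    simp [Matrix.mul_apply, h]
  have h2 := congrFun (congrFun (matrix_exp_mul_comm_of_intertwine h1) p) ()
  simpa [Matrix.mul_apply] using h2

theorem vecMul_matrix_exp_of_vecMul_eq_zero {A : Matrix X X ℝ} {w : X → ℝ}
    (h : ∀ q, ∑ p, w p * A p q = 0) (q : X) :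
    ∑ p, w p * NormedSpace.exp A p q = w q := by
  have h1 : (0 : Matrix Unit Unit ℝ) * (Matrix.of fun (_ : Unit) (p : X) => w p) =
      (Matrix.of fun (_ : Unit) (p : X) => w p) * A := by
    ext p q
    simp [Matrix.mul_apply, h]
  have h2 := congrFun (congrFun (matrix_exp_mul_comm_of_intertwine h1) ()) q
  simpa [Matrix.mul_apply] using h2.symm

end MatrixExp

/-! ### Jump processes with finitely many types of jump -/

section JumpGen

variable {X Y J I : Type*} [Fintype X] [DecidableEq X] [Fintype J] [Fintype Y] [DecidableEq Y]
  [Fintype I]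

/-- The generator of the Markov chain on `X` that jumps from `p` to `T j p` at rate `R j p`,
for each `j`. -/
def jumpGen (R : J → X → ℝ) (T : J → X → X) : Matrix X X ℝ :=
  Matrix.of fun p q => ∑ j, R j p * ((if q = T j p then 1 else 0) - (if q = p then 1 else 0))

theorem sum_jumpGen_mul (R : J → X → ℝ) (T : J → X → X) (f : X → ℝ) (p : X) :
    ∑ q, jumpGen R T p q * f q = ∑ j, R j p * (f (T j p) - f p) := by
  simp only [jumpGen, Matrix.of_apply, Finset.sum_mul]
  rw [Finset.sum_comm]
  refine Finset.sum_congr rfl fun j _ => ?_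
  simp only [mul_assoc, ← Finset.mul_sum, sub_mul, ite_mul, one_mul, zero_mul,
    Finset.sum_sub_distrib, Finset.sum_ite_eq', Finset.mem_univ, if_true]

theorem jumpGen_exp_of_invariant {R : J → X → ℝ} {T : J → X → X} {O : Set X}
    (hR : ∀ p ∈ O, ∀ j, 0 ≤ R j p) (hT : ∀ p ∈ O, ∀ j, R j p ≠ 0 → T j p ∈ O)
    {t : ℝ} (ht : 0 ≤ t) {p : X} (hp : p ∈ O) (q : X) :
    0 ≤ NormedSpace.exp (t • jumpGen R T) p q ∧
      (q ∉ O → NormedSpace.exp (t • jumpGen R T) p q = 0) := by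
  refine matrix_exp_apply_of_invariant (fun p hp q hq => ?_) (fun p hp q hq => ?_) hp q
  · refine mul_nonneg ht (Finset.sum_nonneg fun j _ => mul_nonneg (hR p hp j) ?_)
    rw [if_neg hq]
    split_ifs <;> norm_num
  · have hne : q ≠ p := fun h => hq (h ▸ hp)
    rw [Matrix.smul_apply, jumpGen, Matrix.of_apply, Finset.sum_eq_zero, smul_zero]
    intro j _
    by_cases hj : R j p = 0
    · rw [hj, zero_mul]
    · rw [if_neg hne, if_neg fun h : q = T j p => hq (h ▸ hT p hp j hj), sub_zero, mul_zero]

theorem sum_jumpGen_exp (R : J → X → ℝ) (T : J → X → X) (t : ℝ) (p : X) :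
    ∑ q, NormedSpace.exp (t • jumpGen R T) p q = 1 := by
  refine sum_matrix_exp_apply (fun p => ?_) p
  have := sum_jumpGen_mul R T (fun _ => 1) p
  simp only [mul_one, sub_self, mul_zero, Finset.sum_const_zero] at this
  simp only [Matrix.smul_apply, ← Finset.smul_sum, this, smul_zero]

/-- If `φ` maps a chain with generator `jumpGen R T` to one with generator `jumpGen R' T'`, at the
level of generators, then it does so at the level of semigroups. -/
theorem jumpGen_exp_map {R : J → X → ℝ} {T : J → X → X} {R' : I → Y → ℝ} {T' : I → Y → Y}
    (φ : X → Y) (h : ∀ (f : Y → ℝ) (p : X), ∑ j, R j p * (f (φ (T j p)) - f (φ p)) =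
      ∑ i, R' i (φ p) * (f (T' i (φ p)) - f (φ p))) (t : ℝ) (f : Y → ℝ) (p : X) :
    ∑ q, NormedSpace.exp (t • jumpGen R T) p q * f (φ q) =
      ∑ y, NormedSpace.exp (t • jumpGen R' T') (φ p) y * f y := by
  set K : Matrix X Y ℝ := Matrix.of fun x y => if y = φ x then 1 else 0 with hK
  have hint : (t • jumpGen R T) * K = K * (t • jumpGen R' T') := by
    rw [Matrix.smul_mul, Matrix.mul_smul]
    congr 1
    ext p y
    rw [Matrix.mul_apply, Matrix.mul_apply]
    have h1 := h (fun z => if y = z then 1 else 0) p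
    rw [← sum_jumpGen_mul R' T' (fun z => if y = z then (1 : ℝ) else 0) (φ p)] at h1
    have h2 := sum_jumpGen_mul R T (fun q => if y = φ q then (1 : ℝ) else 0) p
    simp only [hK, Matrix.of_apply]
    rw [h2, h1]
    simp
  have h3 := matrix_exp_mul_comm_of_intertwine hint
  have h4 : ∀ q, f (φ q) = ∑ y, K q y * f y := by
    intro q
    simp [hK]
  simp only [h4, Finset.mul_sum, ← mul_assoc]
  rw [Finset.sum_comm]
  refine Finset.sum_congr rfl fun y _ => ?_
  rw [← Finset.sum_mul]
  have h5 := congrFun (congrFun h3 p) y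
  rw [Matrix.mul_apply, Matrix.mul_apply] at h5
  rw [h5]
  simp [hK]

end JumpGen

/-! ### The flip rates -/

section Rates

theorem renewalK_norm_pos {ρ : ℝ} (hρ : 0 < ρ) :
    0 < ∑' i : ℕ, ((i + 1 : ℕ) : ℝ) ^ (-(1 + ρ)) := by
  have h1 : Summable fun i : ℕ => ((i + 1 : ℕ) : ℝ) ^ (-(1 + ρ)) :=
    (summable_nat_add_iff 1).2 (Real.summable_nat_rpow.2 (by linarith))
  exact h1.tsum_pos (fun i => by positivity) 0 (by simp)

theorem renewalK_nonneg {ρ : ℝ} (hρ : 0 < ρ) (j : ℕ) : 0 ≤ renewalK ρ j :=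
  div_nonneg (by positivity) (renewalK_norm_pos hρ).le

theorem renewalK_pos {ρ : ℝ} (hρ : 0 < ρ) {j : ℕ} (hj : 1 ≤ j) : 0 < renewalK ρ j := by
  have : (0 : ℝ) < j := by exact_mod_cast hj
  exact div_pos (by positivity) (renewalK_norm_pos hρ)

theorem renewalK_eq {ρ : ℝ} {j : ℕ} (hj : 1 ≤ j) :
    renewalK ρ j = renewalK ρ 1 * ((j : ℝ)⁻¹) ^ (1 + ρ) := by
  have : (0 : ℝ) < j := by exact_mod_cast hj
  simp only [renewalK, Real.rpow_neg this.le, Real.inv_rpow this.le, Nat.cast_one, Real.one_rpow]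
  ring

theorem renewalK_zero {ρ : ℝ} (hρ : 0 < ρ) : renewalK ρ 0 = 0 := by
  rw [renewalK, Nat.cast_zero, Real.zero_rpow (by linarith), zero_div]

theorem hasSum_renewalK {ρ : ℝ} (hρ : 0 < ρ) : HasSum (renewalK ρ) 1 := by
  have h1 : Summable fun i : ℕ => ((i + 1 : ℕ) : ℝ) ^ (-(1 + ρ)) :=
    (summable_nat_add_iff 1).2 (Real.summable_nat_rpow.2 (by linarith))
  have h2 : HasSum (fun i : ℕ => renewalK ρ (i + 1)) 1 := by
    have := h1.hasSum.div_const (∑' i : ℕ, ((i + 1 : ℕ) : ℝ) ^ (-(1 + ρ)))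
    rwa [div_self (renewalK_norm_pos hρ).ne'] at this
  have h3 := (hasSum_nat_add_iff (f := renewalK ρ) 1).1 h2
  simpa [renewalK_zero hρ] using h3

theorem renewalK_le_one {ρ : ℝ} (hρ : 0 < ρ) (j : ℕ) : renewalK ρ j ≤ 1 :=
  le_hasSum (hasSum_renewalK hρ) j fun i _ => renewalK_nonneg hρ i

/-- The inverse of a distance, with `1 / ∞ = 0`. -/
noncomputable def invDist : ℕ∞ → ℝ
  | (n : ℕ) => (n : ℝ)⁻¹
  | ⊤ => 0

theorem invDist_nonneg (a : ℕ∞) : 0 ≤ invDist a := by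
  cases a with
  | top => exact le_rfl
  | coe n => change 0 ≤ (n : ℝ)⁻¹; positivity

theorem invDist_anti {a b : ℕ∞} (ha : 1 ≤ a) (h : a ≤ b) : invDist b ≤ invDist a := by
  cases b with
  | top => exact invDist_nonneg a
  | coe n =>
    cases a with
    | top => simp at h
    | coe m =>
      have hm : 1 ≤ m := by exact_mod_cast ha
      have hmn : m ≤ n := by exact_mod_cast h
      change (n : ℝ)⁻¹ ≤ (m : ℝ)⁻¹
      have : (0 : ℝ) < m := by exact_mod_cast hm
      gcongr

theorem invDist_le_one {a : ℕ∞} (ha : 1 ≤ a) : invDist a ≤ 1 := by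
  have := invDist_anti le_rfl ha
  have h1 : invDist 1 = 1 := by change ((1 : ℕ) : ℝ)⁻¹ = 1; simp
  linarith

theorem gapRatio_eq_invDist {ρ : ℝ} (hρ : 0 < ρ) {a b : ℕ∞} (ha : 1 ≤ a) (hb : 1 ≤ b) :
    gapRatio ρ a b = renewalK ρ 1 * (invDist a + invDist b) ^ (1 + ρ) := by
  have key : ∀ n : ℕ, 1 ≤ n → gapRatio ρ n ⊤ = renewalK ρ 1 * (invDist n + invDist ⊤) ^ (1 + ρ) := by
    intro n hn
    change renewalK ρ n = renewalK ρ 1 * ((n : ℝ)⁻¹ + 0) ^ (1 + ρ)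
    rw [add_zero, renewalK_eq hn]
  cases a with
  | top =>
    cases b with
    | top =>
      change (0 : ℝ) = renewalK ρ 1 * (0 + 0) ^ (1 + ρ)
      rw [add_zero, Real.zero_rpow (by linarith), mul_zero]
    | coe n =>
      rw [gapRatio_comm, add_comm]
      exact key n (by exact_mod_cast hb)
  | coe m =>
    cases b with
    | top => exact key m (by exact_mod_cast ha)
    | coe n => exact gapRatio_eq hρ (by exact_mod_cast ha) (by exact_mod_cast hb)

/-- The ratio `K(a) K(b) / K(a + b)` at the site `x` of the configuration `ω`. -/
noncomputable def siteRatio (ρ : ℝ) (ω : ℤ → Bool) (x : ℤ) : ℝ :=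
  gapRatio ρ (leftDist ω x) (rightDist ω x)

theorem one_le_leftDist (ω : ℤ → Bool) (x : ℤ) : 1 ≤ leftDist ω x :=
  le_iInf₂ fun d hd => by exact_mod_cast hd.1

theorem one_le_rightDist (ω : ℤ → Bool) (x : ℤ) : 1 ≤ rightDist ω x :=
  le_iInf₂ fun d hd => by exact_mod_cast hd.1

theorem leftDist_anti {ω ω' : ℤ → Bool} (h : ω ≤ ω') (x : ℤ) : leftDist ω' x ≤ leftDist ω x :=
  le_iInf₂ fun d hd => iInf₂_le d ⟨hd.1, Bool.le_iff_imp.1 (h _) hd.2⟩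

theorem rightDist_anti {ω ω' : ℤ → Bool} (h : ω ≤ ω') (x : ℤ) : rightDist ω' x ≤ rightDist ω x :=
  le_iInf₂ fun d hd => iInf₂_le d ⟨hd.1, Bool.le_iff_imp.1 (h _) hd.2⟩

theorem siteRatio_eq {ρ : ℝ} (hρ : 0 < ρ) (ω : ℤ → Bool) (x : ℤ) :
    siteRatio ρ ω x =
      renewalK ρ 1 * (invDist (leftDist ω x) + invDist (rightDist ω x)) ^ (1 + ρ) :=
  gapRatio_eq_invDist hρ (one_le_leftDist ω x) (one_le_rightDist ω x)

theorem siteRatio_nonneg {ρ : ℝ} (hρ : 0 < ρ) (ω : ℤ → Bool) (x : ℤ) : 0 ≤ siteRatio ρ ω x := by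
  rw [siteRatio_eq hρ]
  have := invDist_nonneg (leftDist ω x)
  have := invDist_nonneg (rightDist ω x)
  have := renewalK_nonneg hρ 1
  positivity

theorem siteRatio_le_four {ρ : ℝ} (hρ : 0 < ρ) (hρ1 : ρ < 1) (ω : ℤ → Bool) (x : ℤ) :
    siteRatio ρ ω x ≤ 4 := by
  rw [siteRatio_eq hρ]
  have h1 := invDist_nonneg (leftDist ω x)
  have h2 := invDist_nonneg (rightDist ω x)
  have h3 := invDist_le_one (one_le_leftDist ω x)
  have h4 := invDist_le_one (one_le_rightDist ω x)
  have h5 : (invDist (leftDist ω x) + invDist (rightDist ω x)) ^ (1 + ρ) ≤ 4 :=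
    calc _ ≤ (2 : ℝ) ^ (1 + ρ) :=
          Real.rpow_le_rpow (by linarith) (by linarith) (by linarith)
      _ ≤ (2 : ℝ) ^ (2 : ℝ) := Real.rpow_le_rpow_of_exponent_le (by norm_num) (by linarith)
      _ = 4 := by norm_num
  calc _ ≤ 1 * (4 : ℝ) := mul_le_mul (renewalK_le_one hρ 1) h5 (by positivity) zero_le_one
    _ = 4 := one_mul _

theorem siteRatio_mono {ρ : ℝ} (hρ : 0 < ρ) {ω ω' : ℤ → Bool} (h : ω ≤ ω') (x : ℤ) :
    siteRatio ρ ω x ≤ siteRatio ρ ω' x := by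
  rw [siteRatio_eq hρ, siteRatio_eq hρ]
  have h1 := invDist_nonneg (leftDist ω x)
  have h2 := invDist_nonneg (rightDist ω x)
  have h3 := invDist_anti (one_le_leftDist ω' x) (leftDist_anti h x)
  have h4 := invDist_anti (one_le_rightDist ω' x) (rightDist_anti h x)
  exact mul_le_mul_of_nonneg_left (Real.rpow_le_rpow (by linarith) (by linarith) (by linarith))
    (renewalK_nonneg hρ 1)

/-- The bijection `e` of `ℤ` transports the rates of the dynamics; this is the case for translations
and reflections. -/
def PreservesRatio (ρ : ℝ) (e : ℤ ≃ ℤ) : Prop :=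
  ∀ (ω : ℤ → Bool) (x : ℤ), siteRatio ρ (fun z => ω (e z)) x = siteRatio ρ ω (e x)

theorem preservesRatio_addRight (ρ : ℝ) (s : ℤ) : PreservesRatio ρ (Equiv.addRight s) := by
  intro ω x
  simp only [siteRatio, leftDist, rightDist, Equiv.coe_addRight]
  congr 1 <;> simp only [add_sub_right_comm, add_right_comm]

theorem preservesRatio_subLeft (ρ : ℝ) (s : ℤ) : PreservesRatio ρ (Equiv.subLeft s) := by
  intro ω x
  rw [siteRatio, siteRatio, gapRatio_comm]
  simp only [leftDist, rightDist, Equiv.subLeft_apply]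
  congr 1 <;> simp only [sub_add_eq_sub_sub, sub_sub_eq_add_sub, add_sub_right_comm]

theorem PreservesRatio.symm {ρ : ℝ} {e : ℤ ≃ ℤ} (h : PreservesRatio ρ e) :
    PreservesRatio ρ e.symm := by
  intro ω x
  have := h (fun z => ω (e.symm z)) (e.symm x)
  simpa using this.symm

variable {Λ : Finset ℤ}

theorem glue_apply_mem (τ : ℤ → Bool) (σ : Config Λ) (x : Λ) : glue τ σ x = σ x := by
  simp [glue]

theorem glue_apply_notMem (τ : ℤ → Bool) (σ : Config Λ) {y : ℤ} (hy : y ∉ Λ) :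
    glue τ σ y = τ y := by
  simp [glue, hy]

theorem glue_flipAt (τ : ℤ → Bool) (σ : Config Λ) (x : Λ) :
    glue τ (flipAt σ x) = Function.update (glue τ σ) x (!(σ x)) := by
  ext1 y
  by_cases hy : y ∈ Λ
  · by_cases hxy : y = x
    · subst hxy
      simp [glue, flipAt]
    · have : (⟨y, hy⟩ : Λ) ≠ x := fun h => hxy (congrArg Subtype.val h)
      simp [glue, flipAt, hy, hxy, this]
  · have hxy : y ≠ x := fun h => hy (h ▸ x.2)
    simp [glue, hy, hxy]

theorem flipRate_eq (ρ lam : ℝ) (τ : ℤ → Bool) (σ : Config Λ) (x : Λ) :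
    flipRate ρ lam τ σ x = if σ x then 1 / (1 + lam * siteRatio ρ (glue τ σ) x)
      else lam * siteRatio ρ (glue τ σ) x / (1 + lam * siteRatio ρ (glue τ σ) x) := rfl

theorem flipRate_nonneg {ρ lam : ℝ} (hρ : 0 < ρ) (hlam : 0 < lam) (τ : ℤ → Bool) (σ : Config Λ)
    (x : Λ) : 0 ≤ flipRate ρ lam τ σ x := by
  have := siteRatio_nonneg hρ (glue τ σ) x
  rw [flipRate_eq]
  split_ifs <;> positivity

theorem flipRate_le_one {ρ lam : ℝ} (hρ : 0 < ρ) (hlam : 0 < lam) (τ : ℤ → Bool) (σ : Config Λ)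
    (x : Λ) : flipRate ρ lam τ σ x ≤ 1 := by
  have := mul_nonneg hlam.le (siteRatio_nonneg hρ (glue τ σ) x)
  rw [flipRate_eq]
  split_ifs <;> rw [div_le_one (by linarith)] <;> linarith

/-- Attractiveness: more particles make creation easier and destruction harder. -/
theorem create_le_create {lam r s : ℝ} (hlam : 0 < lam) (hr : 0 ≤ r) (h : r ≤ s) :
    lam * r / (1 + lam * r) ≤ lam * s / (1 + lam * s) := by
  have h1 := mul_nonneg hlam.le hr
  have h2 := mul_le_mul_of_nonneg_left h hlam.le
  rw [div_le_div_iff₀ (by linarith) (by linarith)]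
  nlinarith

theorem destroy_le_destroy {lam r s : ℝ} (hlam : 0 < lam) (hr : 0 ≤ r) (h : r ≤ s) :
    1 / (1 + lam * s) ≤ 1 / (1 + lam * r) := by
  have h1 := mul_nonneg hlam.le hr
  have h2 := mul_le_mul_of_nonneg_left h hlam.le
  exact one_div_le_one_div_of_le (by linarith) (by linarith)

end Rates

/-! ### The monotone coupling -/

section Coupling

variable {Λ Λ' : Finset ℤ}

/-- The expectation at time `t` of the observable `f` for the dynamics started from `σ`. -/
noncomputable def evolve (ρ lam : ℝ) (Λ : Finset ℤ) (τ : ℤ → Bool) (t : ℝ) (f : Config Λ → ℝ)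
    (σ : Config Λ) : ℝ :=
  ∑ η, law ρ lam Λ τ t σ η * f η

/-- The occupation number of the site `x`. -/
def occ (x : Λ) (σ : Config Λ) : ℝ := if σ x then 1 else 0

/-- After composition with the bijection `e` of `ℤ`, the first configuration (completed by its
boundary condition) lies below the second one. -/
def Dominated (e : ℤ ≃ ℤ) (τ τ' : ℤ → Bool) (p : Config Λ × Config Λ') : Prop :=
  ∀ z : ℤ, glue τ p.1 (e z) ≤ glue τ' p.2 z

/-- The rate of simultaneous flips in the coupling: sites that correspond to each other and are in
the same state flip together as much as possible. -/
noncomputable def jointRate (ρ lam : ℝ) (e : ℤ ≃ ℤ) (τ τ' : ℤ → Bool) (x : Λ) (x' : Λ')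
    (p : Config Λ × Config Λ') : ℝ :=
  if (x : ℤ) = e x' ∧ p.1 x = p.2 x' then
    min (flipRate ρ lam τ p.1 x) (flipRate ρ lam τ' p.2 x') else 0

/-- The rates of the coupled dynamics: flips in the first configuration only, in the second one
only, and in both. -/
noncomputable def coupledRate (ρ lam : ℝ) (e : ℤ ≃ ℤ) (τ τ' : ℤ → Bool) :
    (Λ ⊕ Λ') ⊕ (Λ × Λ') → Config Λ × Config Λ' → ℝ
  | .inl (.inl x), p => flipRate ρ lam τ p.1 x - ∑ x' : Λ', jointRate ρ lam e τ τ' x x' p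
  | .inl (.inr x'), p => flipRate ρ lam τ' p.2 x' - ∑ x : Λ, jointRate ρ lam e τ τ' x x' p
  | .inr (x, x'), p => jointRate ρ lam e τ τ' x x' p

/-- The jumps of the coupled dynamics. -/
def coupledJump : (Λ ⊕ Λ') ⊕ (Λ × Λ') → Config Λ × Config Λ' → Config Λ × Config Λ'
  | .inl (.inl x), p => (flipAt p.1 x, p.2)
  | .inl (.inr x'), p => (p.1, flipAt p.2 x')
  | .inr (x, x'), p => (flipAt p.1 x, flipAt p.2 x')

theorem coupled_map_fst (ρ lam : ℝ) (e : ℤ ≃ ℤ) (τ τ' : ℤ → Bool) (t : ℝ) (f : Config Λ → ℝ)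
    (p : Config Λ × Config Λ') :
    ∑ q, NormedSpace.exp (t • jumpGen (coupledRate (Λ := Λ) (Λ' := Λ') ρ lam e τ τ')
      coupledJump) p q * f q.1 = evolve ρ lam Λ τ t f p.1 := by
  refine jumpGen_exp_map Prod.fst (fun f p => ?_) t f p
  simp only [Fintype.sum_sum_type, Fintype.sum_prod_type, coupledRate, coupledJump, sub_self,
    mul_zero, Finset.sum_const_zero, add_zero, ← Finset.sum_mul]
  rw [← Finset.sum_add_distrib]
  exact Finset.sum_congr rfl fun x _ => by ring

theorem coupled_map_snd (ρ lam : ℝ) (e : ℤ ≃ ℤ) (τ τ' : ℤ → Bool) (t : ℝ) (f : Config Λ' → ℝ)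
    (p : Config Λ × Config Λ') :
    ∑ q, NormedSpace.exp (t • jumpGen (coupledRate (Λ := Λ) (Λ' := Λ') ρ lam e τ τ')
      coupledJump) p q * f q.2 = evolve ρ lam Λ' τ' t f p.2 := by
  refine jumpGen_exp_map Prod.snd (fun f p => ?_) t f p
  simp only [Fintype.sum_sum_type, Fintype.sum_prod_type_right, coupledRate, coupledJump, sub_self,
    mul_zero, Finset.sum_const_zero, zero_add, ← Finset.sum_mul]
  rw [← Finset.sum_add_distrib]
  exact Finset.sum_congr rfl fun x _ => by ring

theorem jointRate_nonneg {ρ lam : ℝ} (hρ : 0 < ρ) (hlam : 0 < lam) (e : ℤ ≃ ℤ) (τ τ' : ℤ → Bool)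
    (x : Λ) (x' : Λ') (p : Config Λ × Config Λ') : 0 ≤ jointRate ρ lam e τ τ' x x' p := by
  unfold jointRate
  split_ifs
  · exact le_min (flipRate_nonneg hρ hlam _ _ _) (flipRate_nonneg hρ hlam _ _ _)
  · exact le_rfl

theorem sum_jointRate_snd {ρ lam : ℝ} {e : ℤ ≃ ℤ} {τ τ' : ℤ → Bool} {x : Λ} {x' : Λ'}
    (h : (x : ℤ) = e x') (p : Config Λ × Config Λ') :
    ∑ y : Λ', jointRate ρ lam e τ τ' x y p = jointRate ρ lam e τ τ' x x' p := by
  refine Finset.sum_eq_single x' (fun y _ hy => ?_) (by simp)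
  refine if_neg fun hh => hy (Subtype.ext (e.injective ?_))
  rw [← hh.1, h]

theorem sum_jointRate_fst {ρ lam : ℝ} {e : ℤ ≃ ℤ} {τ τ' : ℤ → Bool} {x : Λ} {x' : Λ'}
    (h : (x : ℤ) = e x') (p : Config Λ × Config Λ') :
    ∑ y : Λ, jointRate ρ lam e τ τ' y x' p = jointRate ρ lam e τ τ' x x' p := by
  refine Finset.sum_eq_single x (fun y _ hy => ?_) (by simp)
  refine if_neg fun hh => hy (Subtype.ext ?_)
  rw [hh.1, h]

theorem sum_jointRate_snd_le {ρ lam : ℝ} (hρ : 0 < ρ) (hlam : 0 < lam) (e : ℤ ≃ ℤ)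
    (τ τ' : ℤ → Bool) (x : Λ) (p : Config Λ × Config Λ') :
    ∑ y : Λ', jointRate ρ lam e τ τ' x y p ≤ flipRate ρ lam τ p.1 x := by
  by_cases h : ∃ x' : Λ', (x : ℤ) = e x'
  · obtain ⟨x', hx'⟩ := h
    rw [sum_jointRate_snd hx', jointRate]
    split_ifs
    · exact min_le_left _ _
    · exact flipRate_nonneg hρ hlam _ _ _
  · rw [Finset.sum_eq_zero]
    · exact flipRate_nonneg hρ hlam _ _ _
    · exact fun y _ => if_neg fun hh => h ⟨y, hh.1⟩

theorem sum_jointRate_fst_le {ρ lam : ℝ} (hρ : 0 < ρ) (hlam : 0 < lam) (e : ℤ ≃ ℤ)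
    (τ τ' : ℤ → Bool) (x' : Λ') (p : Config Λ × Config Λ') :
    ∑ y : Λ, jointRate ρ lam e τ τ' y x' p ≤ flipRate ρ lam τ' p.2 x' := by
  by_cases h : ∃ x : Λ, (x : ℤ) = e x'
  · obtain ⟨x, hx⟩ := h
    rw [sum_jointRate_fst hx, jointRate]
    split_ifs
    · exact min_le_right _ _
    · exact flipRate_nonneg hρ hlam _ _ _
  · rw [Finset.sum_eq_zero]
    · exact flipRate_nonneg hρ hlam _ _ _
    · exact fun y _ => if_neg fun hh => h ⟨y, hh.1⟩

theorem coupledRate_nonneg {ρ lam : ℝ} (hρ : 0 < ρ) (hlam : 0 < lam) (e : ℤ ≃ ℤ)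
    (τ τ' : ℤ → Bool) (j : (Λ ⊕ Λ') ⊕ (Λ × Λ')) (p : Config Λ × Config Λ') :
    0 ≤ coupledRate ρ lam e τ τ' j p := by
  match j with
  | .inl (.inl x) => exact sub_nonneg.2 (sum_jointRate_snd_le hρ hlam e τ τ' x p)
  | .inl (.inr x') => exact sub_nonneg.2 (sum_jointRate_fst_le hρ hlam e τ τ' x' p)
  | .inr (x, x') => exact jointRate_nonneg hρ hlam e τ τ' x x' p

theorem Dominated.siteRatio_le {ρ : ℝ} (hρ : 0 < ρ) {e : ℤ ≃ ℤ} (he : PreservesRatio ρ e)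
    {τ τ' : ℤ → Bool} {p : Config Λ × Config Λ'} (hp : Dominated e τ τ' p) (z : ℤ) :
    siteRatio ρ (glue τ p.1) (e z) ≤ siteRatio ρ (glue τ' p.2) z := by
  rw [← he]
  exact siteRatio_mono hρ hp z

/-- The coupled dynamics preserves the domination, provided that sites which are free in only one of
the two dynamics are frozen in the right state in the other. -/
theorem Dominated.jump {ρ lam : ℝ} (hρ : 0 < ρ) (hlam : 0 < lam) {e : ℤ ≃ ℤ}
    (he : PreservesRatio ρ e) {τ τ' : ℤ → Bool}
    (h1 : ∀ z, e z ∈ Λ → z ∉ Λ' → τ' z = true) (h2 : ∀ z ∈ Λ', e z ∉ Λ → τ (e z) = false)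
    {p : Config Λ × Config Λ'} (hp : Dominated e τ τ' p) (j : (Λ ⊕ Λ') ⊕ (Λ × Λ'))
    (hj : coupledRate ρ lam e τ τ' j p ≠ 0) : Dominated e τ τ' (coupledJump j p) := by
  obtain ⟨σ, σ'⟩ := p
  match j, hj with
  | .inl (.inl x), hj =>
    intro z
    simp only [coupledJump, glue_flipAt, Function.update_apply]
    split_ifs with hz
    · cases hx : σ x with
      | true => exact Bool.false_le _
      | false =>
        by_cases hz' : z ∈ Λ'
        · cases hx' : σ' ⟨z, hz'⟩ with
          | true => simp [glue, hz', hx']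
          | false =>
            refine absurd ?_ hj
            have hm : (x : ℤ) = e (⟨z, hz'⟩ : Λ') := hz.symm
            have hr := hp.siteRatio_le hρ he z
            rw [hz] at hr
            simp only [coupledRate]
            rw [sum_jointRate_snd hm, jointRate, if_pos ⟨hm, hx.trans hx'.symm⟩, min_eq_left, sub_self]
            simp only [flipRate_eq, hx, hx', Bool.false_eq_true, if_false]
            exact create_le_create hlam (siteRatio_nonneg hρ _ _) hr
        · rw [glue_apply_notMem _ _ hz', h1 z (hz ▸ x.2) hz']
          exact Bool.le_true _
    · exact hp z
  | .inl (.inr x'), hj =>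
    intro z
    simp only [coupledJump, glue_flipAt, Function.update_apply]
    split_ifs with hz
    · subst hz
      cases hx' : σ' x' with
      | false => exact Bool.le_true _
      | true =>
        by_cases hz' : e x' ∈ Λ
        · cases hx : σ ⟨e x', hz'⟩ with
          | false => simp [glue, hz', hx]
          | true =>
            refine absurd ?_ hj
            have hm : ((⟨e x', hz'⟩ : Λ) : ℤ) = e x' := rfl
            have hr := hp.siteRatio_le hρ he x'
            simp only [coupledRate]
            rw [sum_jointRate_fst hm, jointRate, if_pos ⟨hm, hx.trans hx'.symm⟩, min_eq_right,
              sub_self]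
            simp only [flipRate_eq, hx, hx', if_true]
            exact destroy_le_destroy hlam (siteRatio_nonneg hρ _ _) hr
        · rw [glue_apply_notMem _ _ hz', h2 _ x'.2 hz']
          exact Bool.false_le _
    · exact hp z
  | .inr (x, x'), hj =>
    have hm : (x : ℤ) = e x' ∧ σ x = σ' x' := by
      by_contra hh
      exact hj (if_neg hh)
    intro z
    simp only [coupledJump, glue_flipAt, Function.update_apply]
    by_cases hz : z = x'
    · rw [if_pos hz, if_pos (by rw [hz, hm.1]), hm.2]
    · rw [if_neg hz, if_neg fun h => hz (e.injective (h.trans hm.1))]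
      exact hp z

theorem Dominated.coupled_exp {ρ lam : ℝ} (hρ : 0 < ρ) (hlam : 0 < lam) {e : ℤ ≃ ℤ}
    (he : PreservesRatio ρ e) {τ τ' : ℤ → Bool}
    (h1 : ∀ z, e z ∈ Λ → z ∉ Λ' → τ' z = true) (h2 : ∀ z ∈ Λ', e z ∉ Λ → τ (e z) = false)
    {p : Config Λ × Config Λ'} (hp : Dominated e τ τ' p) {t : ℝ} (ht : 0 ≤ t)
    (q : Config Λ × Config Λ') :
    0 ≤ NormedSpace.exp (t • jumpGen (coupledRate (Λ := Λ) (Λ' := Λ') ρ lam e τ τ')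
      coupledJump) p q ∧
    (¬ Dominated e τ τ' q → NormedSpace.exp (t • jumpGen (coupledRate (Λ := Λ) (Λ' := Λ') ρ lam e
      τ τ') coupledJump) p q = 0) :=
  jumpGen_exp_of_invariant (O := {p | Dominated e τ τ' p})
    (fun p _ j => coupledRate_nonneg hρ hlam e τ τ' j p)
    (fun _ hp j hj => Dominated.jump hρ hlam he h1 h2 hp j hj) ht hp q

theorem Dominated.occ_le {e : ℤ ≃ ℤ} {τ τ' : ℤ → Bool} {p : Config Λ × Config Λ'}
    (hp : Dominated e τ τ' p) {x : Λ} {x' : Λ'} (hx : (x : ℤ) = e x') : occ x p.1 ≤ occ x' p.2 := by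
  have h := hp x'
  rw [← hx, glue_apply_mem, glue_apply_mem] at h
  unfold occ
  have h' := Bool.le_iff_imp.1 h
  cases h1 : p.1 x <;> cases h2 : p.2 x' <;> simp_all

/-- Comparison of two dynamics in different volumes: the occupation probability of a site is smaller
in the dominated dynamics. -/
theorem Dominated.evolve_occ_le {ρ lam : ℝ} (hρ : 0 < ρ) (hlam : 0 < lam) {e : ℤ ≃ ℤ}
    (he : PreservesRatio ρ e) {τ τ' : ℤ → Bool}
    (h1 : ∀ z, e z ∈ Λ → z ∉ Λ' → τ' z = true) (h2 : ∀ z ∈ Λ', e z ∉ Λ → τ (e z) = false)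
    {σ : Config Λ} {σ' : Config Λ'} (hp : Dominated e τ τ' (σ, σ')) {t : ℝ} (ht : 0 ≤ t)
    {x : Λ} {x' : Λ'} (hx : (x : ℤ) = e x') :
    evolve ρ lam Λ τ t (occ x) σ ≤ evolve ρ lam Λ' τ' t (occ x') σ' := by
  rw [← coupled_map_fst ρ lam e τ τ' t (occ x) (σ, σ'),
    ← coupled_map_snd ρ lam e τ τ' t (occ x') (σ, σ')]
  refine Finset.sum_le_sum fun q _ => ?_
  have h := hp.coupled_exp hρ hlam he h1 h2 ht q
  by_cases hq : Dominated e τ τ' q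
  · exact mul_le_mul_of_nonneg_left (hq.occ_le hx) h.1
  · rw [h.2 hq, zero_mul, zero_mul]

theorem dominated_refl_iff {τ : ℤ → Bool} {σ σ' : Config Λ} :
    Dominated (Equiv.refl ℤ) τ τ (σ, σ') ↔ σ ≤ σ' := by
  constructor
  · intro h x
    have := h x
    simpa [glue] using this
  · intro h z
    by_cases hz : z ∈ Λ
    · simpa [glue, hz] using h ⟨z, hz⟩
    · simp [glue, hz]

theorem preservesRatio_refl (ρ : ℝ) : PreservesRatio ρ (Equiv.refl ℤ) := fun _ _ => rfl

theorem evolve_occ_mono {ρ lam : ℝ} (hρ : 0 < ρ) (hlam : 0 < lam) (τ : ℤ → Bool)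
    {σ σ' : Config Λ} (h : σ ≤ σ') {t : ℝ} (ht : 0 ≤ t) (x : Λ) :
    evolve ρ lam Λ τ t (occ x) σ ≤ evolve ρ lam Λ τ t (occ x) σ' :=
  Dominated.evolve_occ_le hρ hlam (preservesRatio_refl ρ) (fun _ h h' => absurd h h')
    (fun _ h h' => absurd h h') (dominated_refl_iff.2 h) ht rfl

theorem hammingDist_eq_of_le {σ σ' : Config Λ} (h : σ ≤ σ') :
    (hammingDist σ σ' : ℝ) = ∑ x, (occ x σ' - occ x σ) := by
  classical
  rw [hammingDist, Finset.card_filter]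
  push_cast
  refine Finset.sum_congr rfl fun x _ => ?_
  have := Bool.le_iff_imp.1 (h x)
  unfold occ
  cases h1 : σ x <;> cases h2 : σ' x <;> simp_all

theorem kantorovich_comm_le (μ ν : Config Λ → ℝ) : kantorovich μ ν ≤ kantorovich ν μ := by
  refine le_iInf₂ fun γ hγ => iInf₂_le_of_le (fun x y => γ y x)
    ⟨fun x y => hγ.nonneg y x, hγ.snd, hγ.fst⟩ (le_of_eq ?_)
  rw [Finset.sum_comm]
  simp only [hammingDist_comm]

/-- For ordered initial configurations the Kantorovich distance is at most the difference of the
expected numbers of particles. -/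
theorem kantorovich_law_le {ρ lam : ℝ} (hρ : 0 < ρ) (hlam : 0 < lam) (τ : ℤ → Bool)
    {σ σ' : Config Λ} (h : σ ≤ σ') {t : ℝ} (ht : 0 ≤ t) :
    kantorovich (law ρ lam Λ τ t σ) (law ρ lam Λ τ t σ') ≤
      ENNReal.ofReal (∑ x, (evolve ρ lam Λ τ t (occ x) σ' - evolve ρ lam Λ τ t (occ x) σ)) := by
  set Q := NormedSpace.exp (t • jumpGen (coupledRate (Λ := Λ) (Λ' := Λ) ρ lam (Equiv.refl ℤ) τ τ)
      coupledJump) (σ, σ') with hQ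
  have hQ1 := fun q => Dominated.coupled_exp (Λ := Λ) (Λ' := Λ) hρ hlam (preservesRatio_refl ρ)
    (fun _ h h' => absurd h h') (fun _ h h' => absurd h h') (dominated_refl_iff (τ := τ).2 h) ht q
  have hf := fun f => coupled_map_fst (Λ := Λ) (Λ' := Λ) ρ lam (Equiv.refl ℤ) τ τ t f (σ, σ')
  have hs := fun f => coupled_map_snd (Λ := Λ) (Λ' := Λ) ρ lam (Equiv.refl ℤ) τ τ t f (σ, σ')
  rw [← hQ] at hQ1 hf hs
  refine iInf₂_le_of_le (fun η η' => Q (η, η')) ⟨fun η η' => (hQ1 _).1, fun η => ?_, fun η' => ?_⟩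
    (ENNReal.ofReal_le_ofReal (le_of_eq ?_))
  · have := hf (fun ξ => if ξ = η then 1 else 0)
    simpa [Fintype.sum_prod_type_right, evolve] using this
  · have := hs (fun ξ => if ξ = η' then 1 else 0)
    simpa [Fintype.sum_prod_type, evolve] using this
  · rw [← Fintype.sum_prod_type' (f := fun η η' => Q (η, η') * (hammingDist η η' : ℝ))]
    simp only [← hf, ← hs, ← Finset.sum_sub_distrib]
    rw [Finset.sum_comm]
    refine Finset.sum_congr rfl fun q _ => ?_
    by_cases hq : Dominated (Equiv.refl ℤ) τ τ q
    · rw [hammingDist_eq_of_le (dominated_refl_iff.1 hq), Finset.mul_sum]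
      exact Finset.sum_congr rfl fun x _ => by ring
    · simp [(hQ1 q).2 hq]

end Coupling

/-! ### Contraction in the Kantorovich distance -/

section Contraction

variable {Λ : Finset ℤ}

theorem abs_sum_sub_sum_le_of_kantorovich_le {μ ν : Config Λ → ℝ} {c : ℝ} (hc : 0 ≤ c)
    (h : kantorovich μ ν ≤ ENNReal.ofReal c) {f : Config Λ → ℝ} {a : ℝ} (ha : 0 < a)
    (hf : ∀ σ σ', |f σ - f σ'| ≤ a * hammingDist σ σ') :
    |∑ σ, μ σ * f σ - ∑ σ, ν σ * f σ| ≤ a * c := by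
  have key : ENNReal.ofReal (|∑ σ, μ σ * f σ - ∑ σ, ν σ * f σ| / a) ≤ kantorovich μ ν := by
    refine le_iInf₂ fun γ hγ => ENNReal.ofReal_le_ofReal ?_
    rw [div_le_iff₀ ha]
    have h1 : ∑ σ, μ σ * f σ = ∑ σ, ∑ σ', γ σ σ' * f σ :=
      Finset.sum_congr rfl fun σ _ => by rw [← hγ.fst, Finset.sum_mul]
    have h2 : ∑ σ, ν σ * f σ = ∑ σ, ∑ σ', γ σ σ' * f σ' := by
      rw [Finset.sum_comm]
      exact Finset.sum_congr rfl fun σ _ => by rw [← hγ.snd, Finset.sum_mul]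
    rw [h1, h2, ← Finset.sum_sub_distrib, Finset.sum_mul]
    refine (Finset.abs_sum_le_sum_abs _ _).trans (Finset.sum_le_sum fun σ _ => ?_)
    rw [← Finset.sum_sub_distrib, Finset.sum_mul]
    refine (Finset.abs_sum_le_sum_abs _ _).trans (Finset.sum_le_sum fun σ' _ => ?_)
    rw [← mul_sub, abs_mul, abs_of_nonneg (hγ.nonneg _ _), mul_assoc]
    refine mul_le_mul_of_nonneg_left ((hf σ σ').trans_eq (mul_comm _ _)) (hγ.nonneg _ _)
  have h3 := (ENNReal.ofReal_le_ofReal_iff hc).1 (key.trans h)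
  rw [div_le_iff₀ ha] at h3
  linarith

/-- A function on configurations is Lipschitz for the Hamming distance if it is so for pairs of
configurations that differ at one site. -/
theorem lipschitz_of_neighbours {g : Config Λ → ℝ} {b : ℝ}
    (h : ∀ σ σ' : Config Λ, hammingDist σ σ' = 1 → |g σ - g σ'| ≤ b) (σ σ' : Config Λ) :
    |g σ - g σ'| ≤ b * hammingDist σ σ' := by
  induction hn : hammingDist σ σ' generalizing σ with
  | zero =>
    rw [hammingDist_eq_zero.1 hn]
    simp
  | succ n ih =>
    have hne : σ ≠ σ' := fun hh => by simp [hh] at hn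
    obtain ⟨x, hx⟩ := Function.ne_iff.1 hne
    set ρ := Function.update σ x (σ' x) with hρ
    have h1 : hammingDist σ ρ = 1 := by
      rw [hammingDist, Finset.card_eq_one]
      refine ⟨x, ?_⟩
      ext y
      simp only [Finset.mem_filter, Finset.mem_univ, true_and, Finset.mem_singleton, hρ,
        Function.update_apply]
      split_ifs with hy
      · subst hy; simpa using hx
      · simpa using hy
    have h2 : hammingDist ρ σ' = n := by
      have : (Finset.univ.filter fun y => ρ y ≠ σ' y) =
          (Finset.univ.filter fun y => σ y ≠ σ' y).erase x := by
        ext y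
        simp only [Finset.mem_filter, Finset.mem_univ, true_and, Finset.mem_erase, hρ,
          Function.update_apply]
        split_ifs with hy
        · subst hy; simp
        · simp [hy]
      rw [hammingDist, this, Finset.card_erase_of_mem (by simpa using hx)]
      rw [hammingDist] at hn
      omega
    have h3 := ih ρ h2
    have h4 := h σ ρ h1
    have h5 := abs_sub_le (g σ) (g ρ) (g σ')
    push_cast
    linarith

theorem law_nonneg {ρ lam : ℝ} (hρ : 0 < ρ) (hlam : 0 < lam) (τ : ℤ → Bool) {t : ℝ} (ht : 0 ≤ t)
    (σ η : Config Λ) : 0 ≤ law ρ lam Λ τ t σ η :=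
  (jumpGen_exp_of_invariant (O := Set.univ) (fun p _ j => flipRate_nonneg hρ hlam τ p j)
    (fun _ _ _ _ => Set.mem_univ _) ht (Set.mem_univ σ) η).1

theorem sum_law (ρ lam : ℝ) (τ : ℤ → Bool) (t : ℝ) (σ : Config Λ) :
    ∑ η, law ρ lam Λ τ t σ η = 1 :=
  sum_jumpGen_exp _ _ t σ

theorem evolve_add (ρ lam : ℝ) (τ : ℤ → Bool) (s t : ℝ) (f : Config Λ → ℝ) :
    evolve ρ lam Λ τ (s + t) f = evolve ρ lam Λ τ s (evolve ρ lam Λ τ t f) := by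
  ext σ
  simp only [evolve, law, matrix_exp_add_smul, Matrix.mul_apply, Finset.sum_mul, Finset.mul_sum]
  rw [Finset.sum_comm]
  simp only [mul_assoc]

theorem evolve_le {ρ lam : ℝ} (hρ : 0 < ρ) (hlam : 0 < lam) (τ : ℤ → Bool) {t : ℝ} (ht : 0 ≤ t)
    {f : Config Λ → ℝ} {b : ℝ} (h : ∀ σ, f σ ≤ b) (σ : Config Λ) :
    evolve ρ lam Λ τ t f σ ≤ b := by
  calc evolve ρ lam Λ τ t f σ ≤ ∑ η, law ρ lam Λ τ t σ η * b :=
        Finset.sum_le_sum fun η _ => mul_le_mul_of_nonneg_left (h η) (law_nonneg hρ hlam τ ht σ η)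
    _ = b := by rw [← Finset.sum_mul, sum_law, one_mul]

theorem le_evolve {ρ lam : ℝ} (hρ : 0 < ρ) (hlam : 0 < lam) (τ : ℤ → Bool) {t : ℝ} (ht : 0 ≤ t)
    {f : Config Λ → ℝ} {b : ℝ} (h : ∀ σ, b ≤ f σ) (σ : Config Λ) :
    b ≤ evolve ρ lam Λ τ t f σ := by
  calc b = ∑ η, law ρ lam Λ τ t σ η * b := by rw [← Finset.sum_mul, sum_law, one_mul]
    _ ≤ evolve ρ lam Λ τ t f σ :=
        Finset.sum_le_sum fun η _ => mul_le_mul_of_nonneg_left (h η) (law_nonneg hρ hlam τ ht σ η)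

theorem occ_nonneg (x : Λ) (σ : Config Λ) : 0 ≤ occ x σ := by
  unfold occ; split_ifs <;> norm_num

theorem occ_le_one (x : Λ) (σ : Config Λ) : occ x σ ≤ 1 := by
  unfold occ; split_ifs <;> norm_num

/-- `t` is admissible in the definition of the contraction time, with threshold `c`. -/
def ContractsAt (ρ lam : ℝ) (Λ : Finset ℤ) (τ : ℤ → Bool) (c t : ℝ) : Prop :=
  0 < t ∧ (⨆ (σ : Config Λ) (σ' : Config Λ) (_ : hammingDist σ σ' = 1),
    kantorovich (law ρ lam Λ τ t σ) (law ρ lam Λ τ t σ')) ≤ ENNReal.ofReal c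

theorem ContractsAt.lipschitz_evolve {ρ lam : ℝ} {τ : ℤ → Bool} {c t : ℝ} (hc : 0 < c)
    (h : ContractsAt ρ lam Λ τ c t) {f : Config Λ → ℝ} {a : ℝ} (ha : 0 < a)
    (hf : ∀ σ σ', |f σ - f σ'| ≤ a * hammingDist σ σ') (σ σ' : Config Λ) :
    |evolve ρ lam Λ τ t f σ - evolve ρ lam Λ τ t f σ'| ≤ a * c * hammingDist σ σ' := by
  refine lipschitz_of_neighbours (fun η η' hη => ?_) σ σ'
  refine abs_sum_sub_sum_le_of_kantorovich_le hc.le ?_ ha hf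
  exact iSup_le_iff.1 (iSup_le_iff.1 (iSup_le_iff.1 h.2 η) η') hη

theorem ContractsAt.lipschitz_iterate {ρ lam : ℝ} {τ : ℤ → Bool} {c t : ℝ} (hc : 0 < c)
    (h : ContractsAt ρ lam Λ τ c t) {f : Config Λ → ℝ}
    (hf : ∀ σ σ', |f σ - f σ'| ≤ 1 * hammingDist σ σ') (j : ℕ) (σ σ' : Config Λ) :
    |evolve ρ lam Λ τ (j * t) f σ - evolve ρ lam Λ τ (j * t) f σ'| ≤ c ^ j * hammingDist σ σ' := by
  induction j generalizing σ σ' with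
  | zero =>
    have h0 : evolve ρ lam Λ τ ((0 : ℕ) * t) f = f := by
      ext σ
      simp [evolve, law, Matrix.one_apply]
    rw [h0]
    simpa using hf σ σ'
  | succ j ih =>
    have : ((j + 1 : ℕ) : ℝ) * t = t + j * t := by push_cast; ring
    rw [this, evolve_add, pow_succ]
    exact h.lipschitz_evolve hc (by positivity) ih σ σ'

/-- After `j` contraction times the occupation probability of a site has forgotten the initial
condition up to the error `|Λ| c ^ j`. Times that are no multiples of the contraction time do no
harm, since occupation probabilities lie between `0` and `1`. -/
theorem ContractsAt.osc_evolve_occ {ρ lam : ℝ} (hρ : 0 < ρ) (hlam : 0 < lam) {τ : ℤ → Bool}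
    {c t₀ t : ℝ} (hc : 0 < c) (h : ContractsAt ρ lam Λ τ c t₀) {j : ℕ} (ht : j * t₀ ≤ t) (x : Λ)
    (σ σ' : Config Λ) :
    |evolve ρ lam Λ τ t (occ x) σ - evolve ρ lam Λ τ t (occ x) σ'| ≤ c ^ j * Λ.card := by
  have hs : 0 ≤ t - j * t₀ := by linarith
  have h1 : evolve ρ lam Λ τ t (occ x) =
      evolve ρ lam Λ τ (j * t₀) (evolve ρ lam Λ τ (t - j * t₀) (occ x)) := by
    rw [← evolve_add]; congr 1; ring
  rw [h1]
  refine (h.lipschitz_iterate hc (fun η η' => ?_) j σ σ').trans ?_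
  · by_cases hη : η = η'
    · simp [hη]
    · have h2 := le_evolve hρ hlam τ hs (occ_nonneg x) η
      have h3 := le_evolve hρ hlam τ hs (occ_nonneg x) η'
      have h4 := evolve_le hρ hlam τ hs (occ_le_one x) η
      have h5 := evolve_le hρ hlam τ hs (occ_le_one x) η'
      have h6 : (1 : ℝ) ≤ hammingDist η η' := by
        exact_mod_cast Nat.one_le_iff_ne_zero.2 (hammingDist_ne_zero.2 hη)
      rw [one_mul]
      exact (abs_sub_le_iff.2 ⟨by linarith, by linarith⟩).trans h6
  · refine mul_le_mul_of_nonneg_left ?_ (by positivity)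
    have := hammingDist_le_card_fintype (x := σ) (y := σ')
    simp only [Fintype.card_coe] at this
    exact_mod_cast this

theorem contractionTimeLen_eq (ρ lam β : ℝ) (n : ℕ) :
    contractionTimeLen ρ lam β n = ⨆ τ : ℤ → Bool, ⨅ (t : ℝ)
      (_ : ContractsAt ρ lam (Finset.Icc 1 (n : ℤ)) τ (1 / (n : ℝ) ^ β) t), ENNReal.ofReal t := by
  simp [contractionTimeLen, contractionTime, contractionTimeBC, ContractsAt]

theorem exists_contractsAt {ρ lam β : ℝ} {n : ℕ} (hT : contractionTimeLen ρ lam β n < ∞) {ε : ℝ}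
    (hε : 0 < ε) (τ : ℤ → Bool) :
    ∃ t, t ≤ (contractionTimeLen ρ lam β n).toReal + ε ∧
      ContractsAt ρ lam (Finset.Icc 1 (n : ℤ)) τ (1 / (n : ℝ) ^ β) t := by
  have h1 : (⨅ (t : ℝ) (_ : ContractsAt ρ lam (Finset.Icc 1 (n : ℤ)) τ (1 / (n : ℝ) ^ β) t),
      ENNReal.ofReal t) < ENNReal.ofReal ((contractionTimeLen ρ lam β n).toReal + ε) := by
    calc _ ≤ contractionTimeLen ρ lam β n := by
          rw [contractionTimeLen_eq]
          exact le_iSup (f := fun τ : ℤ → Bool => ⨅ (t : ℝ)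
            (_ : ContractsAt ρ lam (Finset.Icc 1 (n : ℤ)) τ (1 / (n : ℝ) ^ β) t),
              ENNReal.ofReal t) τ
      _ = ENNReal.ofReal (contractionTimeLen ρ lam β n).toReal := (ENNReal.ofReal_toReal hT.ne).symm
      _ < _ := (ENNReal.ofReal_lt_ofReal_iff (by positivity)).2 (by linarith)
  obtain ⟨t, ht⟩ := iInf_lt_iff.1 h1
  obtain ⟨ht', ht''⟩ := iInf_lt_iff.1 ht
  exact ⟨t, ((ENNReal.ofReal_lt_ofReal_iff (by positivity)).1 ht'').le, ht'⟩

theorem contractionTimeLen_le {ρ lam β : ℝ} {n : ℕ} {t : ℝ}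
    (h : ∀ τ, ContractsAt ρ lam (Finset.Icc 1 (n : ℤ)) τ (1 / (n : ℝ) ^ β) t) :
    contractionTimeLen ρ lam β n ≤ ENNReal.ofReal t := by
  rw [contractionTimeLen_eq]
  exact iSup_le fun τ => iInf₂_le t (h τ)

/-- A sufficient condition for contraction in terms of occupation probabilities. -/
theorem contractsAt_of_evolve_occ {ρ lam : ℝ} (hρ : 0 < ρ) (hlam : 0 < lam) {τ : ℤ → Bool} {c t : ℝ}
    (ht : 0 < t) (h : ∑ x : Λ, (evolve ρ lam Λ τ t (occ x) (fun _ => true) -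
      evolve ρ lam Λ τ t (occ x) (fun _ => false)) ≤ c) : ContractsAt ρ lam Λ τ c t := by
  refine ⟨ht, ?_⟩
  have key : ∀ σ σ' : Config Λ, σ ≤ σ' → kantorovich (law ρ lam Λ τ t σ) (law ρ lam Λ τ t σ') ≤
      ENNReal.ofReal c := by
    intro σ σ' hσ
    refine (kantorovich_law_le hρ hlam τ hσ ht.le).trans (ENNReal.ofReal_le_ofReal
      ((Finset.sum_le_sum fun x _ => ?_).trans h))
    have h1 := evolve_occ_mono hρ hlam τ (show σ' ≤ fun _ => true from fun _ => Bool.le_true _)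
      ht.le x
    have h2 := evolve_occ_mono hρ hlam τ (show (fun _ => false) ≤ σ from fun _ => Bool.false_le _)
      ht.le x
    linarith
  refine iSup_le fun σ => iSup_le fun σ' => iSup_le fun hσ => ?_
  have hσ' : σ ≤ σ' ∨ σ' ≤ σ := by
    rw [hammingDist, Finset.card_eq_one] at hσ
    obtain ⟨x, hx⟩ := hσ
    have hy : ∀ y, y ≠ x → σ y = σ' y := by
      intro y hy
      by_contra hh
      have : y ∈ ({x} : Finset Λ) := hx ▸ (by simpa using hh)
      exact hy (by simpa using this)
    rcases le_total (σ x) (σ' x) with hxx | hxx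
    · left; intro y
      by_cases hyx : y = x
      · rw [hyx]; exact hxx
      · exact (hy y hyx).le
    · right; intro y
      by_cases hyx : y = x
      · rw [hyx]; exact hxx
      · exact (hy y hyx).ge
  rcases hσ' with hh | hh
  · exact key _ _ hh
  · exact (kantorovich_comm_le _ _).trans (key _ _ hh)

end Contraction

/-! ### Finiteness of the contraction time -/

section Finiteness

variable {Λ : Finset ℤ}

theorem flipAt_ne (σ : Config Λ) (x : Λ) : flipAt σ x ≠ σ := by
  intro h
  have := congrFun h x
  simp [flipAt] at this

theorem generator_apply_ne (ρ lam : ℝ) (τ : ℤ → Bool) {σ η : Config Λ} (h : η ≠ σ) :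
    generator ρ lam Λ τ σ η = ∑ x : Λ, if η = flipAt σ x then flipRate ρ lam τ σ x else 0 := by
  simp [generator, h]

theorem generator_apply_self (ρ lam : ℝ) (τ : ℤ → Bool) (σ : Config Λ) :
    generator ρ lam Λ τ σ σ = - ∑ x : Λ, flipRate ρ lam τ σ x := by
  simp [generator, (flipAt_ne σ _).symm]

theorem generator_add_smul_one_nonneg {ρ lam : ℝ} (hρ : 0 < ρ) (hlam : 0 < lam) (τ : ℤ → Bool)
    (σ η : Config Λ) :
    0 ≤ (generator ρ lam Λ τ + ((Λ.card : ℝ) + 1) • (1 : Matrix (Config Λ) (Config Λ) ℝ)) σ η ∧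
    1 ≤ (generator ρ lam Λ τ + ((Λ.card : ℝ) + 1) • (1 : Matrix (Config Λ) (Config Λ) ℝ)) σ σ := by
  have h1 : 1 ≤ (generator ρ lam Λ τ +
      ((Λ.card : ℝ) + 1) • (1 : Matrix (Config Λ) (Config Λ) ℝ)) σ σ := by
    have : ∑ x : Λ, flipRate ρ lam τ σ x ≤ Λ.card := by
      calc _ ≤ ∑ x : Λ, (1 : ℝ) := Finset.sum_le_sum fun x _ => flipRate_le_one hρ hlam τ σ x
        _ = Λ.card := by simp
    simp only [Matrix.add_apply, Matrix.smul_apply, Matrix.one_apply_eq, smul_eq_mul, mul_one,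
      generator_apply_self]
    linarith
  refine ⟨?_, h1⟩
  by_cases h : η = σ
  · subst h; linarith
  · simp only [Matrix.add_apply, Matrix.smul_apply, Matrix.one_apply_ne' h, smul_zero, add_zero,
      generator_apply_ne ρ lam τ h]
    refine Finset.sum_nonneg fun x _ => ?_
    split_ifs
    · exact flipRate_nonneg hρ hlam τ σ x
    · exact le_rfl

theorem pow_le_generator_pow_apply {ρ lam : ℝ} (hρ : 0 < ρ) (hρ1 : ρ < 1) (hlam : 0 < lam)
    (τ : ℤ → Bool) (j : ℕ) (σ : Config Λ) (hj : (Finset.univ.filter fun x => σ x = true).card ≤ j) :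
    (1 / (1 + lam * 4)) ^ j ≤ ((generator ρ lam Λ τ +
      ((Λ.card : ℝ) + 1) • (1 : Matrix (Config Λ) (Config Λ) ℝ)) ^ j) σ fun _ => false := by
  set M := generator ρ lam Λ τ + ((Λ.card : ℝ) + 1) • (1 : Matrix (Config Λ) (Config Λ) ℝ) with hM
  have hM0 : ∀ σ η, 0 ≤ M σ η := fun σ η => (generator_add_smul_one_nonneg hρ hlam τ σ η).1
  have hM1 : ∀ σ, 1 ≤ M σ σ := fun σ => (generator_add_smul_one_nonneg hρ hlam τ σ σ).2
  have hMp : ∀ (j : ℕ) σ η, 0 ≤ (M ^ j) σ η := matrix_pow_apply_nonneg hM0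
  have hδ : (0 : ℝ) < 1 / (1 + lam * 4) := by positivity
  have hδ1 : (1 : ℝ) / (1 + lam * 4) ≤ 1 := by
    rw [div_le_one (by positivity)]; linarith
  induction j generalizing σ with
  | zero =>
    have : σ = fun _ => false := by
      ext x
      rw [Nat.le_zero, Finset.card_eq_zero, Finset.filter_eq_empty_iff] at hj
      simpa using hj (Finset.mem_univ x)
    rw [this]
    simp
  | succ j ih =>
    -- One step removes a particle if there is one, and stays put otherwise.
    obtain ⟨ξ, hξ, hcard⟩ : ∃ ξ, 1 / (1 + lam * 4) ≤ M σ ξ ∧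
        (Finset.univ.filter fun x => ξ x = true).card ≤ j := by
      by_cases h : ∃ x, σ x = true
      · obtain ⟨x, hx⟩ := h
        refine ⟨flipAt σ x, ?_, ?_⟩
        · have hne := flipAt_ne σ x
          simp only [hM, Matrix.add_apply, Matrix.smul_apply, Matrix.one_apply_ne' hne, smul_zero,
            add_zero, generator_apply_ne ρ lam τ hne]
          refine le_trans ?_ (Finset.single_le_sum (f := fun y => if flipAt σ x = flipAt σ y then
            flipRate ρ lam τ σ y else 0) (fun y _ => ?_) (Finset.mem_univ x))
          · rw [if_pos rfl, flipRate_eq, if_pos hx]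
            exact destroy_le_destroy hlam (siteRatio_nonneg hρ _ _) (siteRatio_le_four hρ hρ1 _ _)
          · split_ifs
            · exact flipRate_nonneg hρ hlam τ σ y
            · exact le_rfl
        · have : (Finset.univ.filter fun y => flipAt σ x y = true) =
              (Finset.univ.filter fun y => σ y = true).erase x := by
            ext y
            simp only [Finset.mem_filter, Finset.mem_univ, true_and, Finset.mem_erase, flipAt,
              Function.update_apply]
            split_ifs with hy
            · subst hy; simp [hx]
            · simp [hy]
          rw [this, Finset.card_erase_of_mem (by simpa using hx)]
          omega
      · refine ⟨σ, hδ1.trans (hM1 σ), ?_⟩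
        have : (Finset.univ.filter fun y => σ y = true) = ∅ := by
          rw [Finset.filter_eq_empty_iff]
          exact fun y _ hy => h ⟨y, hy⟩
        rw [this]
        simp
    rw [pow_succ', pow_succ', Matrix.mul_apply]
    calc _ ≤ M σ ξ * (M ^ j) ξ fun _ => false :=
          mul_le_mul hξ (ih ξ hcard) (by positivity) (hM0 _ _)
      _ ≤ _ := Finset.single_le_sum (f := fun ξ => M σ ξ * (M ^ j) ξ fun _ => false)
          (fun ξ _ => mul_nonneg (hM0 _ _) (hMp _ _ _)) (Finset.mem_univ ξ)

/-- The empty configuration is reached within time one with a probability that is bounded below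
uniformly in the boundary condition. -/
theorem exists_le_law_empty {ρ lam : ℝ} (hρ : 0 < ρ) (hρ1 : ρ < 1) (hlam : 0 < lam)
    (Λ : Finset ℤ) : ∃ c : ℝ, 0 < c ∧ ∀ (τ : ℤ → Bool) (σ : Config Λ),
      c ≤ law ρ lam Λ τ 1 σ fun _ => false := by
  refine ⟨Real.exp (-((Λ.card : ℝ) + 1)) * (((Λ.card.factorial : ℝ)⁻¹) *
    (1 / (1 + lam * 4)) ^ Λ.card), by positivity, fun τ σ => ?_⟩
  rw [law, one_smul, matrix_exp_eq_exp_neg_smul _ ((Λ.card : ℝ) + 1), Matrix.smul_apply,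
    smul_eq_mul]
  refine mul_le_mul_of_nonneg_left ?_ (Real.exp_pos _).le
  set M := generator ρ lam Λ τ + ((Λ.card : ℝ) + 1) • (1 : Matrix (Config Λ) (Config Λ) ℝ) with hM
  have hMp : ∀ (j : ℕ) σ η, 0 ≤ (M ^ j) σ η :=
    matrix_pow_apply_nonneg fun σ η => (generator_add_smul_one_nonneg hρ hlam τ σ η).1
  have h1 := hasSum_matrix_exp_apply M σ fun _ => false
  refine le_trans ?_ (le_hasSum h1 Λ.card fun n _ => mul_nonneg (by positivity) (hMp _ _ _))
  refine mul_le_mul_of_nonneg_left (pow_le_generator_pow_apply hρ hρ1 hlam τ _ σ ?_) (by positivity)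
  exact (Finset.card_le_univ _).trans_eq (Fintype.card_coe Λ)

/-- Doeblin's argument: two chains that have both reached the empty configuration have met. -/
theorem evolve_sub_evolve_le {ρ lam : ℝ} (hρ : 0 < ρ) (hlam : 0 < lam) {τ : ℤ → Bool} {c t : ℝ}
    (ht : 0 ≤ t) (hc : 0 < c) (h : ∀ σ : Config Λ, c ≤ law ρ lam Λ τ t σ fun _ => false)
    {f : Config Λ → ℝ} {D : ℝ} (hD : 0 ≤ D) (hf : ∀ σ σ', f σ - f σ' ≤ D) (σ σ' : Config Λ) :
    evolve ρ lam Λ τ t f σ - evolve ρ lam Λ τ t f σ' ≤ (1 - c ^ 2) * D := by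
  classical
  set p := law ρ lam Λ τ t σ with hp
  set p' := law ρ lam Λ τ t σ' with hp'
  have hp0 : ∀ η, 0 ≤ p η := law_nonneg hρ hlam τ ht σ
  have hp0' : ∀ η, 0 ≤ p' η := law_nonneg hρ hlam τ ht σ'
  have hp1 : ∑ η, p η = 1 := sum_law ρ lam τ t σ
  have hp1' : ∑ η, p' η = 1 := sum_law ρ lam τ t σ'
  set o : Config Λ := fun _ => false with ho
  have e1 : evolve ρ lam Λ τ t f σ - evolve ρ lam Λ τ t f σ' =
      ∑ η, ∑ η', p η * p' η' * (f η - f η') := by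
    have a1 : evolve ρ lam Λ τ t f σ = ∑ η, ∑ η', p η * p' η' * f η := by
      refine Finset.sum_congr rfl fun η _ => ?_
      rw [← Finset.sum_mul, ← Finset.mul_sum, hp1', mul_one]
    have a2 : evolve ρ lam Λ τ t f σ' = ∑ η, ∑ η', p η * p' η' * f η' := by
      simp only [mul_assoc, ← Finset.mul_sum]
      rw [← Finset.sum_mul, hp1, one_mul]
      rfl
    rw [a1, a2]
    simp only [← Finset.sum_sub_distrib, mul_sub]
  have e2 : ∑ η, ∑ η', p η * p' η' * (f η - f η') ≤
      ∑ η, ∑ η', (p η * p' η' * D - if η = o ∧ η' = o then p o * p' o * D else 0) := by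
    refine Finset.sum_le_sum fun η _ => Finset.sum_le_sum fun η' _ => ?_
    split_ifs with hh
    · rw [hh.1, hh.2]; simp
    · rw [sub_zero]
      exact mul_le_mul_of_nonneg_left (hf _ _) (mul_nonneg (hp0 _) (hp0' _))
  have e3 : ∑ η, ∑ η', (p η * p' η' * D - if η = o ∧ η' = o then p o * p' o * D else 0) =
      D - p o * p' o * D := by
    simp only [Finset.sum_sub_distrib, ← Finset.sum_mul, ← Finset.mul_sum, hp1', mul_one, hp1,
      one_mul, ite_and]
    simp
  have e4 : c ^ 2 ≤ p o * p' o := by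
    rw [sq]
    exact mul_le_mul (h σ) (h σ') hc.le (hp0 _)
  rw [e1]
  refine e2.trans (e3.trans_le ?_)
  nlinarith

theorem contractionTimeLen_lt_top {ρ lam : ℝ} (hρ : 0 < ρ) (hρ1 : ρ < 1) (hlam : 0 < lam) (β : ℝ)
    {n : ℕ} (hn : 1 ≤ n) : contractionTimeLen ρ lam β n < ∞ := by
  obtain ⟨c, hc, h⟩ := exists_le_law_empty hρ hρ1 hlam (Finset.Icc 1 (n : ℤ))
  have hn' : (0 : ℝ) < n := by exact_mod_cast hn
  have hc1 : c ≤ 1 := by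
    refine (h (fun _ => false) fun _ => false).trans ?_
    refine le_trans ?_ (sum_law (Λ := Finset.Icc 1 (n : ℤ)) ρ lam (fun _ => false) 1
      fun _ => false).le
    exact Finset.single_le_sum (fun η _ => law_nonneg hρ hlam _ zero_le_one _ η) (Finset.mem_univ _)
  have hq0 : 0 ≤ 1 - c ^ 2 := by nlinarith
  have hq1 : 1 - c ^ 2 < 1 := by nlinarith
  obtain ⟨j, hj⟩ := exists_pow_lt_of_lt_one (show 0 < 1 / (n : ℝ) ^ β / n by positivity) hq1
  have key : ∀ (τ : ℤ → Bool) (j : ℕ) (x : Finset.Icc 1 (n : ℤ)) σ σ',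
      evolve ρ lam (Finset.Icc 1 (n : ℤ)) τ j (occ x) σ -
        evolve ρ lam (Finset.Icc 1 (n : ℤ)) τ j (occ x) σ' ≤ (1 - c ^ 2) ^ j := by
    intro τ j x
    induction j with
    | zero =>
      intro σ σ'
      have h0 : evolve ρ lam (Finset.Icc 1 (n : ℤ)) τ (0 : ℕ) (occ x) = occ x := by
        ext σ
        simp [evolve, law, Matrix.one_apply]
      rw [h0, pow_zero]
      linarith [occ_nonneg x σ', occ_le_one x σ]
    | succ j ih =>
      intro σ σ'
      have e : ((j + 1 : ℕ) : ℝ) = 1 + j := by push_cast; ring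
      rw [e, evolve_add, pow_succ']
      exact evolve_sub_evolve_le hρ hlam zero_le_one hc (h τ) (pow_nonneg hq0 _) ih σ σ'
  refine (contractionTimeLen_le (t := ((j + 1 : ℕ) : ℝ)) fun τ =>
    contractsAt_of_evolve_occ hρ hlam (by positivity) ?_).trans_lt ENNReal.ofReal_lt_top
  calc _ ≤ ∑ x : Finset.Icc 1 (n : ℤ), (1 - c ^ 2) ^ (j + 1) :=
        Finset.sum_le_sum fun x _ => key τ (j + 1) x _ _
    _ = n * (1 - c ^ 2) ^ (j + 1) := by simp
    _ ≤ n * (1 / (n : ℝ) ^ β / n) := by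
        gcongr
        refine le_trans ?_ hj.le
        rw [pow_succ]
        exact mul_le_of_le_one_right (pow_nonneg hq0 _) hq1.le
    _ = 1 / (n : ℝ) ^ β := by field_simp

end Finiteness

/-! ### The reversible measure -/

section Scan

/-- `renewalK` at an integer distance. -/
noncomputable def distK (ρ : ℝ) (d : ℤ) : ℝ := renewalK ρ d.toNat

theorem distK_pos {ρ : ℝ} (hρ : 0 < ρ) {d : ℤ} (hd : 0 < d) : 0 < distK ρ d :=
  renewalK_pos hρ (by omega)

theorem distK_nonneg {ρ : ℝ} (hρ : 0 < ρ) (d : ℤ) : 0 ≤ distK ρ d := renewalK_nonneg hρ _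

/-- The weight of the particles of `ω` in the sites `q, …, q + n - 1` when the last particle before
`q` is at `p`: each particle contributes `lam` times `K` of the distance to the previous particle,
and the position of the very last particle contributes the factor `g`. -/
noncomputable def scanWeight (ρ lam : ℝ) (g : ℤ → ℝ) (ω : ℤ → Bool) : ℤ → ℤ → ℕ → ℝ
  | p, _, 0 => g p
  | p, q, n + 1 => if ω q then lam * distK ρ (q - p) * scanWeight ρ lam g ω q (q + 1) n
      else scanWeight ρ lam g ω p (q + 1) n

/-- The sum of `scanWeight` over all configurations in `q, …, q + n - 1`, with an extra factor `b x`
for each occupied site `x` and `a x` for each empty one. -/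
noncomputable def scanSum (ρ lam : ℝ) (a b : ℤ → ℝ) (g : ℤ → ℝ) : ℤ → ℤ → ℕ → ℝ
  | p, _, 0 => g p
  | p, q, n + 1 => a q * scanSum ρ lam a b g p (q + 1) n +
      b q * (lam * distK ρ (q - p)) * scanSum ρ lam a b g q (q + 1) n

theorem scanWeight_congr (ρ lam : ℝ) (g : ℤ → ℝ) {ω ω' : ℤ → Bool} {q : ℤ} {n : ℕ}
    (h : ∀ z, q ≤ z → z < q + n → ω z = ω' z) (p : ℤ) :
    scanWeight ρ lam g ω p q n = scanWeight ρ lam g ω' p q n := by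
  induction n generalizing p q with
  | zero => rfl
  | succ n ih =>
    have h' : ∀ z, q + 1 ≤ z → z < q + 1 + n → ω z = ω' z :=
      fun z h1 h2 => h z (by omega) (by push_cast; omega)
    rw [scanWeight, scanWeight, h q le_rfl (by push_cast; omega), ih h', ih h']

theorem scanWeight_pos {ρ lam : ℝ} (hρ : 0 < ρ) (hlam : 0 < lam) {g : ℤ → ℝ} {q : ℤ} {n : ℕ} {p : ℤ}
    (hp : p < q) (hg : ∀ u, u < q + n → 0 < g u) (ω : ℤ → Bool) :
    0 < scanWeight ρ lam g ω p q n := by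
  induction n generalizing p q with
  | zero => exact hg p (by simpa using hp)
  | succ n ih =>
    have hg' : ∀ u, u < q + 1 + n → 0 < g u := fun u hu => hg u (by push_cast; omega)
    rw [scanWeight]
    split_ifs
    · have := distK_pos hρ (show 0 < q - p by omega)
      have := ih (lt_add_one q) hg'
      positivity
    · exact ih (by omega) hg'

theorem sum_powerset_scanWeight (ρ lam : ℝ) (a b g : ℤ → ℝ) (p q : ℤ) (n : ℕ) :
    ∑ S ∈ (Finset.Ico q (q + n)).powerset, scanWeight ρ lam g (fun z => decide (z ∈ S)) p q n *
      ∏ x ∈ Finset.Ico q (q + n), (if x ∈ S then b x else a x) = scanSum ρ lam a b g p q n := by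
  induction n generalizing p q with
  | zero => simp [scanWeight, scanSum]
  | succ n ih =>
    have hI : Finset.Ico q (q + (n + 1 : ℕ)) = insert q (Finset.Ico (q + 1) (q + 1 + n)) := by
      ext z
      simp only [Finset.mem_Ico, Finset.mem_insert]
      push_cast
      omega
    have hq : q ∉ Finset.Ico (q + 1) (q + 1 + n) := by simp
    rw [hI, Finset.sum_powerset_insert hq, scanSum, ← ih, ← ih, Finset.mul_sum, Finset.mul_sum]
    congr 1
    · refine Finset.sum_congr rfl fun S hS => ?_
      have hqS : q ∉ S := fun h => hq (Finset.mem_powerset.1 hS h)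
      rw [Finset.prod_insert hq, scanWeight, if_neg (by simpa using hqS), if_neg hqS]
      ring
    · refine Finset.sum_congr rfl fun S hS => ?_
      rw [Finset.prod_insert hq, scanWeight, if_pos (by simp), if_pos (by simp),
        scanWeight_congr ρ lam g (ω' := fun z => decide (z ∈ S))]
      · have : ∏ x ∈ Finset.Ico (q + 1) (q + 1 + n), (if x ∈ insert q S then b x else a x) =
            ∏ x ∈ Finset.Ico (q + 1) (q + 1 + n), (if x ∈ S then b x else a x) := by
          refine Finset.prod_congr rfl fun x hx => ?_
          have : x ≠ q := fun h => hq (h ▸ hx)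
          simp [this]
        rw [this]
        ring
      · intro z hz _
        have : z ≠ q := by omega
        simp [this]

/-- The same sum over configurations in the sense of `Config`. -/
theorem sum_scanWeight (ρ lam : ℝ) (a b g : ℤ → ℝ) (τ : ℤ → Bool) (p : ℤ) (n : ℕ) :
    ∑ σ : Config (Finset.Icc 1 (n : ℤ)), scanWeight ρ lam g (glue τ σ) p 1 n *
      ∏ x, (if σ x then b x else a x) = scanSum ρ lam a b g p 1 n := by
  have hI : Finset.Ico (1 : ℤ) (1 + n) = Finset.Icc 1 (n : ℤ) := by
    ext z; simp only [Finset.mem_Ico, Finset.mem_Icc]; omega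
  rw [← sum_powerset_scanWeight, hI]
  refine Finset.sum_bij' (fun σ _ => (Finset.univ.filter fun x => σ x = true).map
    ⟨Subtype.val, Subtype.val_injective⟩) (fun S _ x => decide ((x : ℤ) ∈ S)) ?_ ?_ ?_ ?_ ?_
  · intro σ _
    rw [Finset.mem_powerset]
    intro z hz
    obtain ⟨x, -, rfl⟩ := Finset.mem_map.1 hz
    exact x.2
  · intro S _; exact Finset.mem_univ _
  · intro σ _
    ext x
    simp
  · intro S hS
    ext z
    simp only [Finset.mem_map, Finset.mem_filter, Finset.mem_univ, true_and, decide_eq_true_eq,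
      Function.Embedding.coeFn_mk]
    constructor
    · rintro ⟨x, hx, rfl⟩; exact hx
    · intro hz; exact ⟨⟨z, Finset.mem_powerset.1 hS hz⟩, hz, rfl⟩
  · intro σ _
    congr 1
    · refine scanWeight_congr ρ lam g (fun z h1 h2 => ?_) p
      have hz : z ∈ Finset.Icc 1 (n : ℤ) := by rw [Finset.mem_Icc]; omega
      simp [glue, Finset.mem_Icc.1 hz]
    · rw [← Finset.prod_coe_sort (Finset.Icc 1 (n : ℤ))]
      exact Finset.prod_congr rfl fun x _ => by simp

/-- The factor `g` of the last particle encodes the boundary condition `τ` on the sites from `m`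
onwards: either there is a particle at `m`, or there is none at all. -/
def RightEnd (ρ : ℝ) (τ : ℤ → Bool) (g : ℤ → ℝ) (m : ℤ) : Prop :=
  (τ m = true ∧ ∀ u, g u = distK ρ (m - u)) ∨ ((∀ z, m ≤ z → τ z = false) ∧ ∀ u, g u = 1)

theorem leftDist_eq {ω : ℤ → Bool} {x p : ℤ} (hp : p < x) (h1 : ω p = true)
    (h0 : ∀ z, p < z → z < x → ω z = false) : leftDist ω x = ((x - p).toNat : ℕ) := by
  refine le_antisymm (iInf₂_le _ ⟨by omega, ?_⟩) (le_iInf₂ fun d hd => ?_)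
  · rw [Nat.cast_le]
    by_contra hh
    have := h0 (x - d) (by omega) (by have := hd.1; omega)
    simp [this] at hd
  · rw [show x - ((x - p).toNat : ℤ) = p by omega, h1]

theorem rightDist_eq {ω : ℤ → Bool} {x y : ℤ} (hy : x < y) (h1 : ω y = true)
    (h0 : ∀ z, x < z → z < y → ω z = false) : rightDist ω x = ((y - x).toNat : ℕ) := by
  refine le_antisymm (iInf₂_le _ ⟨by omega, ?_⟩) (le_iInf₂ fun d hd => ?_)
  · rw [Nat.cast_le]
    by_contra hh
    have := h0 (x + d) (by have := hd.1; omega) (by omega)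
    simp [this] at hd
  · rw [show x + ((y - x).toNat : ℤ) = y by omega, h1]

theorem rightDist_eq_top {ω : ℤ → Bool} {x : ℤ} (h0 : ∀ z, x < z → ω z = false) :
    rightDist ω x = ⊤ := by
  refine top_le_iff.1 (le_iInf₂ fun d hd => ?_)
  have := h0 (x + d) (by have := hd.1; omega)
  simp [this] at hd

/-- Sites after `x`: replacing the last particle `p` by a particle at `x` changes the weight by the
ratio in the definition of the rates. -/
theorem scanWeight_after {ρ : ℝ} (hρ : 0 < ρ) (lam : ℝ) {g : ℤ → ℝ} {ω : ℤ → Bool} {p x q : ℤ}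
    {n : ℕ} (hg : RightEnd ρ ω g (q + n)) (hpx : p < x) (hxq : x < q) (hp : ω p = true)
    (h0 : ∀ z, p < z → z < x → ω z = false) (h0' : ∀ z, x < z → z < q → ω z = false) :
    distK ρ (x - p) * scanWeight ρ lam g ω x q n =
      siteRatio ρ ω x * scanWeight ρ lam g ω p q n := by
  have key : ∀ y, x < y → ω y = true → (∀ z, x < z → z < y → ω z = false) →
      distK ρ (x - p) * distK ρ (y - x) = siteRatio ρ ω x * distK ρ (y - p) := by
    intro y hy h1 h2
    have hne : distK ρ (y - p) ≠ 0 := (distK_pos hρ (by omega)).ne'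
    rw [siteRatio, leftDist_eq hpx hp h0, rightDist_eq hy h1 h2]
    change _ = renewalK ρ (x - p).toNat * renewalK ρ (y - x).toNat /
      renewalK ρ ((x - p).toNat + (y - x).toNat) * _
    rw [show (x - p).toNat + (y - x).toNat = (y - p).toNat by omega]
    exact (div_mul_cancel₀ _ hne).symm
  induction n generalizing q with
  | zero =>
    rw [Nat.cast_zero, add_zero] at hg
    rw [scanWeight, scanWeight]
    rcases hg with ⟨h1, h2⟩ | ⟨h1, h2⟩
    · rw [h2, h2]
      exact key q hxq h1 h0'
    · rw [h2, h2, siteRatio, leftDist_eq hpx hp h0, rightDist_eq_top fun z hz => ?_]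
      · rfl
      · by_cases hzq : z < q
        · exact h0' z hz hzq
        · exact h1 z (by omega)
  | succ n ih =>
    rw [scanWeight, scanWeight]
    cases hq : ω q with
    | true =>
      simp only [if_true]
      linear_combination lam * scanWeight ρ lam g ω q (q + 1) n * key q hxq hq h0'
    | false =>
      simp only [Bool.false_eq_true, if_false]
      refine ih ?_ (by omega) fun z h1 h2 => ?_
      · rw [show q + 1 + (n : ℤ) = q + (n + 1 : ℕ) by push_cast; ring]
        exact hg
      · rcases eq_or_ne z q with rfl | hz
        · exact hq
        · exact h0' z h1 (by omega)

theorem siteRatio_update (ρ : ℝ) (ω : ℤ → Bool) (x : ℤ) (b : Bool) :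
    siteRatio ρ (Function.update ω x b) x = siteRatio ρ ω x := by
  have h1 : ∀ d : ℕ, (1 ≤ d ∧ Function.update ω x b (x - d) = true) ↔
      (1 ≤ d ∧ ω (x - d) = true) := fun d => and_congr_right fun hd => by
    rw [Function.update_of_ne (by omega)]
  have h2 : ∀ d : ℕ, (1 ≤ d ∧ Function.update ω x b (x + d) = true) ↔
      (1 ≤ d ∧ ω (x + d) = true) := fun d => and_congr_right fun hd => by
    rw [Function.update_of_ne (by omega)]
  simp only [siteRatio, leftDist, rightDist, h1, h2]

/-- Adding a particle at `x` multiplies the weight by `lam` times the ratio in the definition of the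
rates. -/
theorem scanWeight_update {ρ : ℝ} (hρ : 0 < ρ) (lam : ℝ) {g : ℤ → ℝ} {ω : ℤ → Bool} {p x q : ℤ}
    {n : ℕ} (hg : RightEnd ρ ω g (q + n)) (hpq : p < q) (hqx : q ≤ x) (hx : x < q + n)
    (hp : ω p = true) (h0 : ∀ z, p < z → z < q → ω z = false) :
    scanWeight ρ lam g (Function.update ω x true) p q n =
      lam * siteRatio ρ ω x * scanWeight ρ lam g (Function.update ω x false) p q n := by
  induction n generalizing p q with
  | zero => exact absurd hx (by simpa using hqx)
  | succ n ih =>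
    have hcast : q + ((n + 1 : ℕ) : ℤ) = q + 1 + n := by push_cast; ring
    rw [hcast] at hg hx
    rw [scanWeight, scanWeight]
    rcases eq_or_lt_of_le hqx with rfl | hlt
    · simp only [Function.update_self, if_true, Bool.false_eq_true, if_false]
      have hc : ∀ (b : Bool) (u : ℤ), scanWeight ρ lam g (Function.update ω q b) u (q + 1) n =
          scanWeight ρ lam g ω u (q + 1) n := fun b u =>
        scanWeight_congr ρ lam g (fun z hz _ => Function.update_of_ne (by omega) _ _) u
      rw [hc, hc]
      have := scanWeight_after hρ lam hg hpq (lt_add_one q) hp h0 (fun z h1 h2 => by omega)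
      linear_combination lam * this
    · rw [Function.update_of_ne hlt.ne, Function.update_of_ne hlt.ne]
      cases hq : ω q with
      | true =>
        simp only [if_true]
        rw [ih hg (lt_add_one q) (by omega) hx hq fun z h1 h2 => by omega]
        ring
      | false =>
        simp only [Bool.false_eq_true, if_false]
        refine ih hg (by omega) (by omega) hx hp fun z h1 h2 => ?_
        rcases eq_or_ne z q with rfl | hz
        · exact hq
        · exact h0 z h1 (by omega)

end Scan

section Reversible

/-- The boundary condition `τ` of the box `{1, …, n}` has its last particle on the left at `p`, and
is described by `g` on the right. -/
structure BoxBoundary (ρ : ℝ) (n : ℕ) (τ : ℤ → Bool) (p : ℤ) (g : ℤ → ℝ) : Prop where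
  lt : p < 1
  occupied : τ p = true
  empty : ∀ z, p < z → z < 1 → τ z = false
  right : RightEnd ρ τ g (1 + n)

variable {ρ lam : ℝ} {n : ℕ} {τ : ℤ → Bool} {p : ℤ} {g : ℤ → ℝ}

theorem BoxBoundary.pos (h : BoxBoundary ρ n τ p g) (hρ : 0 < ρ) {u : ℤ} (hu : u < 1 + n) :
    0 < g u := by
  rcases h.right with h | h
  · rw [h.2]; exact distK_pos hρ (by omega)
  · rw [h.2]; exact one_pos

theorem flipAt_flipAt {Λ : Finset ℤ} (σ : Config Λ) (x : Λ) : flipAt (flipAt σ x) x = σ := by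
  simp [flipAt]

theorem BoxBoundary.detailed_balance (h : BoxBoundary ρ n τ p g) (hρ : 0 < ρ) (lam : ℝ)
    (σ : Config (Finset.Icc 1 (n : ℤ))) (x : Finset.Icc 1 (n : ℤ)) :
    scanWeight ρ lam g (glue τ (flipAt σ x)) p 1 n * flipRate ρ lam τ (flipAt σ x) x =
      scanWeight ρ lam g (glue τ σ) p 1 n * flipRate ρ lam τ σ x := by
  have key : ∀ σ : Config (Finset.Icc 1 (n : ℤ)), σ x = false →
      scanWeight ρ lam g (glue τ (flipAt σ x)) p 1 n * flipRate ρ lam τ (flipAt σ x) x =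
        scanWeight ρ lam g (glue τ σ) p 1 n * flipRate ρ lam τ σ x := by
    intro σ hσ
    have hx := Finset.mem_Icc.1 x.2
    have hout : ∀ z : ℤ, z < 1 ∨ (n : ℤ) < z → glue τ σ z = τ z := fun z hz =>
      glue_apply_notMem _ _ (by rw [Finset.mem_Icc]; omega)
    have hend : RightEnd ρ (glue τ σ) g (1 + n) := by
      rcases h.right with hr | hr
      · exact Or.inl ⟨by rw [hout _ (Or.inr (by omega)), hr.1], hr.2⟩
      · exact Or.inr ⟨fun z hz => by rw [hout _ (Or.inr (by omega)), hr.1 z hz], hr.2⟩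
    have hw := scanWeight_update hρ lam hend h.lt hx.1 (by omega)
      (by rw [hout _ (Or.inl h.lt), h.occupied])
      (fun z h1 h2 => by rw [hout _ (Or.inl h2), h.empty z h1 h2])
    have e0 : Function.update (glue τ σ) x false = glue τ σ := by
      rw [Function.update_eq_self_iff, glue_apply_mem, hσ]
    rw [flipRate_eq, flipRate_eq, glue_flipAt, siteRatio_update, hσ, Bool.not_false, hw, e0]
    simp only [flipAt, hσ, Bool.not_false, Function.update_self, if_true, Bool.false_eq_true,
      if_false]
    ring
  cases hσ : σ x with
  | false => exact key σ hσ
  | true =>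
    have := key (flipAt σ x) (by simp [flipAt, hσ])
    rw [flipAt_flipAt] at this
    exact this.symm

theorem BoxBoundary.sum_mul_evolve (h : BoxBoundary ρ n τ p g) (hρ : 0 < ρ) (lam t : ℝ)
    (f : Config (Finset.Icc 1 (n : ℤ)) → ℝ) :
    ∑ σ, scanWeight ρ lam g (glue τ σ) p 1 n * evolve ρ lam (Finset.Icc 1 (n : ℤ)) τ t f σ =
      ∑ σ, scanWeight ρ lam g (glue τ σ) p 1 n * f σ := by
  have h0 : ∀ η, ∑ σ, scanWeight ρ lam g (glue τ σ) p 1 n *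
      (t • generator ρ lam (Finset.Icc 1 (n : ℤ)) τ) σ η = 0 := by
    intro η
    simp only [Matrix.smul_apply, smul_eq_mul, mul_left_comm _ t, ← Finset.mul_sum, generator,
      Matrix.of_apply]
    rw [mul_eq_zero]
    right
    simp only [Finset.mul_sum]
    rw [Finset.sum_comm]
    refine Finset.sum_eq_zero fun x _ => ?_
    have hflip : ∀ σ : Config (Finset.Icc 1 (n : ℤ)), η = flipAt σ x ↔ σ = flipAt η x := fun σ =>
      ⟨fun hh => by rw [hh, flipAt_flipAt], fun hh => by rw [hh, flipAt_flipAt]⟩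
    simp only [mul_sub, Finset.sum_sub_distrib, hflip, @eq_comm _ η, mul_ite, mul_one, mul_zero,
      Finset.sum_ite_eq', Finset.mem_univ, if_true]
    rw [h.detailed_balance hρ lam, sub_self]
  have h1 := vecMul_matrix_exp_of_vecMul_eq_zero h0
  simp only [evolve, law, Finset.mul_sum, ← mul_assoc]
  rw [Finset.sum_comm]
  simp only [← Finset.sum_mul, h1]

/-- The occupation probability of `x` under the reversible measure in the box `{1, …, n}`. -/
noncomputable def boxProb (ρ lam : ℝ) (g : ℤ → ℝ) (p : ℤ) (n : ℕ) (x : ℤ) : ℝ :=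
  scanSum ρ lam (fun z => if z = x then 0 else 1) (fun _ => 1) g p 1 n /
    scanSum ρ lam (fun _ => 1) (fun _ => 1) g p 1 n

theorem BoxBoundary.sum_pos (h : BoxBoundary ρ n τ p g) (hρ : 0 < ρ) (hlam : 0 < lam) :
    0 < scanSum ρ lam (fun _ => 1) (fun _ => 1) g p 1 n := by
  rw [← sum_scanWeight ρ lam _ _ g τ p n]
  simp only [ite_self, Finset.prod_const_one, mul_one]
  exact Finset.sum_pos (fun σ _ => scanWeight_pos hρ hlam h.lt (fun u hu => h.pos hρ hu) _)
    Finset.univ_nonempty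

/-- An occupation probability that has almost forgotten the initial condition is close to its
equilibrium value. -/
theorem BoxBoundary.abs_evolve_occ_sub_boxProb_le (h : BoxBoundary ρ n τ p g) (hρ : 0 < ρ)
    (hlam : 0 < lam) {t D : ℝ} {x : Finset.Icc 1 (n : ℤ)}
    (hD : ∀ σ σ', |evolve ρ lam (Finset.Icc 1 (n : ℤ)) τ t (occ x) σ -
      evolve ρ lam (Finset.Icc 1 (n : ℤ)) τ t (occ x) σ'| ≤ D)
    (σ : Config (Finset.Icc 1 (n : ℤ))) :
    |evolve ρ lam (Finset.Icc 1 (n : ℤ)) τ t (occ x) σ - boxProb ρ lam g p n x| ≤ D := by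
  have hZ := h.sum_pos hρ hlam
  have e1 : ∑ σ : Config (Finset.Icc 1 (n : ℤ)), scanWeight ρ lam g (glue τ σ) p 1 n =
      scanSum ρ lam (fun _ => 1) (fun _ => 1) g p 1 n := by
    rw [← sum_scanWeight ρ lam _ _ g τ p n]
    simp
  have e2 : ∑ σ, scanWeight ρ lam g (glue τ σ) p 1 n * occ x σ =
      scanSum ρ lam (fun z => if z = x then 0 else 1) (fun _ => 1) g p 1 n := by
    rw [← sum_scanWeight ρ lam _ _ g τ p n]
    refine Finset.sum_congr rfl fun σ _ => ?_
    congr 1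
    unfold occ
    cases hσ : σ x with
    | true =>
      rw [if_pos rfl, Finset.prod_eq_one]
      intro y _
      split_ifs with h1 h2
      · rfl
      · exact absurd (Subtype.ext h2 ▸ hσ) h1
      · rfl
    | false =>
      rw [if_neg (by simp), Finset.prod_eq_zero (Finset.mem_univ x)]
      simp [hσ]
  rw [← e1] at hZ
  have hw : ∀ σ : Config (Finset.Icc 1 (n : ℤ)), 0 < scanWeight ρ lam g (glue τ σ) p 1 n := fun σ =>
    scanWeight_pos hρ hlam h.lt (fun u hu => h.pos hρ hu) _
  rw [boxProb, ← e1, ← e2, ← h.sum_mul_evolve hρ lam t]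
  rw [abs_sub_le_iff, sub_le_iff_le_add, sub_le_iff_le_add, ← sub_le_iff_le_add', le_div_iff₀ hZ,
    div_le_iff₀ hZ, Finset.mul_sum, Finset.mul_sum]
  constructor <;> refine Finset.sum_le_sum fun η _ => ?_
  · have := abs_sub_le_iff.1 (hD σ η)
    nlinarith [hw η]
  · have := abs_sub_le_iff.1 (hD σ η)
    nlinarith [hw η]

end Reversible

/-! ### Renewal estimates -/

section Renewal

theorem renewalK_le_sq_mul {ρ : ℝ} (hρ : 0 < ρ) (hρ1 : ρ < 1) {m n : ℕ} (hm : 1 ≤ m) (hn : 1 ≤ n)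
    {s : ℝ} (hs : 1 ≤ s) (h : (n : ℝ) ≤ s * m) : renewalK ρ m ≤ s ^ 2 * renewalK ρ n := by
  have hm' : (0 : ℝ) < m := by exact_mod_cast hm
  have hn' : (0 : ℝ) < n := by exact_mod_cast hn
  rw [renewalK_eq hm, renewalK_eq hn]
  have h1 : ((m : ℝ)⁻¹) ^ (1 + ρ) ≤ s ^ 2 * ((n : ℝ)⁻¹) ^ (1 + ρ) := by
    calc ((m : ℝ)⁻¹) ^ (1 + ρ) ≤ (s * (n : ℝ)⁻¹) ^ (1 + ρ) := by
          refine Real.rpow_le_rpow (by positivity) ?_ (by linarith)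
          rw [← div_eq_mul_inv, le_div_iff₀ hn', inv_mul_le_iff₀ hm']
          linarith
      _ = s ^ (1 + ρ) * ((n : ℝ)⁻¹) ^ (1 + ρ) := Real.mul_rpow (by linarith) (by positivity)
      _ ≤ s ^ 2 * ((n : ℝ)⁻¹) ^ (1 + ρ) := by
          refine mul_le_mul_of_nonneg_right ?_ (by positivity)
          rw [← Real.rpow_natCast]
          exact Real.rpow_le_rpow_of_exponent_le hs (by push_cast; linarith)
  calc _ ≤ renewalK ρ 1 * (s ^ 2 * ((n : ℝ)⁻¹) ^ (1 + ρ)) :=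
        mul_le_mul_of_nonneg_left h1 (renewalK_nonneg hρ 1)
    _ = _ := by ring

/-- The `(k + 1)`-fold convolution of `renewalK` with itself. -/
noncomputable def convK (ρ : ℝ) : ℕ → ℕ → ℝ
  | 0, n => renewalK ρ n
  | k + 1, n => ∑ x ∈ Finset.HasAntidiagonal.antidiagonal n, renewalK ρ x.1 * convK ρ k x.2

theorem convK_nonneg {ρ : ℝ} (hρ : 0 < ρ) (k n : ℕ) : 0 ≤ convK ρ k n := by
  induction k generalizing n with
  | zero => exact renewalK_nonneg hρ n
  | succ k ih => exact Finset.sum_nonneg fun x _ => mul_nonneg (renewalK_nonneg hρ _) (ih _)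

theorem hasSum_convK {ρ : ℝ} (hρ : 0 < ρ) (k : ℕ) : HasSum (convK ρ k) 1 := by
  induction k with
  | zero => exact hasSum_renewalK hρ
  | succ k ih =>
    have h1 : Summable fun n => ‖renewalK ρ n‖ := by
      simpa only [Real.norm_of_nonneg (renewalK_nonneg hρ _)] using (hasSum_renewalK hρ).summable
    have h2 : Summable fun n => ‖convK ρ k n‖ := by
      simpa only [Real.norm_of_nonneg (convK_nonneg hρ k _)] using ih.summable
    have h3 := (summable_norm_sum_mul_antidiagonal_of_summable_norm h1 h2).of_norm
    have h4 := tsum_mul_tsum_eq_tsum_sum_antidiagonal_of_summable_norm h1 h2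
    rw [(hasSum_renewalK hρ).tsum_eq, ih.tsum_eq, one_mul] at h4
    have h5 := h3.hasSum
    rw [← h4] at h5
    exact h5

/-- The one big jump principle: one of `k + 1` summands with sum `n` is at least `n / (k + 1)`. -/
theorem convK_le {ρ : ℝ} (hρ : 0 < ρ) (hρ1 : ρ < 1) (k : ℕ) {n : ℕ} (hn : 1 ≤ n) :
    convK ρ k n ≤ ((k : ℝ) + 1) ^ 3 * renewalK ρ n := by
  induction k generalizing n with
  | zero => simp [convK]
  | succ k ih =>
    have hK := renewalK_nonneg hρ n
    have hterm : ∀ x ∈ Finset.HasAntidiagonal.antidiagonal n, renewalK ρ x.1 * convK ρ k x.2 ≤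
        ((k : ℝ) + 2) ^ 2 * renewalK ρ n * convK ρ k x.2 +
          ((k : ℝ) + 1) * ((k : ℝ) + 2) ^ 2 * renewalK ρ n * renewalK ρ x.1 := by
      rintro ⟨i, j⟩ hx
      have hij : i + j = n := Finset.HasAntidiagonal.mem_antidiagonal.1 hx
      have hij' : (i : ℝ) + j = n := by exact_mod_cast hij
      have hci := renewalK_nonneg hρ i
      have hcj := convK_nonneg hρ k j
      have hk : (0 : ℝ) ≤ k := k.cast_nonneg
      have hn' : (1 : ℝ) ≤ n := by exact_mod_cast hn
      simp only
      rcases le_or_gt (n : ℝ) (((k : ℝ) + 2) * i) with h | h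
      · have hi : 1 ≤ i := by
          rcases Nat.eq_zero_or_pos i with rfl | hi
          · norm_num at h; omega
          · exact hi
        have h1 := mul_le_mul_of_nonneg_right
          (renewalK_le_sq_mul hρ hρ1 hi hn (show (1 : ℝ) ≤ k + 2 by linarith) h) hcj
        have h2 : 0 ≤ ((k : ℝ) + 1) * ((k : ℝ) + 2) ^ 2 * renewalK ρ n * renewalK ρ i := by
          positivity
        linarith
      · have hj : 1 ≤ j := by
          rcases Nat.eq_zero_or_pos j with rfl | hj
          · exfalso
            have : (i : ℝ) = n := by simpa using hij'
            nlinarith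
          · exact hj
        have h1 : convK ρ k j ≤ ((k : ℝ) + 1) * ((k : ℝ) + 2) ^ 2 * renewalK ρ n := by
          have h3 : (n : ℝ) ≤ ((k : ℝ) + 2) / (k + 1) * j := by
            rw [div_mul_eq_mul_div, le_div_iff₀ (by linarith)]
            nlinarith
          have h4 : (1 : ℝ) ≤ ((k : ℝ) + 2) / (k + 1) := by
            rw [le_div_iff₀ (by linarith)]; linarith
          calc convK ρ k j ≤ ((k : ℝ) + 1) ^ 3 * renewalK ρ j := ih hj
            _ ≤ ((k : ℝ) + 1) ^ 3 * ((((k : ℝ) + 2) / (k + 1)) ^ 2 * renewalK ρ n) :=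
                mul_le_mul_of_nonneg_left (renewalK_le_sq_mul hρ hρ1 hj hn h4 h3) (by positivity)
            _ = _ := by
                have : (k : ℝ) + 1 ≠ 0 := by linarith
                field_simp
        have h2 := mul_le_mul_of_nonneg_left h1 hci
        have h3 : 0 ≤ ((k : ℝ) + 2) ^ 2 * renewalK ρ n * convK ρ k j := by positivity
        linarith
    have s1 : ∑ x ∈ Finset.HasAntidiagonal.antidiagonal n, convK ρ k x.2 ≤ 1 := by
      rw [← Finset.sum_image (f := convK ρ k) (g := Prod.snd)]
      · exact sum_le_hasSum _ (fun j _ => convK_nonneg hρ k j) (hasSum_convK hρ k)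
      · rintro ⟨i, j⟩ hx ⟨i', j'⟩ hx' hh
        have h1 : i + j = n := Finset.HasAntidiagonal.mem_antidiagonal.1 hx
        have h2 : i' + j' = n := Finset.HasAntidiagonal.mem_antidiagonal.1 hx'
        simp only at hh
        rw [Prod.mk.injEq]
        omega
    have s2 : ∑ x ∈ Finset.HasAntidiagonal.antidiagonal n, renewalK ρ x.1 ≤ 1 := by
      rw [← Finset.sum_image (f := renewalK ρ) (g := Prod.fst)]
      · exact sum_le_hasSum _ (fun j _ => renewalK_nonneg hρ j) (hasSum_renewalK hρ)
      · rintro ⟨i, j⟩ hx ⟨i', j'⟩ hx' hh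
        have h1 : i + j = n := Finset.HasAntidiagonal.mem_antidiagonal.1 hx
        have h2 : i' + j' = n := Finset.HasAntidiagonal.mem_antidiagonal.1 hx'
        simp only at hh
        rw [Prod.mk.injEq]
        omega
    have hk : (0 : ℝ) ≤ k := k.cast_nonneg
    calc convK ρ (k + 1) n ≤ ∑ x ∈ Finset.HasAntidiagonal.antidiagonal n, _ := Finset.sum_le_sum hterm
      _ = ((k : ℝ) + 2) ^ 2 * renewalK ρ n * ∑ x ∈ Finset.HasAntidiagonal.antidiagonal n, convK ρ k x.2 +
          ((k : ℝ) + 1) * ((k : ℝ) + 2) ^ 2 * renewalK ρ n *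
            ∑ x ∈ Finset.HasAntidiagonal.antidiagonal n, renewalK ρ x.1 := by
          rw [Finset.sum_add_distrib, Finset.mul_sum, Finset.mul_sum]
      _ ≤ ((k : ℝ) + 2) ^ 2 * renewalK ρ n * 1 +
          ((k : ℝ) + 1) * ((k : ℝ) + 2) ^ 2 * renewalK ρ n * 1 := by
          gcongr
      _ = _ := by push_cast; ring

/-- The partition function of the renewal process pinned at `0` and `n`, with weight `lam` per
intermediate renewal. -/
noncomputable def pinnedSum (ρ lam : ℝ) (n : ℕ) : ℝ := ∑' k : ℕ, lam ^ k * convK ρ k n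

theorem summable_geom_cube {lam : ℝ} (hlam : 0 < lam) (hlam1 : lam < 1) :
    Summable fun k : ℕ => lam ^ k * ((k : ℝ) + 1) ^ 3 := by
  have h := summable_pow_mul_geometric_of_norm_lt_one (R := ℝ) 3
    (r := lam) (by rwa [Real.norm_of_nonneg hlam.le])
  have h1 := ((summable_nat_add_iff 1).2 h).mul_left lam⁻¹
  refine h1.congr fun k => ?_
  push_cast
  rw [pow_succ lam k]
  field_simp

theorem summable_pinnedSum {ρ lam : ℝ} (hρ : 0 < ρ) (hlam : 0 < lam) (hlam1 : lam < 1) (n : ℕ) :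
    Summable fun k : ℕ => lam ^ k * convK ρ k n := by
  refine Summable.of_nonneg_of_le (fun k => mul_nonneg (by positivity) (convK_nonneg hρ k n))
    (fun k => ?_) (summable_geometric_of_lt_one hlam.le hlam1)
  refine mul_le_of_le_one_right (by positivity) ?_
  exact le_hasSum (hasSum_convK hρ k) n fun j _ => convK_nonneg hρ k j

theorem pinnedSum_nonneg {ρ lam : ℝ} (hρ : 0 < ρ) (hlam : 0 < lam) (n : ℕ) :
    0 ≤ pinnedSum ρ lam n :=
  tsum_nonneg fun k => mul_nonneg (by positivity) (convK_nonneg hρ k n)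

theorem pinnedSum_eq {ρ lam : ℝ} (hρ : 0 < ρ) (hlam : 0 < lam) (hlam1 : lam < 1) (n : ℕ) :
    pinnedSum ρ lam n = renewalK ρ n +
      lam * ∑ x ∈ Finset.HasAntidiagonal.antidiagonal n, renewalK ρ x.1 * pinnedSum ρ lam x.2 := by
  have hs := summable_pinnedSum hρ hlam hlam1
  have h1 : pinnedSum ρ lam n = lam ^ 0 * convK ρ 0 n + ∑' k : ℕ, lam ^ (k + 1) * convK ρ (k + 1) n :=
    (hs n).tsum_eq_zero_add
  have h2 : ∀ k : ℕ, lam ^ (k + 1) * convK ρ (k + 1) n =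
      ∑ x ∈ Finset.HasAntidiagonal.antidiagonal n, lam * renewalK ρ x.1 *
        (lam ^ k * convK ρ k x.2) := by
    intro k
    rw [convK, Finset.mul_sum]
    exact Finset.sum_congr rfl fun x _ => by ring
  have h3 : ∑' k : ℕ, ∑ x ∈ Finset.HasAntidiagonal.antidiagonal n, lam * renewalK ρ x.1 *
        (lam ^ k * convK ρ k x.2) = ∑ x ∈ Finset.HasAntidiagonal.antidiagonal n,
          ∑' k : ℕ, lam * renewalK ρ x.1 * (lam ^ k * convK ρ k x.2) :=
    Summable.tsum_finsetSum fun x _ => (hs x.2).mul_left _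
  have h4 : convK ρ 0 n = renewalK ρ n := by rw [convK]
  rw [h1, tsum_congr h2, h3, pow_zero, one_mul, h4, Finset.mul_sum]
  congr 1
  refine Finset.sum_congr rfl fun x _ => ?_
  rw [tsum_mul_left, ← mul_assoc]
  rfl

theorem exists_pinnedSum_le {ρ lam : ℝ} (hρ : 0 < ρ) (hρ1 : ρ < 1) (hlam : 0 < lam)
    (hlam1 : lam < 1) : ∃ C : ℝ, 0 < C ∧ ∀ n : ℕ, 1 ≤ n → pinnedSum ρ lam n ≤ C * renewalK ρ n := by
  have hs := summable_geom_cube hlam hlam1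
  refine ⟨∑' k : ℕ, lam ^ k * ((k : ℝ) + 1) ^ 3,
    hs.tsum_pos (fun k => by positivity) 0 (by norm_num), fun n hn => ?_⟩
  rw [← tsum_mul_right]
  refine (summable_pinnedSum hρ hlam hlam1 n).tsum_le_tsum (fun k => ?_) (hs.mul_right _)
  rw [mul_assoc]
  exact mul_le_mul_of_nonneg_left (convK_le hρ hρ1 k hn) (by positivity)

/-- A form of the renewal equation in which only the sites of `[q, z)` carry renewals. -/
theorem distK_add_sum_le_pinnedSum {ρ lam : ℝ} (hρ : 0 < ρ) (hlam : 0 < lam) (hlam1 : lam < 1)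
    {p q z : ℤ} (hpq : p < q) :
    distK ρ (z - p) + lam * ∑ v ∈ Finset.Ico q z, distK ρ (v - p) * pinnedSum ρ lam (z - v).toNat ≤
      pinnedSum ρ lam (z - p).toNat := by
  rw [pinnedSum_eq hρ hlam hlam1, distK]
  refine add_le_add_right (mul_le_mul_of_nonneg_left ?_ hlam.le) _
  have h1 : ∑ v ∈ Finset.Ico q z, distK ρ (v - p) * pinnedSum ρ lam (z - v).toNat =
      ∑ x ∈ (Finset.Ico q z).image (fun v => ((v - p).toNat, (z - v).toNat)),
        renewalK ρ x.1 * pinnedSum ρ lam x.2 := by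
    rw [Finset.sum_image]
    · rfl
    · intro a ha b hb hab
      have ha' := Finset.mem_Ico.1 ha
      have hb' := Finset.mem_Ico.1 hb
      have := (Prod.mk.injEq _ _ _ _ ▸ hab).1
      omega
  rw [h1]
  refine Finset.sum_le_sum_of_subset_of_nonneg (fun x hx => ?_) fun x _ _ =>
    mul_nonneg (renewalK_nonneg hρ _) (pinnedSum_nonneg hρ hlam _)
  obtain ⟨v, hv, rfl⟩ := Finset.mem_image.1 hx
  have hv' := Finset.mem_Ico.1 hv
  rw [Finset.HasAntidiagonal.mem_antidiagonal]
  simp only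
  omega

theorem sum_distK_le_one {ρ : ℝ} (hρ : 0 < ρ) {p q z : ℤ} (hpq : p < q) :
    ∑ v ∈ Finset.Ico q z, distK ρ (v - p) ≤ 1 := by
  have h1 : ∑ v ∈ Finset.Ico q z, distK ρ (v - p) =
      ∑ j ∈ (Finset.Ico q z).image (fun v => (v - p).toNat), renewalK ρ j := by
    rw [Finset.sum_image]
    · rfl
    · intro a ha b hb hab
      have ha' := Finset.mem_Ico.1 ha
      have hb' := Finset.mem_Ico.1 hb
      simp only at hab
      omega
  rw [h1]
  exact sum_le_hasSum _ (fun j _ => renewalK_nonneg hρ j) (hasSum_renewalK hρ)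

end Renewal

section ScanBounds

variable {ρ lam : ℝ} {a b g : ℤ → ℝ}

theorem scanSum_nonneg (hρ : 0 < ρ) (hlam : 0 < lam) (ha : ∀ z, 0 ≤ a z) (hb : ∀ z, 0 ≤ b z)
    {p q : ℤ} {n : ℕ} (hp : p < q) (hg : ∀ u, u < q + n → 0 ≤ g u) :
    0 ≤ scanSum ρ lam a b g p q n := by
  induction n generalizing p q with
  | zero => exact hg p (by simpa using hp)
  | succ n ih =>
    have hg' : ∀ u, u < q + 1 + n → 0 ≤ g u := fun u hu => hg u (by push_cast; omega)
    rw [scanSum]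
    have := distK_nonneg hρ (q - p)
    have := ih (lt_add_one q) hg'
    have := ih (show p < q + 1 by omega) hg'
    have := ha q
    have := hb q
    positivity

/-- The configuration without particles bounds the partition function from below. -/
theorem le_scanSum (hρ : 0 < ρ) (hlam : 0 < lam) (hb : ∀ z, 0 ≤ b z) {p q : ℤ} {n : ℕ} (hp : p < q)
    (hg : ∀ u, u < q + n → 0 ≤ g u) : g p ≤ scanSum ρ lam (fun _ => 1) b g p q n := by
  induction n generalizing p q with
  | zero => exact le_rfl
  | succ n ih =>
    have hg' : ∀ u, u < q + 1 + n → 0 ≤ g u := fun u hu => hg u (by push_cast; omega)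
    rw [scanSum]
    have h1 := distK_nonneg hρ (q - p)
    have h2 := scanSum_nonneg (a := fun _ => 1) hρ hlam (fun _ => zero_le_one) hb (lt_add_one q) hg'
    have h3 := ih (show p < q + 1 by omega) hg'
    have h4 := hb q
    have : 0 ≤ b q * (lam * distK ρ (q - p)) *
        scanSum ρ lam (fun _ => 1) b g q (q + 1) n := by positivity
    linarith

theorem scanSum_succ_le (hρ : 0 < ρ) (hlam : 0 < lam) (ha : ∀ z, 0 ≤ a z) (ha1 : ∀ z, a z ≤ 1)
    (hb : ∀ z, 0 ≤ b z) (hb1 : ∀ z, b z ≤ 1) {p q : ℤ} {n : ℕ} (hp : p < q)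
    (hg : ∀ u, u < q + 1 + n → 0 ≤ g u) :
    scanSum ρ lam a b g p q (n + 1) ≤ scanSum ρ lam a b g p (q + 1) n +
      lam * distK ρ (q - p) * scanSum ρ lam a b g q (q + 1) n := by
  have h1 := scanSum_nonneg hρ hlam ha hb (show p < q + 1 by omega) hg
  have h2 := scanSum_nonneg hρ hlam ha hb (lt_add_one q) hg
  have h3 := distK_nonneg hρ (q - p)
  rw [scanSum]
  refine add_le_add (mul_le_of_le_one_left h1 (ha1 q)) (mul_le_mul_of_nonneg_right ?_ h2)
  exact mul_le_of_le_one_left (by positivity) (hb1 q)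

/-- If the sites of the box carry weights at most one, the partition function between two pinned
particles is at most the full one. -/
theorem scanSum_pinned_le (hρ : 0 < ρ) (hlam : 0 < lam) (hlam1 : lam < 1) (ha : ∀ z, 0 ≤ a z)
    (ha1 : ∀ z, a z ≤ 1) (hb : ∀ z, 0 ≤ b z) (hb1 : ∀ z, b z ≤ 1) {R p q : ℤ} {n : ℕ}
    (hp : p < q) (hR : q + n = R) :
    scanSum ρ lam a b (fun u => distK ρ (R - u)) p q n ≤ pinnedSum ρ lam (R - p).toNat := by
  refine le_trans ?_ (distK_add_sum_le_pinnedSum hρ hlam hlam1 hp)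
  induction n generalizing p q with
  | zero =>
    have : q = R := by simpa using hR
    subst this
    simp [scanSum]
  | succ n ih =>
    have hR' : q + 1 + n = R := by rw [← hR]; push_cast; ring
    have hqR : q < R := by omega
    refine (scanSum_succ_le hρ hlam ha ha1 hb hb1 hp fun u _ => distK_nonneg hρ _).trans ?_
    have h1 := ih (show p < q + 1 by omega) hR'
    have h2 := (ih (lt_add_one q) hR').trans
      (distK_add_sum_le_pinnedSum hρ hlam hlam1 (lt_add_one q))
    have h3 := mul_le_mul_of_nonneg_left h2 (mul_nonneg hlam.le (distK_nonneg hρ (q - p)))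
    rw [← Finset.insert_Ico_add_one_left_eq_Ico hqR, Finset.sum_insert (by simp)]
    linarith

/-- The same for sums in which the last particle is free. -/
theorem scanSum_free_le (hρ : 0 < ρ) (hlam : 0 < lam) (hlam1 : lam < 1) (ha : ∀ z, 0 ≤ a z)
    (ha1 : ∀ z, a z ≤ 1) (hb : ∀ z, 0 ≤ b z) (hb1 : ∀ z, b z ≤ 1) {p q : ℤ} {n : ℕ} (hp : p < q) :
    scanSum ρ lam a b (fun _ => 1) p q n ≤ 1 / (1 - lam) := by
  have hB : 1 + lam * (1 / (1 - lam)) = 1 / (1 - lam) := by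
    have : 1 - lam ≠ 0 := by linarith
    field_simp
    ring
  have hB0 : 0 ≤ 1 / (1 - lam) := one_div_nonneg.2 (by linarith)
  have key : ∀ {p q : ℤ} (z : ℤ), p < q → 1 + lam * ∑ v ∈ Finset.Ico q z, distK ρ (v - p) *
      (1 / (1 - lam)) ≤ 1 / (1 - lam) := by
    intro p q z hpq
    rw [← Finset.sum_mul]
    conv_rhs => rw [← hB]
    have := mul_le_mul_of_nonneg_right (sum_distK_le_one hρ (z := z) hpq) hB0
    have := mul_le_mul_of_nonneg_left this hlam.le
    linarith
  refine le_trans ?_ (key (q + n) hp)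
  induction n generalizing p q with
  | zero => simp [scanSum]
  | succ n ih =>
    have hR' : q + ((n + 1 : ℕ) : ℤ) = q + 1 + n := by push_cast; ring
    refine (scanSum_succ_le hρ hlam ha ha1 hb hb1 hp fun _ _ => zero_le_one).trans ?_
    have h1 := ih (show p < q + 1 by omega)
    have h2 := (ih (lt_add_one q)).trans (key _ (lt_add_one q))
    have h3 := mul_le_mul_of_nonneg_left h2 (mul_nonneg hlam.le (distK_nonneg hρ (q - p)))
    rw [hR', ← Finset.insert_Ico_add_one_left_eq_Ico (show q < q + 1 + n by omega),
      Finset.sum_insert (by simp)]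
    linarith

/-- The partition function restricted to configurations with a particle at `z`. -/
theorem scanSum_marked_le (hρ : 0 < ρ) (hlam : 0 < lam) (hlam1 : lam < 1) (ha : ∀ z, 0 ≤ a z)
    (ha1 : ∀ z, a z ≤ 1) (hb : ∀ z, 0 ≤ b z) (hb1 : ∀ z, b z ≤ 1) {p q z : ℤ} {n : ℕ} {Y : ℝ}
    (hg : ∀ u, u < q + n → 0 ≤ g u) (hp : p < q) (hqz : q ≤ z) (hz : z < q + n) (haz : a z = 0)
    (hY : scanSum ρ lam a b g z (z + 1) (q + n - z - 1).toNat ≤ Y) :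
    scanSum ρ lam a b g p q n ≤ lam * pinnedSum ρ lam (z - p).toNat * Y := by
  have hY0 : 0 ≤ Y := le_trans (scanSum_nonneg hρ hlam ha hb (lt_add_one z)
    fun u hu => hg u (by omega)) hY
  have hS : ∀ {p q : ℤ}, p < q → lam * (distK ρ (z - p) + lam * ∑ v ∈ Finset.Ico q z,
      distK ρ (v - p) * pinnedSum ρ lam (z - v).toNat) * Y ≤
        lam * pinnedSum ρ lam (z - p).toNat * Y := fun hpq =>
    mul_le_mul_of_nonneg_right (mul_le_mul_of_nonneg_left
      (distK_add_sum_le_pinnedSum hρ hlam hlam1 hpq) hlam.le) hY0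
  refine le_trans ?_ (hS hp)
  induction n generalizing p q with
  | zero => exact absurd hz (by simpa using hqz)
  | succ n ih =>
    have hcast : q + ((n + 1 : ℕ) : ℤ) = q + 1 + n := by push_cast; ring
    rw [hcast] at hg hz hY
    rcases eq_or_lt_of_le hqz with rfl | hlt
    · rw [scanSum, haz, zero_mul, zero_add, Finset.Ico_self, Finset.sum_empty, mul_zero, add_zero]
      have e : (q + 1 + (n : ℤ) - q - 1).toNat = n := by omega
      rw [e] at hY
      have h1 := scanSum_nonneg hρ hlam ha hb (lt_add_one q) hg
      have h2 := mul_nonneg hlam.le (distK_nonneg hρ (q - p))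
      exact mul_le_mul (mul_le_of_le_one_left h2 (hb1 q)) hY h1 h2
    · refine (scanSum_succ_le hρ hlam ha ha1 hb hb1 hp hg).trans ?_
      have h1 := ih hg (show p < q + 1 by omega) (by omega) hz hY
      have h2 := (ih hg (lt_add_one q) (by omega) hz hY).trans (hS (lt_add_one q))
      have h3 := mul_le_mul_of_nonneg_left h2 (mul_nonneg hlam.le (distK_nonneg hρ (q - p)))
      rw [← Finset.insert_Ico_add_one_left_eq_Ico hlt, Finset.sum_insert (by simp)]
      linarith

end ScanBounds

/-! ### Equilibrium occupation probabilities -/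

section BoxProb

variable {ρ lam : ℝ} {n : ℕ} {τ : ℤ → Bool} {p : ℤ} {g : ℤ → ℝ}

theorem distK_le_rpow (hρ : 0 < ρ) {d : ℤ} (hd : 0 < d) : distK ρ d ≤ (d : ℝ) ^ (-(1 + ρ)) := by
  have hd' : (0 : ℝ) < d := by exact_mod_cast hd
  have h1 : ((d.toNat : ℕ) : ℝ) = d := by
    have : ((d.toNat : ℕ) : ℤ) = d := by omega
    exact_mod_cast this
  rw [distK, renewalK_eq (by omega), h1, Real.rpow_neg hd'.le, Real.inv_rpow hd'.le]
  exact mul_le_of_le_one_left (by positivity) (renewalK_le_one hρ 1)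

theorem distK_le_sq_mul (hρ : 0 < ρ) (hρ1 : ρ < 1) {d e : ℤ} (hd : 0 < d) (he : 0 < e) {s : ℝ}
    (hs : 1 ≤ s) (h : (e : ℝ) ≤ s * d) : distK ρ d ≤ s ^ 2 * distK ρ e := by
  refine renewalK_le_sq_mul hρ hρ1 (by omega) (by omega) hs ?_
  have h1 : ((d.toNat : ℕ) : ℤ) = d := by omega
  have h2 : ((e.toNat : ℕ) : ℤ) = e := by omega
  have h1' : ((d.toNat : ℕ) : ℝ) = d := by exact_mod_cast h1
  have h2' : ((e.toNat : ℕ) : ℝ) = e := by exact_mod_cast h2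
  rw [h1', h2']
  exact h

theorem BoxBoundary.eq_or_eq (h : BoxBoundary ρ n τ p g) :
    (g = fun u => distK ρ (1 + n - u)) ∨ g = fun _ => 1 :=
  h.right.imp (fun h => funext h.2) fun h => funext h.2

theorem BoxBoundary.nonneg (h : BoxBoundary ρ n τ p g) (hρ : 0 < ρ) (u : ℤ) : 0 ≤ g u := by
  rcases h.eq_or_eq with rfl | rfl
  · exact distK_nonneg hρ _
  · exact zero_le_one

/-- In equilibrium, sites in the left half of the box are occupied with a probability that decays
like `K` of the distance to the particle on the left. -/
theorem exists_boxProb_le (hρ : 0 < ρ) (hρ1 : ρ < 1) (hlam : 0 < lam) (hlam1 : lam < 1) :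
    ∃ C : ℝ, 0 < C ∧ ∀ (n : ℕ) (τ : ℤ → Bool) (p : ℤ) (g : ℤ → ℝ), BoxBoundary ρ n τ p g →
      -n ≤ p → ∀ z : ℤ, 1 ≤ z → 2 * z ≤ n + 1 →
        boxProb ρ lam g p n z ≤ C * ((z - p : ℤ) : ℝ) ^ (-(1 + ρ)) := by
  obtain ⟨C, hC, hX⟩ := exists_pinnedSum_le hρ hρ1 hlam hlam1
  have hX' : ∀ d : ℤ, 0 < d → pinnedSum ρ lam d.toNat ≤ C * distK ρ d := fun d hd =>
    hX _ (by omega)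
  have hl : 0 < 1 / (1 - lam) := one_div_pos.2 (by linarith)
  refine ⟨lam * C * (16 * C + 1 / (1 - lam)), by positivity, ?_⟩
  intro n τ p g h hpn z hz hzn
  have hp := h.lt
  have hdz : 0 < z - p := by omega
  have ha : ∀ y : ℤ, (0 : ℝ) ≤ if y = z then 0 else 1 := fun y => by split_ifs <;> norm_num
  have ha1 : ∀ y : ℤ, (if y = z then 0 else 1 : ℝ) ≤ 1 := fun y => by split_ifs <;> norm_num
  have hZ := le_scanSum (b := fun _ => 1) (n := n) hρ hlam (fun _ => zero_le_one) hp fun u _ => h.nonneg hρ u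
  have hgp := h.pos hρ (show p < 1 + n by omega)
  -- `Y` bounds the contribution of the sites to the right of `z`.
  have key : ∀ Y, scanSum ρ lam (fun y => if y = z then 0 else 1) (fun _ => 1) g z (z + 1)
      (1 + n - z - 1).toNat ≤ Y → Y ≤ (16 * C + 1 / (1 - lam)) * g p →
        boxProb ρ lam g p n z ≤
          lam * C * (16 * C + 1 / (1 - lam)) * ((z - p : ℤ) : ℝ) ^ (-(1 + ρ)) := by
    intro Y hY hY'
    have h1 := scanSum_marked_le hρ hlam hlam1 ha ha1 (fun _ => zero_le_one) (fun _ => le_rfl)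
      (fun u _ => h.nonneg hρ u) hp hz (by omega) (if_pos rfl) hY
    have hY0 : 0 ≤ Y := le_trans (scanSum_nonneg hρ hlam ha (fun _ => zero_le_one) (lt_add_one z)
      fun u _ => h.nonneg hρ u) hY
    rw [boxProb, div_le_iff₀ (hgp.trans_le hZ)]
    have hr := distK_le_rpow hρ hdz
    have hr0 := distK_nonneg hρ (z - p)
    calc _ ≤ lam * pinnedSum ρ lam (z - p).toNat * Y := h1
      _ ≤ lam * (C * ((z - p : ℤ) : ℝ) ^ (-(1 + ρ))) * ((16 * C + 1 / (1 - lam)) * g p) := by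
          gcongr
          exact (hX' _ hdz).trans (by gcongr)
      _ = lam * C * (16 * C + 1 / (1 - lam)) * ((z - p : ℤ) : ℝ) ^ (-(1 + ρ)) * g p := by ring
      _ ≤ _ := by
          have h0 : (0 : ℝ) ≤ ((z - p : ℤ) : ℝ) ^ (-(1 + ρ)) := hr0.trans hr
          gcongr
  rcases h.eq_or_eq with rfl | rfl
  · refine key _ (scanSum_pinned_le hρ hlam hlam1 ha ha1 (fun _ => zero_le_one) (fun _ => le_rfl)
      (lt_add_one z) (by omega)) ?_
    have h1 : distK ρ (1 + n - z) ≤ 4 ^ 2 * distK ρ (1 + n - p) := by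
      refine distK_le_sq_mul hρ hρ1 (by omega) (by omega) (by norm_num) ?_
      have : 1 + (n : ℤ) - p ≤ 4 * (1 + n - z) := by omega
      exact_mod_cast this
    have h2 := hX' (1 + n - z) (by omega)
    have h3 := mul_le_mul_of_nonneg_left h1 hC.le
    have h4 : 0 ≤ 1 / (1 - lam) * distK ρ (1 + n - p) := mul_nonneg hl.le (distK_nonneg hρ _)
    simp only
    linarith
  · refine key _ (scanSum_free_le hρ hlam hlam1 ha ha1 (fun _ => zero_le_one) (fun _ => le_rfl)
      (lt_add_one z)) ?_
    simp only
    linarith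

theorem scanSum_congr {a b a' b' : ℤ → ℝ} {q : ℤ} {n : ℕ}
    (h : ∀ z, q ≤ z → z < q + n → a z = a' z ∧ b z = b' z) (p : ℤ) :
    scanSum ρ lam a b g p q n = scanSum ρ lam a' b' g p q n := by
  induction n generalizing p q with
  | zero => rfl
  | succ n ih =>
    have h' : ∀ z, q + 1 ≤ z → z < q + 1 + n → a z = a' z ∧ b z = b' z :=
      fun z h1 h2 => h z (by omega) (by push_cast; omega)
    have hq := h q le_rfl (by push_cast; omega)
    rw [scanSum, scanSum, ih h', ih h', hq.1, hq.2]

/-- Summing over the sites from `q + m` onwards first. -/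
theorem scanSum_add (a b : ℤ → ℝ) (p q : ℤ) (m n : ℕ) :
    scanSum ρ lam a b g p q (m + n) =
      scanSum ρ lam a b (fun u => scanSum ρ lam a b g u (q + m) n) p q m := by
  induction m generalizing p q with
  | zero => simp [scanSum]
  | succ m ih =>
    have e : q + 1 + (m : ℤ) = q + ((m + 1 : ℕ) : ℤ) := by push_cast; ring
    rw [Nat.add_right_comm, scanSum, ih, ih, e, scanSum]

theorem scanSum_mono {a b g' : ℤ → ℝ} (hρ : 0 < ρ) (hlam : 0 < lam) (ha : ∀ z, 0 ≤ a z)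
    (hb : ∀ z, 0 ≤ b z) {p q : ℤ} {n : ℕ} (hp : g p ≤ g' p)
    (hg : ∀ u, q ≤ u → u < q + n → g u ≤ g' u) :
    scanSum ρ lam a b g p q n ≤ scanSum ρ lam a b g' p q n := by
  induction n generalizing p q with
  | zero => exact hp
  | succ n ih =>
    have hg' : ∀ u, q + 1 ≤ u → u < q + 1 + n → g u ≤ g' u :=
      fun u h1 h2 => hg u (by omega) (by push_cast; omega)
    rw [scanSum, scanSum]
    exact add_le_add (mul_le_mul_of_nonneg_left (ih hp hg') (ha q))
      (mul_le_mul_of_nonneg_left (ih (hg q le_rfl (by push_cast; omega)) hg')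
        (mul_nonneg (hb q) (mul_nonneg hlam.le (distK_nonneg hρ _))))

theorem scanSum_le_scanSum {a b a' b' : ℤ → ℝ} (hρ : 0 < ρ) (hlam : 0 < lam) (ha : ∀ z, 0 ≤ a z)
    (hb : ∀ z, 0 ≤ b z) (haa : ∀ z, a z ≤ a' z) (hbb : ∀ z, b z ≤ b' z) (hg : ∀ u, 0 ≤ g u)
    {p q : ℤ} {n : ℕ} (hp : p < q) :
    scanSum ρ lam a b g p q n ≤ scanSum ρ lam a' b' g p q n := by
  induction n generalizing p q with
  | zero => exact le_rfl
  | succ n ih =>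
    have h1 := distK_nonneg hρ (q - p)
    have h2 := scanSum_nonneg hρ hlam ha hb (lt_add_one q) (n := n) fun u _ => hg u
    have h3 := scanSum_nonneg hρ hlam ha hb (show p < q + 1 by omega) (n := n) fun u _ => hg u
    have h4 := (ha q).trans (haa q)
    have h5 := (hb q).trans (hbb q)
    have h6 := haa q
    have h7 := hbb q
    have h8 := ih (lt_add_one q)
    have h9 := ih (show p < q + 1 by omega)
    rw [scanSum, scanSum]
    gcongr

theorem scanSum_const (a b : ℤ → ℝ) (c : ℝ) (p q : ℤ) (n : ℕ) :
    scanSum ρ lam a b (fun _ => c) p q n = c * scanSum ρ lam a b (fun _ => 1) p q n := by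
  induction n generalizing p q with
  | zero => simp [scanSum]
  | succ n ih => rw [scanSum, scanSum, ih, ih]; ring

/-- Moving the last particle before the box changes the partition function at most as much as it
changes each of the admissible first gaps. -/
theorem scanSum_le_mul_scanSum {a b : ℤ → ℝ} (hρ : 0 < ρ) (hlam : 0 < lam) (ha : ∀ z, 0 ≤ a z)
    (hb : ∀ z, 0 ≤ b z) (hg : ∀ u, 0 ≤ g u) {u u' q : ℤ} {n : ℕ} {s : ℝ}
    (hgu : g u ≤ s * g u')
    (hs : ∀ v, q ≤ v → v < q + n → b v ≠ 0 → distK ρ (v - u) ≤ s * distK ρ (v - u')) :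
    scanSum ρ lam a b g u q n ≤ s * scanSum ρ lam a b g u' q n := by
  induction n generalizing q with
  | zero => exact hgu
  | succ n ih =>
    have h1 := mul_le_mul_of_nonneg_left (ih (q := q + 1) fun v h1 h2 =>
      hs v (by omega) (by push_cast; omega)) (ha q)
    have h2 := scanSum_nonneg hρ hlam ha hb (lt_add_one q) (n := n) fun u _ => hg u
    have h3 : b q * (lam * distK ρ (q - u)) ≤ s * (b q * (lam * distK ρ (q - u'))) := by
      by_cases hbq : b q = 0
      · simp [hbq]
      · have := mul_le_mul_of_nonneg_left (hs q le_rfl (by push_cast; omega) hbq)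
          (mul_nonneg (hb q) hlam.le)
        linarith
    have h4 := mul_le_mul_of_nonneg_right h3 h2
    rw [scanSum, scanSum]
    linarith

/-- Conditionally on the absence of particles in `(m, M]`, the law of the configuration in `[1, m]`
hardly depends on what happens beyond `M`: the partition function of the remaining sites varies
little with the position of the last particle. -/
theorem gap_scanSum_comparison (hρ : 0 < ρ) (hρ1 : ρ < 1) (hlam : 0 < lam) {m M : ℕ}
    (hmM : m < M) (hMn : M ≤ n) (h : BoxBoundary ρ n τ p g) (hpm : -(m : ℤ) ≤ p) :
    ∃ G : ℝ, 0 < G ∧ ∀ a : ℤ → ℝ, (∀ z, 0 ≤ a z) → (∀ z : ℤ, (m : ℤ) < z → a z = 1) →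
      G * scanSum ρ lam a (fun _ => 1) (fun _ => 1) p 1 m ≤
        scanSum ρ lam a (fun y => if (m : ℤ) < y ∧ y ≤ M then 0 else 1) g p 1 n ∧
      scanSum ρ lam a (fun y => if (m : ℤ) < y ∧ y ≤ M then 0 else 1) g p 1 n ≤
        (((M : ℝ) + m) / (M - m)) ^ 2 * (G * scanSum ρ lam a (fun _ => 1) (fun _ => 1) p 1 m) := by
  set b : ℤ → ℝ := fun y => if (m : ℤ) < y ∧ y ≤ M then 0 else 1 with hb
  have hb0 : ∀ y, 0 ≤ b y := fun y => by simp only [hb]; split_ifs <;> norm_num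
  have hp := h.lt
  have hmM' : (0 : ℝ) < (M : ℝ) - m := by
    have : (m : ℝ) < M := by exact_mod_cast hmM
    linarith
  have hm0 : (0 : ℝ) ≤ m := m.cast_nonneg
  set s : ℝ := ((M : ℝ) + m) / (M - m) with hs
  have hs1 : 1 ≤ s := by rw [hs, le_div_iff₀ hmM']; linarith
  set G : ℤ → ℝ := fun u => scanSum ρ lam (fun _ => 1) b g u (1 + m) (n - m) with hG
  have hGp : 0 < G p := (h.pos hρ (by omega)).trans_le
    (le_scanSum hρ hlam hb0 (by omega) fun u _ => h.nonneg hρ u)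
  -- Gaps that end beyond `M` are hardly affected by the position of their left end in `[p, m]`.
  have hup : ∀ u v : ℤ, u ≤ m → (M : ℤ) < v → distK ρ (v - u) ≤ s ^ 2 * distK ρ (v - p) := by
    intro u v hu hv
    refine distK_le_sq_mul hρ hρ1 (by omega) (by omega) hs1 ?_
    have h1 : (u : ℝ) ≤ m := by exact_mod_cast hu
    have h2 : (M : ℝ) < v := by exact_mod_cast hv
    have h3 : -(m : ℝ) ≤ p := by exact_mod_cast hpm
    have h4 : (v : ℝ) + m ≤ s * (v - m) := by
      rw [hs, div_mul_eq_mul_div, le_div_iff₀ hmM']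
      nlinarith
    push_cast
    nlinarith
  have hlow : ∀ u v : ℤ, p ≤ u → u < v → distK ρ (v - p) ≤ 1 * distK ρ (v - u) := by
    intro u v hu hv
    have := distK_le_sq_mul hρ hρ1 (d := v - p) (e := v - u) (by omega) (by omega) le_rfl
      (by rw [one_mul]; exact_mod_cast (by omega : v - u ≤ v - p))
    simpa using this
  have hGu : ∀ u : ℤ, p ≤ u → u ≤ m → G p ≤ G u ∧ G u ≤ s ^ 2 * G p := by
    intro u hpu hum
    constructor
    · rw [← one_mul (G u)]
      refine scanSum_le_mul_scanSum hρ hlam (fun _ => zero_le_one) hb0 (h.nonneg hρ) ?_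
        fun v hv _ _ => hlow u v hpu (by omega)
      rcases h.eq_or_eq with rfl | rfl
      · exact hlow u (1 + n) hpu (by omega)
      · simp
    · refine scanSum_le_mul_scanSum hρ hlam (fun _ => zero_le_one) hb0 (h.nonneg hρ) ?_
        fun v hv _ hbv => hup u v hum ?_
      · rcases h.eq_or_eq with rfl | rfl
        · exact hup u (1 + n) hum (by omega)
        · simpa only [mul_one] using one_le_pow₀ hs1
      · by_contra hh
        exact hbv (if_pos ⟨by omega, by omega⟩)
  refine ⟨G p, hGp, fun a ha ham => ?_⟩
  have e1 : scanSum ρ lam a b g p 1 n = scanSum ρ lam a (fun _ => 1) G p 1 m := by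
    conv_lhs => rw [← Nat.add_sub_cancel' (show m ≤ n by omega), scanSum_add]
    have e2 : (fun u => scanSum ρ lam a b g u (1 + m) (n - m)) = G := by
      funext u
      exact scanSum_congr (fun z hz _ => ⟨ham z (by omega), rfl⟩) u
    rw [e2]
    exact scanSum_congr (fun z _ hz => ⟨rfl, if_neg fun hh => by omega⟩) p
  rw [e1, ← mul_assoc, ← scanSum_const, ← scanSum_const]
  constructor <;> refine scanSum_mono hρ hlam ha (fun _ => zero_le_one) ?_ fun u h1 h2 => ?_
  · exact le_rfl
  · exact (hGu u (by omega) (by omega)).1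
  · exact (hGu p le_rfl (by omega)).2
  · exact (hGu u (by omega) (by omega)).2

/-- Forbidding some particles costs a sub-event at most as much weight as the whole space. -/
theorem scanSum_sub_le_sub (hρ : 0 < ρ) (hlam : 0 < lam) (h : BoxBoundary ρ n τ p g)
    {a b : ℤ → ℝ} (ha : ∀ z, 0 ≤ a z) (ha1 : ∀ z, a z ≤ 1) (hb : ∀ z, 0 ≤ b z)
    (hb1 : ∀ z, b z ≤ 1) :
    scanSum ρ lam a (fun _ => 1) g p 1 n - scanSum ρ lam a b g p 1 n ≤
      scanSum ρ lam (fun _ => 1) (fun _ => 1) g p 1 n -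
        scanSum ρ lam (fun _ => 1) b g p 1 n := by
  simp only [← sum_scanWeight ρ lam _ _ g τ p n, ← Finset.sum_sub_distrib, ← mul_sub]
  refine Finset.sum_le_sum fun σ _ => mul_le_mul_of_nonneg_left ?_
    (scanWeight_pos hρ hlam h.lt (fun u hu => h.pos hρ hu) _).le
  have e : (∏ x : Finset.Icc 1 (n : ℤ), if σ x = true then b x else a x) =
      (∏ x : Finset.Icc 1 (n : ℤ), if σ x = true then 1 else a x) *
        ∏ x : Finset.Icc 1 (n : ℤ), if σ x = true then b x else 1 := by
    rw [← Finset.prod_mul_distrib]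
    exact Finset.prod_congr rfl fun x _ => by split_ifs <;> simp
  have h1 : (∏ x : Finset.Icc 1 (n : ℤ), if σ x = true then 1 else a x) ≤ 1 :=
    Finset.prod_le_one (fun x _ => by split_ifs; exacts [zero_le_one, ha x])
      fun x _ => by split_ifs; exacts [le_rfl, ha1 x]
  have h2 : (∏ x : Finset.Icc 1 (n : ℤ), if σ x = true then b x else 1) ≤ 1 :=
    Finset.prod_le_one (fun x _ => by split_ifs; exacts [hb x, zero_le_one])
      fun x _ => by split_ifs; exacts [hb1 x, le_rfl]
  rw [e]
  simp only [ite_self, Finset.prod_const_one]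
  nlinarith

/-- A union bound for the weight of the configurations with a particle in `(m, M]`. -/
theorem scanSum_sub_gap_le (hρ : 0 < ρ) (hlam : 0 < lam) (h : BoxBoundary ρ n τ p g)
    (m M : ℕ) :
    scanSum ρ lam (fun _ => 1) (fun _ => 1) g p 1 n -
      scanSum ρ lam (fun _ => 1) (fun y => if (m : ℤ) < y ∧ y ≤ M then 0 else 1) g p 1 n ≤
        ∑ y ∈ Finset.Ioc (m : ℤ) M, scanSum ρ lam (fun z => if z = y then 0 else 1) (fun _ => 1)
          g p 1 n := by
  simp only [← sum_scanWeight ρ lam _ _ g τ p n, ← Finset.sum_sub_distrib, ← mul_sub]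
  rw [Finset.sum_comm]
  simp only [← Finset.mul_sum]
  refine Finset.sum_le_sum fun σ _ => mul_le_mul_of_nonneg_left ?_
    (scanWeight_pos hρ hlam h.lt (fun u hu => h.pos hρ hu) _).le
  have hnn : ∀ y ∈ Finset.Ioc (m : ℤ) M, (0 : ℝ) ≤
      ∏ x : Finset.Icc 1 (n : ℤ), if σ x = true then 1 else if (x : ℤ) = y then 0 else 1 :=
    fun y _ => Finset.prod_nonneg fun x _ => by split_ifs <;> norm_num
  simp only [ite_self, Finset.prod_const_one]
  by_cases hex : ∃ x : Finset.Icc 1 (n : ℤ), σ x = true ∧ (m : ℤ) < x ∧ (x : ℤ) ≤ M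
  · obtain ⟨x, hx, hxm, hxM⟩ := hex
    have h1 : (0 : ℝ) ≤ ∏ x : Finset.Icc 1 (n : ℤ),
        if σ x = true then (if (m : ℤ) < x ∧ (x : ℤ) ≤ M then 0 else 1) else 1 :=
      Finset.prod_nonneg fun x _ => by split_ifs <;> norm_num
    have h2 := Finset.single_le_sum hnn (Finset.mem_Ioc.2 ⟨hxm, hxM⟩)
    rw [Finset.prod_eq_one fun y _ => ?_] at h2
    · linarith
    · split_ifs with h3 h4
      · rfl
      · exact absurd (Subtype.ext h4 ▸ hx) h3
      · rfl
  · rw [Finset.prod_eq_one fun x _ => ?_]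
    · simpa using Finset.sum_nonneg hnn
    · split_ifs with h1 h2
      · exact absurd ⟨x, h1, h2⟩ hex
      · rfl
      · rfl

/-- The equilibrium near the left end of the box hardly depends on the boundary condition at the
right end: with high probability there is no particle in `(m, M]`, and given this event both
equilibria are close on `[1, m]`. -/
theorem boxProb_sub_boxProb_le (hρ : 0 < ρ) (hρ1 : ρ < 1) (hlam : 0 < lam) {m M : ℕ}
    (hmM : m < M) (hMn : M ≤ n) {τ' : ℤ → Bool} {g' : ℤ → ℝ} (h : BoxBoundary ρ n τ p g)
    (h' : BoxBoundary ρ n τ' p g') (hpm : -(m : ℤ) ≤ p) {z : ℤ} (hzm : z ≤ m) :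
    boxProb ρ lam g p n z - boxProb ρ lam g' p n z ≤
      ∑ y ∈ Finset.Ioc (m : ℤ) M, boxProb ρ lam g p n y +
        ∑ y ∈ Finset.Ioc (m : ℤ) M, boxProb ρ lam g' p n y +
          ((((M : ℝ) + m) / (M - m)) ^ 4 - 1) := by
  obtain ⟨G, hG, hGa⟩ := gap_scanSum_comparison (lam := lam) hρ hρ1 hlam hmM hMn h hpm
  obtain ⟨G', hG', hGa'⟩ := gap_scanSum_comparison (lam := lam) hρ hρ1 hlam hmM hMn h' hpm
  set b : ℤ → ℝ := fun y => if (m : ℤ) < y ∧ y ≤ M then 0 else 1 with hb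
  set a : ℤ → ℝ := fun y => if y = z then 0 else 1 with ha
  have hb0 : ∀ y, 0 ≤ b y := fun y => by simp only [hb]; split_ifs <;> norm_num
  have hb1 : ∀ y, b y ≤ 1 := fun y => by simp only [hb]; split_ifs <;> norm_num
  have ha0 : ∀ y, 0 ≤ a y := fun y => by simp only [ha]; split_ifs <;> norm_num
  have ha1 : ∀ y, a y ≤ 1 := fun y => by simp only [ha]; split_ifs <;> norm_num
  have ham : ∀ y : ℤ, (m : ℤ) < y → a y = 1 := fun y hy => if_neg (by omega)
  set s : ℝ := ((M : ℝ) + m) / (M - m) with hs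
  set Z := scanSum ρ lam (fun _ => 1) (fun _ => 1) g p 1 n with hZ
  set Z' := scanSum ρ lam (fun _ => 1) (fun _ => 1) g' p 1 n with hZ'
  set N := scanSum ρ lam a (fun _ => 1) g p 1 n with hN
  set N' := scanSum ρ lam a (fun _ => 1) g' p 1 n with hN'
  set Y := scanSum ρ lam (fun _ => 1) b g p 1 n with hY
  set Y' := scanSum ρ lam (fun _ => 1) b g' p 1 n with hY'
  set V := scanSum ρ lam a b g p 1 n with hV
  set V' := scanSum ρ lam a b g' p 1 n with hV'
  set A := scanSum ρ lam a (fun _ => 1) (fun _ => 1) p 1 m with hA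
  set B := scanSum ρ lam (fun _ => 1) (fun _ => 1) (fun _ => 1) p 1 m with hB
  have hp := h.lt
  have hB0 : 1 ≤ B := le_scanSum hρ hlam (fun _ => zero_le_one) hp fun _ _ => zero_le_one
  have hA0 : 0 ≤ A := scanSum_nonneg hρ hlam ha0 (fun _ => zero_le_one) hp fun _ _ => zero_le_one
  obtain ⟨-, v1⟩ := hGa a ha0 ham
  obtain ⟨y1, -⟩ := hGa (fun _ => 1) (fun _ => zero_le_one) fun _ _ => rfl
  obtain ⟨v1', -⟩ := hGa' a ha0 ham
  obtain ⟨-, y1'⟩ := hGa' (fun _ => 1) (fun _ => zero_le_one) fun _ _ => rfl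
  have hZ0 : 0 < Z := h.sum_pos hρ hlam
  have hZ0' : 0 < Z' := h'.sum_pos hρ hlam
  have hY0 : 0 < Y := lt_of_lt_of_le (by positivity) y1
  have hY0' : 0 < Y' := (h'.pos hρ (by omega)).trans_le
    (le_scanSum hρ hlam hb0 hp fun u _ => h'.nonneg hρ u)
  have hV0 : 0 ≤ V := scanSum_nonneg hρ hlam ha0 hb0 hp fun u _ => h.nonneg hρ u
  have hV0' : 0 ≤ V' := scanSum_nonneg hρ hlam ha0 hb0 hp fun u _ => h'.nonneg hρ u
  have d1 : N - V ≤ Z - Y := scanSum_sub_le_sub hρ hlam h ha0 ha1 hb0 hb1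
  have d2 : Z - Y ≤ _ := scanSum_sub_gap_le hρ hlam h m M
  have d2' : Z' - Y' ≤ _ := scanSum_sub_gap_le hρ hlam h' m M
  have e : (Z - Y) / Z ≤ ∑ y ∈ Finset.Ioc (m : ℤ) M, boxProb ρ lam g p n y := by
    simp only [boxProb, ← Finset.sum_div]
    gcongr
  have e' : (Z' - Y') / Z' ≤ ∑ y ∈ Finset.Ioc (m : ℤ) M, boxProb ρ lam g' p n y := by
    simp only [boxProb, ← Finset.sum_div]
    gcongr
  have hYZ : Y ≤ Z := scanSum_le_scanSum hρ hlam (fun _ => zero_le_one) hb0 (fun _ => le_rfl) hb1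
    (h.nonneg hρ) hp
  have hVY' : V' ≤ Y' := scanSum_le_scanSum hρ hlam ha0 hb0 ha1 (fun _ => le_rfl) (h'.nonneg hρ) hp
  have hVN' : V' ≤ N' := scanSum_le_scanSum hρ hlam ha0 hb0 (fun _ => le_rfl) hb1 (h'.nonneg hρ) hp
  have hmM' : (0 : ℝ) < (M : ℝ) - m := by
    have : (m : ℝ) < M := by exact_mod_cast hmM
    linarith
  have hs1 : 1 ≤ s := by
    rw [hs, le_div_iff₀ hmM']
    linarith [(m.cast_nonneg : (0 : ℝ) ≤ m)]
  have hs0 : 0 < s := by linarith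
  have c1 : N / Z ≤ V / Y + (Z - Y) / Z := by
    calc N / Z ≤ (V + (Z - Y)) / Z := by gcongr; linarith
      _ = V / Z + (Z - Y) / Z := add_div _ _ _
      _ ≤ _ := by gcongr
  have c2 : V / Y ≤ s ^ 4 * (V' / Y') := by
    have h1 : V / Y ≤ s ^ 2 * (A / B) := by
      rw [div_le_iff₀ hY0]
      calc V ≤ s ^ 2 * (G * A) := v1
        _ = s ^ 2 * (A / B) * (G * B) := by field_simp
        _ ≤ s ^ 2 * (A / B) * Y := by gcongr
    have h2 : A / B ≤ s ^ 2 * (V' / Y') := by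
      rw [div_le_iff₀ (by positivity), mul_div_assoc', div_mul_eq_mul_div, le_div_iff₀ hY0']
      calc A * Y' ≤ A * (s ^ 2 * (G' * B)) := by gcongr
        _ = s ^ 2 * (G' * A) * B := by ring
        _ ≤ s ^ 2 * V' * B := by gcongr
    calc V / Y ≤ s ^ 2 * (s ^ 2 * (V' / Y')) := h1.trans (by gcongr)
      _ = _ := by ring
  have c3 : V' / Y' ≤ 1 := (div_le_one hY0').2 hVY'
  have c4 : V' / Y' ≤ V' / Z' + (Z' - Y') / Z' := by
    rw [← add_div, div_le_div_iff₀ hY0' hZ0']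
    have : Y' ≤ Z' := scanSum_le_scanSum hρ hlam (fun _ => zero_le_one) hb0 (fun _ => le_rfl) hb1
      (h'.nonneg hρ) hp
    nlinarith
  have c5 : V' / Z' ≤ N' / Z' := by gcongr
  have c6 : (s ^ 4 - 1) * (V' / Y') ≤ (s ^ 4 - 1) * 1 :=
    mul_le_mul_of_nonneg_left c3 (sub_nonneg.2 (one_le_pow₀ hs1))
  change N / Z - N' / Z' ≤ _
  linarith

end BoxProb

/-! ### Comparison with boxes -/

section Boxes

variable {ρ lam : ℝ} {n L : ℕ} {τ τ' : ℤ → Bool} {p : ℤ} {g : ℤ → ℝ} {e : ℤ ≃ ℤ} {t D : ℝ}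

theorem evolve_occ_full_le (hρ : 0 < ρ) (hlam : 0 < lam) (ht : 0 ≤ t) (he : PreservesRatio ρ e)
    (h : BoxBoundary ρ n τ' p g)
    (hout : ∀ z, z ∉ Finset.Icc 1 (n : ℤ) → τ (e z) ≤ τ' z ∧ (e z ∈ Finset.Icc 1 (L : ℤ) →
      τ' z = true))
    (hin : ∀ z ∈ Finset.Icc 1 (n : ℤ), e z ∈ Finset.Icc 1 (L : ℤ))
    {x : Finset.Icc 1 (n : ℤ)} {y : Finset.Icc 1 (L : ℤ)} (hxy : (y : ℤ) = e x)
    (hD : ∀ σ σ', |evolve ρ lam (Finset.Icc 1 (n : ℤ)) τ' t (occ x) σ -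
      evolve ρ lam (Finset.Icc 1 (n : ℤ)) τ' t (occ x) σ'| ≤ D) :
    evolve ρ lam (Finset.Icc 1 (L : ℤ)) τ t (occ y) (fun _ => true) ≤
      boxProb ρ lam g p n x + D := by
  have hdom : Dominated (Λ := Finset.Icc 1 (L : ℤ)) (Λ' := Finset.Icc 1 (n : ℤ)) e τ τ'
      (fun _ => true, fun _ => true) := by
    intro z
    by_cases hz : z ∈ Finset.Icc 1 (n : ℤ)
    · simp only [glue, hz, dif_pos]
      exact Bool.le_true _
    · by_cases hez : e z ∈ Finset.Icc 1 (L : ℤ)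
      · simp only [glue, hz, dif_neg, not_false_eq_true, (hout z hz).2 hez]
        exact Bool.le_true _
      · simp only [glue, hz, hez, dif_neg, not_false_eq_true, (hout z hz).1]
  have h1 := hdom.evolve_occ_le hρ hlam he (fun z h1 h2 => (hout z h2).2 h1)
    (fun z h1 h2 => absurd (hin z h1) h2) ht hxy
  have h2 := abs_sub_le_iff.1 (h.abs_evolve_occ_sub_boxProb_le hρ hlam hD fun _ => true)
  linarith

theorem le_evolve_occ_empty (hρ : 0 < ρ) (hlam : 0 < lam) (ht : 0 ≤ t) (he : PreservesRatio ρ e)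
    (h : BoxBoundary ρ n τ' p g)
    (hout : ∀ z, z ∉ Finset.Icc 1 (n : ℤ) → τ' z ≤ τ (e z) ∧ (e z ∈ Finset.Icc 1 (L : ℤ) →
      τ' z = false))
    (hin : ∀ z ∈ Finset.Icc 1 (n : ℤ), e z ∈ Finset.Icc 1 (L : ℤ))
    {x : Finset.Icc 1 (n : ℤ)} {y : Finset.Icc 1 (L : ℤ)} (hxy : (y : ℤ) = e x)
    (hD : ∀ σ σ', |evolve ρ lam (Finset.Icc 1 (n : ℤ)) τ' t (occ x) σ -
      evolve ρ lam (Finset.Icc 1 (n : ℤ)) τ' t (occ x) σ'| ≤ D) :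
    boxProb ρ lam g p n x - D ≤
      evolve ρ lam (Finset.Icc 1 (L : ℤ)) τ t (occ y) (fun _ => false) := by
  have hdom : Dominated (Λ := Finset.Icc 1 (n : ℤ)) (Λ' := Finset.Icc 1 (L : ℤ)) e.symm τ' τ
      (fun _ => false, fun _ => false) := by
    intro z
    by_cases hz : e.symm z ∈ Finset.Icc 1 (n : ℤ)
    · simp only [glue, hz, dif_pos]
      exact Bool.false_le _
    · have hh := hout _ hz
      rw [e.apply_symm_apply] at hh
      by_cases hez : z ∈ Finset.Icc 1 (L : ℤ)
      · simp only [glue, hz, dif_neg, not_false_eq_true, hh.2 hez]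
        exact Bool.false_le _
      · simp only [glue, hz, hez, dif_neg, not_false_eq_true, hh.1]
  have h1 := hdom.evolve_occ_le hρ hlam he.symm
    (fun z h1 h2 => absurd (by simpa only [e.apply_symm_apply] using hin _ h1) h2)
    (fun z h1 h2 => (hout _ h2).2 (by simpa only [e.apply_symm_apply] using h1)) ht
    (x := x) (x' := y) (by rw [hxy, e.symm_apply_apply])
  have h2 := abs_sub_le_iff.1 (h.abs_evolve_occ_sub_boxProb_le hρ hlam hD fun _ => false)
  linarith

theorem evolve_occ_nonneg (hρ : 0 < ρ) (hlam : 0 < lam) (ht : 0 ≤ t) {Λ : Finset ℤ} (x : Λ)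
    (σ : Config Λ) : 0 ≤ evolve ρ lam Λ τ t (occ x) σ :=
  le_evolve hρ hlam τ ht (occ_nonneg x) σ

/-- The influence of the initial condition on the occupation of the site `y`. -/
noncomputable def discrepancy (ρ lam : ℝ) (L : ℕ) (τ : ℤ → Bool) (t : ℝ)
    (y : Finset.Icc 1 (L : ℤ)) : ℝ :=
  evolve ρ lam (Finset.Icc 1 (L : ℤ)) τ t (occ y) (fun _ => true) -
    evolve ρ lam (Finset.Icc 1 (L : ℤ)) τ t (occ y) (fun _ => false)

/-- The dynamics in the box `{1, …, n}` has forgotten its initial condition up to an error `D`. -/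
def BoxMixed (ρ lam : ℝ) (n : ℕ) (t D : ℝ) : Prop :=
  ∀ (τ : ℤ → Bool) (x : Finset.Icc 1 (n : ℤ)) (σ σ' : Config (Finset.Icc 1 (n : ℤ))),
    |evolve ρ lam (Finset.Icc 1 (n : ℤ)) τ t (occ x) σ -
      evolve ρ lam (Finset.Icc 1 (n : ℤ)) τ t (occ x) σ'| ≤ D

/-- Surrounding a box by particles bounds the influence of the initial condition in the box. -/
theorem exists_discrepancy_le (hρ : 0 < ρ) (hρ1 : ρ < 1) (hlam : 0 < lam) (hlam1 : lam < 1) :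
    ∃ C : ℝ, 0 < C ∧ (∀ (n L : ℕ) (τ : ℤ → Bool) (e : ℤ ≃ ℤ) (t D : ℝ), 0 ≤ t →
      BoxMixed ρ lam n t D → PreservesRatio ρ e →
      (∀ z ∈ Finset.Icc 1 (n : ℤ), e z ∈ Finset.Icc 1 (L : ℤ)) → ∀ z : ℤ, 1 ≤ z → 2 * z ≤ n + 1 →
        ∀ y : Finset.Icc 1 (L : ℤ), (y : ℤ) = e z →
          discrepancy ρ lam L τ t y ≤ C * (z : ℝ) ^ (-(1 + ρ)) + D) ∧
      ∀ (n L : ℕ) (τ : ℤ → Bool) (e : ℤ ≃ ℤ) (t D : ℝ), 0 ≤ t →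
      BoxMixed ρ lam n t D → PreservesRatio ρ e → n ≤ L →
      (∀ z, e z ∈ Finset.Icc 1 (L : ℤ) ↔ z ∈ Finset.Icc 1 (L : ℤ)) →
      ∀ m M : ℕ, 1 ≤ m → m < M → 2 * M ≤ n + 1 → ∀ z : ℤ, 1 ≤ z → z ≤ m →
        ∀ y : Finset.Icc 1 (L : ℤ), (y : ℤ) = e z →
          discrepancy ρ lam L τ t y ≤ 2 * (C * ∑ y ∈ Finset.Ioc (m : ℤ) M, (y : ℝ) ^ (-(1 + ρ))) +
            ((((M : ℝ) + m) / (M - m)) ^ 4 - 1) + C * (m : ℝ) ^ (-(1 + ρ)) + 2 * D := by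
  obtain ⟨C, hC, hbox⟩ := exists_boxProb_le hρ hρ1 hlam hlam1
  refine ⟨C, hC, ?_, ?_⟩
  · intro n L τ e t D ht hD he hin z hz hzn y hy
    have hzmem : z ∈ Finset.Icc 1 (n : ℤ) := by rw [Finset.mem_Icc]; omega
    have hb : BoxBoundary ρ n (fun _ => true) 0 (fun u => distK ρ (1 + n - u)) :=
      ⟨by norm_num, rfl, fun z h1 h2 => by omega, Or.inl ⟨rfl, fun _ => rfl⟩⟩
    have h1 := evolve_occ_full_le (τ := τ) hρ hlam ht he hb (fun z _ => ⟨Bool.le_true _, fun _ => rfl⟩)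
      hin (x := ⟨z, hzmem⟩) hy (hD _ _)
    have h2 := evolve_occ_nonneg (τ := τ) hρ hlam ht y fun _ => false
    have h3 := hbox n _ 0 _ hb (by omega) z hz hzn
    rw [sub_zero] at h3
    rw [discrepancy]
    linarith
  · intro n L τ e t D ht hD he hnL heL m M hm hmM hMn z hz hzm y hy
    have hzmem : z ∈ Finset.Icc 1 (n : ℤ) := by rw [Finset.mem_Icc]; omega
    have hin : ∀ z ∈ Finset.Icc 1 (n : ℤ), e z ∈ Finset.Icc 1 (L : ℤ) := by
      intro z hz
      rw [heL]
      rw [Finset.mem_Icc] at hz ⊢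
      omega
    have hD0 : 0 ≤ D := (abs_nonneg _).trans (hD τ ⟨z, hzmem⟩ (fun _ => true) fun _ => true)
    have hs : (0 : ℝ) ≤ (((M : ℝ) + m) / (M - m)) ^ 4 - 1 := by
      have hmM' : (0 : ℝ) < (M : ℝ) - m := by
        have : (m : ℝ) < M := by exact_mod_cast hmM
        linarith
      refine sub_nonneg.2 (one_le_pow₀ ?_)
      rw [le_div_iff₀ hmM']
      linarith [(m.cast_nonneg : (0 : ℝ) ≤ m)]
    have hpow : ∀ y ∈ Finset.Ioc (m : ℤ) M, (0 : ℝ) ≤ (y : ℝ) ^ (-(1 + ρ)) := by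
      intro y hy
      have : (0 : ℝ) ≤ y := by exact_mod_cast (by have := (Finset.mem_Ioc.1 hy).1; omega : 0 ≤ y)
      positivity
    have hS : 0 ≤ C * ∑ y ∈ Finset.Ioc (m : ℤ) M, (y : ℝ) ^ (-(1 + ρ)) :=
      mul_nonneg hC.le (Finset.sum_nonneg hpow)
    have hanti : ∀ {a b : ℝ}, 0 < a → a ≤ b → b ^ (-(1 + ρ)) ≤ a ^ (-(1 + ρ)) := fun ha hab =>
      Real.rpow_le_rpow_of_nonpos ha hab (by linarith)
    by_cases hex : ∃ q : ℤ, -(m : ℤ) ≤ q ∧ q < 1 ∧ τ (e q) = true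
    · -- The last particle on the left is close to the box: compare two equilibria.
      obtain ⟨p, ⟨hpm, hp1, hpτ⟩, hpmax⟩ : ∃ p : ℤ, (-(m : ℤ) ≤ p ∧ p < 1 ∧ τ (e p) = true) ∧
          ∀ q, (-(m : ℤ) ≤ q ∧ q < 1 ∧ τ (e q) = true) → q ≤ p :=
        Int.exists_greatest_of_bdd ⟨1, fun q hq => by omega⟩ hex
      have hempty : ∀ z, p < z → z < 1 → τ (e z) = false := by
        intro z h1 h2
        by_contra hh
        have := hpmax z ⟨by omega, h2, by simpa using hh⟩
        omega
      have hb1 : BoxBoundary ρ n (fun z => if z < 1 then τ (e z) else true) p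
          (fun u => distK ρ (1 + n - u)) :=
        ⟨hp1, by simp only [hp1, if_true, hpτ], fun z h1 h2 => by
          simp only [h2, if_true, hempty z h1 h2], Or.inl ⟨if_neg (by omega), fun _ => rfl⟩⟩
      have hb0 : BoxBoundary ρ n (fun z => if z < 1 then τ (e z) else false) p (fun _ => 1) :=
        ⟨hp1, by simp only [hp1, if_true, hpτ], fun z h1 h2 => by
          simp only [h2, if_true, hempty z h1 h2],
          Or.inr ⟨fun z hz => if_neg (by omega), fun _ => rfl⟩⟩
      have h1 := evolve_occ_full_le (τ := τ) hρ hlam ht he hb1 (L := L) (fun z hz => by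
        split_ifs with hz1
        · refine ⟨le_rfl, fun hh => ?_⟩
          rw [heL, Finset.mem_Icc] at hh
          omega
        · exact ⟨Bool.le_true _, fun _ => rfl⟩) hin (x := ⟨z, hzmem⟩) hy (hD _ _)
      have h0 := le_evolve_occ_empty (τ := τ) hρ hlam ht he hb0 (L := L) (fun z hz => by
        split_ifs with hz1
        · refine ⟨le_rfl, fun hh => ?_⟩
          rw [heL, Finset.mem_Icc] at hh
          omega
        · exact ⟨Bool.false_le _, fun _ => rfl⟩) hin (x := ⟨z, hzmem⟩) hy (hD _ _)
      have hd := boxProb_sub_boxProb_le hρ hρ1 hlam hmM (by omega) hb1 hb0 hpm hzm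
      have hsum : ∀ {τ' g'}, BoxBoundary ρ n τ' p g' →
          ∑ y ∈ Finset.Ioc (m : ℤ) M, boxProb ρ lam g' p n y ≤
            C * ∑ y ∈ Finset.Ioc (m : ℤ) M, (y : ℝ) ^ (-(1 + ρ)) := by
        intro τ' g' hb
        rw [Finset.mul_sum]
        refine Finset.sum_le_sum fun y hy => ?_
        have hy' := Finset.mem_Ioc.1 hy
        refine (hbox n _ p _ hb (by omega) y (by omega) (by omega)).trans
          (mul_le_mul_of_nonneg_left (hanti ?_ ?_) hC.le)
        · exact_mod_cast (by omega : 0 < y)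
        · exact_mod_cast (by omega : y ≤ y - p)
      have hs1 := hsum hb1
      have hs0 := hsum hb0
      have hm0 : 0 ≤ C * (m : ℝ) ^ (-(1 + ρ)) := by positivity
      rw [discrepancy]
      linarith
    · -- Otherwise the upper dynamics only sees a far particle on the left.
      have hb : BoxBoundary ρ n (fun z => if -(m : ℤ) < z ∧ z < 1 then false else true) (-m)
          (fun u => distK ρ (1 + n - u)) :=
        ⟨by omega, if_neg (by omega), fun z h1 h2 => if_pos ⟨h1, h2⟩,
          Or.inl ⟨if_neg (by omega), fun _ => rfl⟩⟩
      have h1 := evolve_occ_full_le (τ := τ) hρ hlam ht he hb (L := L) (fun z hz => by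
        split_ifs with hz1
        · constructor
          · have : τ (e z) = false := by
              by_contra hh
              exact hex ⟨z, by omega, hz1.2, by simpa using hh⟩
            rw [this]
          · intro hh
            rw [heL, Finset.mem_Icc] at hh
            omega
        · exact ⟨Bool.le_true _, fun _ => rfl⟩) hin (x := ⟨z, hzmem⟩) hy (hD _ _)
      have h2 := evolve_occ_nonneg (τ := τ) hρ hlam ht y fun _ => false
      have h3 := hbox n _ _ _ hb (by omega) z hz (by omega)
      have h4 : C * ((z - -(m : ℤ) : ℤ) : ℝ) ^ (-(1 + ρ)) ≤ C * (m : ℝ) ^ (-(1 + ρ)) := by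
        refine mul_le_mul_of_nonneg_left (hanti (by exact_mod_cast hm) ?_) hC.le
        exact_mod_cast (by omega : (m : ℤ) ≤ z - -(m : ℤ))
      rw [discrepancy]
      linarith

end Boxes

section Sum

/-- The tail of the series `∑ y ^ (-(1 + ρ))` is of order `m ^ (-ρ / 2)` at most. -/
theorem exists_sum_rpow_le {ρ : ℝ} (hρ : 0 < ρ) : ∃ S : ℝ, 0 < S ∧ ∀ (m : ℕ) (s : Finset ℤ), 1 ≤ m →
    (∀ y ∈ s, (m : ℤ) ≤ y) → ∑ y ∈ s, (y : ℝ) ^ (-(1 + ρ)) ≤ S * (m : ℝ) ^ (-(ρ / 2)) := by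
  have hs : Summable fun i : ℕ => (i : ℝ) ^ (-(1 + ρ / 2)) :=
    Real.summable_nat_rpow.2 (by linarith)
  refine ⟨∑' i : ℕ, (i : ℝ) ^ (-(1 + ρ / 2)), hs.tsum_pos (fun i => by positivity) 1 (by simp), ?_⟩
  intro m s hm hsm
  have hm' : (0 : ℝ) < m := by exact_mod_cast hm
  calc ∑ y ∈ s, (y : ℝ) ^ (-(1 + ρ)) ≤
        ∑ y ∈ s, ((y.toNat : ℕ) : ℝ) ^ (-(1 + ρ / 2)) * (m : ℝ) ^ (-(ρ / 2)) := by
        refine Finset.sum_le_sum fun y hy => ?_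
        have hy1 := hsm y hy
        have e : ((y.toNat : ℕ) : ℝ) = y := by
          have : ((y.toNat : ℕ) : ℤ) = y := by omega
          exact_mod_cast this
        have hmy : (m : ℝ) ≤ y := by exact_mod_cast hy1
        have hy0 : (0 : ℝ) < y := by linarith
        rw [e, show -(1 + ρ) = -(1 + ρ / 2) + -(ρ / 2) by ring, Real.rpow_add hy0]
        exact mul_le_mul_of_nonneg_left (Real.rpow_le_rpow_of_nonpos hm' hmy (by linarith))
          (by positivity)
    _ = (∑ i ∈ s.image Int.toNat, (i : ℝ) ^ (-(1 + ρ / 2))) * (m : ℝ) ^ (-(ρ / 2)) := by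
        rw [← Finset.sum_mul, Finset.sum_image]
        intro a ha b hb hab
        have := hsm a ha
        have := hsm b hb
        omega
    _ ≤ _ := by
        gcongr
        exact hs.sum_le_tsum _ fun i _ => by positivity

variable {ρ lam : ℝ}

/-- Summation over all sites of `{1, …, L}`: sites at distance more than `n / 2` from the boundary
are treated with a centred box, the others with a box at the edge. -/
theorem exists_sum_discrepancy_le (hρ : 0 < ρ) (hρ1 : ρ < 1) (hlam : 0 < lam) (hlam1 : lam < 1) :
    ∃ C : ℝ, 0 < C ∧ ∀ (n L : ℕ) (τ : ℤ → Bool) (t D : ℝ), 0 ≤ t → BoxMixed ρ lam n t D → n ≤ L →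
      ∀ k m : ℕ, 1 ≤ k → k ≤ m → m < n / 2 →
        ∑ y, discrepancy ρ lam L τ t y ≤
          C * (k * ((m : ℝ) ^ (-(ρ / 2)) +
            (((((n / 2 : ℕ) : ℝ) + m) / (((n / 2 : ℕ) : ℝ) - m)) ^ 4 - 1)) +
              (k : ℝ) ^ (-(ρ / 2))) +
            L * (C * ((n / 2 : ℕ) : ℝ) ^ (-(1 + ρ)) + 2 * D) := by
  obtain ⟨C, hC, hbulk, hedge⟩ := exists_discrepancy_le hρ hρ1 hlam hlam1
  obtain ⟨S, hS, htail⟩ := exists_sum_rpow_le hρ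
  refine ⟨2 + 2 * C + 4 * C * S, by positivity, ?_⟩
  intro n L τ t D ht hD hnL k m hk hkm hm
  set h := n / 2 with hh
  have hL1 : 1 ≤ L := by omega
  have hD0 : 0 ≤ D := (abs_nonneg _).trans (hD τ ⟨1, by rw [Finset.mem_Icc]; omega⟩ (fun _ => true)
    fun _ => true)
  set s : ℝ := ((((h : ℕ) : ℝ) + m) / ((h : ℝ) - m)) ^ 4 - 1 with hs
  have hs0 : 0 ≤ s := by
    have hmM' : (0 : ℝ) < (h : ℝ) - m := by
      have : (m : ℝ) < h := by exact_mod_cast hm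
      linarith
    refine sub_nonneg.2 (one_le_pow₀ ?_)
    rw [le_div_iff₀ hmM']
    linarith [(m.cast_nonneg : (0 : ℝ) ≤ m)]
  set F : ℝ := (2 * C * S + C) * (m : ℝ) ^ (-(ρ / 2)) + s with hF
  have hm1 : (1 : ℝ) ≤ m := by exact_mod_cast hk.trans hkm
  have hF0 : 0 ≤ F := by positivity
  set B : ℤ → ℝ := fun z => if z ≤ k then F else C * (z : ℝ) ^ (-(1 + ρ)) with hB
  have hB0 : ∀ z ∈ Finset.Icc 1 (L : ℤ), 0 ≤ B z := by
    intro z hz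
    have : (0 : ℝ) ≤ z := by exact_mod_cast (by have := (Finset.mem_Icc.1 hz).1; omega : 0 ≤ z)
    simp only [hB]
    split_ifs
    · exact hF0
    · positivity
  have hedgeB : ∀ (e : ℤ ≃ ℤ), PreservesRatio ρ e →
      (∀ z, e z ∈ Finset.Icc 1 (L : ℤ) ↔ z ∈ Finset.Icc 1 (L : ℤ)) → ∀ z : ℤ, 1 ≤ z →
        2 * z ≤ n + 1 → ∀ y : Finset.Icc 1 (L : ℤ), (y : ℤ) = e z →
          discrepancy ρ lam L τ t y ≤ B z + 2 * D := by
    intro e he heL z hz hzn y hy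
    simp only [hB]
    split_ifs with hzk
    · have h1 := hedge n L τ e t D ht hD he hnL heL m h (by omega) hm (by omega) z hz (by omega) y hy
      have h2 := mul_le_mul_of_nonneg_left (htail m (Finset.Ioc (m : ℤ) h) (by omega)
        fun y hy => (Finset.mem_Ioc.1 hy).1.le) hC.le
      have h3 : C * (m : ℝ) ^ (-(1 + ρ)) ≤ C * (m : ℝ) ^ (-(ρ / 2)) := by
        refine mul_le_mul_of_nonneg_left ?_ hC.le
        exact Real.rpow_le_rpow_of_exponent_le hm1 (by linarith)
      rw [hF]
      linarith
    · have h1 := hbulk n L τ e t D ht hD he (fun z hz => by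
        rw [heL]; rw [Finset.mem_Icc] at hz ⊢; omega) z hz hzn y hy
      linarith
  have hsite : ∀ y : Finset.Icc 1 (L : ℤ), discrepancy ρ lam L τ t y ≤
      B y + B (L + 1 - y) + (C * (h : ℝ) ^ (-(1 + ρ)) + 2 * D) := by
    intro y
    have hy := Finset.mem_Icc.1 y.2
    have hy' : (L : ℤ) + 1 - y ∈ Finset.Icc 1 (L : ℤ) := by rw [Finset.mem_Icc]; omega
    have hb1 := hB0 y y.2
    have hb2 := hB0 _ hy'
    have hb3 : 0 ≤ C * (h : ℝ) ^ (-(1 + ρ)) := by positivity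
    rcases le_or_gt (2 * (y : ℤ)) (n + 1) with hc | hc
    · have := hedgeB (Equiv.refl ℤ) (preservesRatio_refl ρ) (fun z => Iff.rfl) y hy.1 hc y rfl
      linarith
    · rcases le_or_gt (2 * ((L : ℤ) + 1 - y)) (n + 1) with hc' | hc'
      · have := hedgeB (Equiv.subLeft ((L : ℤ) + 1)) (preservesRatio_subLeft ρ _) (fun z => by
          simp only [Equiv.subLeft_apply, Finset.mem_Icc]; omega) ((L : ℤ) + 1 - y) (by omega) hc' y
          (by simp)
        linarith
      · have := hbulk n L τ (Equiv.addRight ((y : ℤ) - h)) t D ht hD (preservesRatio_addRight ρ _)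
          (fun z hz => by
            rw [Finset.mem_Icc] at hz ⊢
            simp only [Equiv.coe_addRight]
            omega) h (by omega) (by omega) y (by simp)
        rw [Int.cast_natCast] at this
        linarith
  have hsumB : ∑ z ∈ Finset.Icc 1 (L : ℤ), B z ≤ k * F + C * (S * (k : ℝ) ^ (-(ρ / 2))) := by
    have h1 : ∑ z ∈ Finset.Icc 1 (L : ℤ), B z =
        ∑ z ∈ (Finset.Icc 1 (L : ℤ)).filter (· ≤ (k : ℤ)), F +
          ∑ z ∈ (Finset.Icc 1 (L : ℤ)).filter (fun z => ¬ z ≤ (k : ℤ)), C * (z : ℝ) ^ (-(1 + ρ)) := by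
      rw [← Finset.sum_ite]
    rw [h1]
    refine add_le_add ?_ ?_
    · rw [Finset.sum_const, nsmul_eq_mul]
      refine mul_le_mul_of_nonneg_right ?_ hF0
      have : ((Finset.Icc 1 (L : ℤ)).filter (· ≤ (k : ℤ))).card ≤ (Finset.Icc 1 (k : ℤ)).card := by
        refine Finset.card_le_card fun z hz => ?_
        rw [Finset.mem_filter, Finset.mem_Icc] at hz
        rw [Finset.mem_Icc]
        omega
      rw [Int.card_Icc] at this
      exact_mod_cast this.trans (by omega)
    · rw [← Finset.mul_sum]
      refine mul_le_mul_of_nonneg_left (htail k _ hk fun y hy => ?_) hC.le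
      have := (Finset.mem_filter.1 hy).2
      omega
  have hrefl : ∑ z ∈ Finset.Icc 1 (L : ℤ), B (L + 1 - z) = ∑ z ∈ Finset.Icc 1 (L : ℤ), B z := by
    refine Finset.sum_nbij' (fun z => (L : ℤ) + 1 - z) (fun z => (L : ℤ) + 1 - z) ?_ ?_ ?_ ?_ ?_
    · intro z hz; rw [Finset.mem_Icc] at hz ⊢; omega
    · intro z hz; rw [Finset.mem_Icc] at hz ⊢; omega
    · intro z _; ring
    · intro z _; ring
    · intro z _; rfl
  have htot : ∑ y, discrepancy ρ lam L τ t y ≤ 2 * (k * F + C * (S * (k : ℝ) ^ (-(ρ / 2)))) +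
      L * (C * (h : ℝ) ^ (-(1 + ρ)) + 2 * D) := by
    calc ∑ y, discrepancy ρ lam L τ t y ≤ ∑ y : Finset.Icc 1 (L : ℤ),
          (B y + B (L + 1 - y) + (C * (h : ℝ) ^ (-(1 + ρ)) + 2 * D)) :=
          Finset.sum_le_sum fun y _ => hsite y
      _ = ∑ z ∈ Finset.Icc 1 (L : ℤ),
          (B z + B (L + 1 - z) + (C * (h : ℝ) ^ (-(1 + ρ)) + 2 * D)) :=
          Finset.sum_coe_sort (Finset.Icc 1 (L : ℤ))
            fun z => B z + B (L + 1 - z) + (C * (h : ℝ) ^ (-(1 + ρ)) + 2 * D)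
      _ = ∑ z ∈ Finset.Icc 1 (L : ℤ), B z + ∑ z ∈ Finset.Icc 1 (L : ℤ), B z +
          L * (C * (h : ℝ) ^ (-(1 + ρ)) + 2 * D) := by
          rw [Finset.sum_add_distrib, Finset.sum_add_distrib, hrefl, Finset.sum_const,
            Int.card_Icc, nsmul_eq_mul]
          simp
      _ ≤ _ := by linarith
  refine htot.trans (add_le_add ?_ ?_)
  · have hk0 : (0 : ℝ) ≤ k := k.cast_nonneg
    have a1 : (0 : ℝ) ≤ (k : ℝ) ^ (-(ρ / 2)) := by positivity
    have a2 : (0 : ℝ) ≤ k * (m : ℝ) ^ (-(ρ / 2)) := by positivity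
    have a3 : 0 ≤ k * s := by positivity
    have a4 : 0 ≤ C * S := by positivity
    have b1 := mul_nonneg hC.le a1
    have b2 := mul_nonneg hC.le a3
    have b3 := mul_nonneg a4 a1
    have b4 := mul_nonneg a4 a3
    have b5 := mul_nonneg hC.le a2
    have b6 := mul_nonneg a4 a2
    rw [hF]
    nlinarith
  · have a1 : (0 : ℝ) ≤ (h : ℝ) ^ (-(1 + ρ)) := by positivity
    have a2 : C ≤ 2 + 2 * C + 4 * C * S := by
      have : 0 ≤ C * S := by positivity
      linarith
    gcongr

end Sum

/-! ### Choice of the scales -/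

section Scales

theorem half_le_floor {x : ℝ} (hx : 1 ≤ x) : x / 2 ≤ (⌊x⌋₊ : ℝ) := by
  have h1 := Nat.lt_floor_add_one x
  have h2 : (1 : ℝ) ≤ ⌊x⌋₊ := by exact_mod_cast Nat.one_le_floor_iff x |>.2 hx
  linarith

/-- With `k ≈ n ^ (ρ / 8)`, `m ≈ n ^ (1 / 2)` and `M = n / 2` all error terms near the boundary are
of order `n ^ (-ρ ^ 2 / 16)`. -/
theorem exists_scales {ρ : ℝ} (hρ : 0 < ρ) (hρ1 : ρ < 1) {n : ℕ} (hn : 100 ≤ n) :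
    ∃ k m : ℕ, 1 ≤ k ∧ k ≤ m ∧ m < n / 2 ∧
      k * ((m : ℝ) ^ (-(ρ / 2)) +
        (((((n / 2 : ℕ) : ℝ) + m) / (((n / 2 : ℕ) : ℝ) - m)) ^ 4 - 1)) + (k : ℝ) ^ (-(ρ / 2)) ≤
          139 * (n : ℝ) ^ (-(ρ ^ 2 / 16)) ∧
      ((n / 2 : ℕ) : ℝ) ^ (-(1 + ρ)) ≤ 9 * (n : ℝ) ^ (-(1 + ρ)) := by
  set x : ℝ := (n : ℝ) with hx
  have hx100 : (100 : ℝ) ≤ x := by rw [hx]; exact_mod_cast hn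
  have hx1 : 1 ≤ x := by linarith
  have hx0 : 0 < x := by linarith
  set h : ℕ := n / 2 with hh
  have hh2 : (n : ℤ) ≤ 2 * h + 1 := by omega
  have hh2' : x ≤ 2 * h + 1 := by rw [hx]; exact_mod_cast hh2
  have hxh : x / 3 ≤ h := by linarith
  have hh0 : (0 : ℝ) < h := by linarith
  have half : ∀ {y : ℝ}, 1 ≤ y → (⌊y⌋₊ : ℝ) ^ (-(ρ / 2)) ≤ 2 * y ^ (-(ρ / 2)) := by
    intro y hy
    calc (⌊y⌋₊ : ℝ) ^ (-(ρ / 2)) ≤ (y / 2) ^ (-(ρ / 2)) :=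
          Real.rpow_le_rpow_of_nonpos (by linarith) (half_le_floor hy) (by linarith)
      _ = (2 : ℝ) ^ (ρ / 2) * y ^ (-(ρ / 2)) := by
          rw [Real.div_rpow (by linarith) (by norm_num), Real.rpow_neg (by norm_num : (0 : ℝ) ≤ 2),
            div_inv_eq_mul, mul_comm]
      _ ≤ 2 * y ^ (-(ρ / 2)) := by
          refine mul_le_mul_of_nonneg_right ?_ (by positivity)
          calc (2 : ℝ) ^ (ρ / 2) ≤ 2 ^ (1 : ℝ) :=
                Real.rpow_le_rpow_of_exponent_le (by norm_num) (by linarith)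
            _ = 2 := Real.rpow_one 2
  have hpow : ∀ {a b : ℝ}, a ≤ b → x ^ a ≤ x ^ b := fun hab =>
    Real.rpow_le_rpow_of_exponent_le hx1 hab
  have hk1 : 1 ≤ x ^ (ρ / 8) := Real.one_le_rpow hx1 (by linarith)
  have hm1 : 1 ≤ x ^ (1 / 2 : ℝ) := Real.one_le_rpow hx1 (by norm_num)
  set r := x ^ (1 / 2 : ℝ) with hr
  have hrr : r * r = x := by rw [hr, ← Real.rpow_add hx0]; norm_num
  have hr10 : 10 ≤ r := by nlinarith
  have hmr : (⌊r⌋₊ : ℝ) ≤ r := Nat.floor_le (by linarith)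
  have hm3 : 3 * (⌊r⌋₊ : ℝ) ≤ h := by nlinarith
  have hm0 : (0 : ℝ) ≤ ⌊r⌋₊ := Nat.cast_nonneg _
  refine ⟨⌊x ^ (ρ / 8)⌋₊, ⌊r⌋₊, (Nat.one_le_floor_iff _).2 hk1,
    Nat.floor_mono (hpow (by linarith)), ?_, ?_, ?_⟩
  · have : (⌊r⌋₊ : ℝ) < h := by linarith
    exact_mod_cast this
  · have a1 := half hm1
    have a2 := half hk1
    rw [← Real.rpow_mul hx0.le] at a1 a2
    have a3 : (⌊x ^ (ρ / 8)⌋₊ : ℝ) ≤ x ^ (ρ / 8) := Nat.floor_le (by linarith)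
    have hd : 0 < (h : ℝ) - ⌊r⌋₊ := by linarith
    have a4 : ((h : ℝ) + ⌊r⌋₊) / ((h : ℝ) - ⌊r⌋₊) ≤ 1 + 9 * r⁻¹ := by
      rw [div_le_iff₀ hd]
      have b1 : r⁻¹ * x = r := by rw [← hrr]; field_simp
      have b2 : r ≤ 3 * (r⁻¹ * h) := by
        have := mul_le_mul_of_nonneg_left hxh (inv_nonneg.2 (zero_le_one.trans hm1))
        linarith
      have b3 : r⁻¹ * ⌊r⌋₊ ≤ r⁻¹ * (h / 3) :=
        mul_le_mul_of_nonneg_left (by linarith) (inv_nonneg.2 (zero_le_one.trans hm1))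
      linarith
    have a5 : r⁻¹ ≤ 1 / 10 := by
      rw [inv_le_comm₀ (by linarith) (by norm_num)]
      linarith
    have a5' : 0 < r⁻¹ := inv_pos.2 (by linarith)
    have a6 : (((h : ℝ) + ⌊r⌋₊) / ((h : ℝ) - ⌊r⌋₊)) ^ 4 - 1 ≤ 135 * r⁻¹ := by
      have b0 : 0 ≤ ((h : ℝ) + ⌊r⌋₊) / ((h : ℝ) - ⌊r⌋₊) := by positivity
      have b1 := pow_le_pow_left₀ b0 a4 4
      have b2 : (1 + 9 * r⁻¹) ^ 4 - 1 ≤ 135 * r⁻¹ := by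
        have c0 : 9 * r⁻¹ ≤ 1 := by linarith
        set w := 9 * r⁻¹ with hw
        have c1 : 0 < w := by positivity
        have c2 : w * w ≤ w := by nlinarith
        have c3 : w * w * w ≤ w := by nlinarith
        have c4 : w * w * w * w ≤ w := by nlinarith [mul_pos (mul_pos c1 c1) c1]
        calc (1 + w) ^ 4 - 1 = 4 * w + 6 * (w * w) + 4 * (w * w * w) + w * w * w * w := by ring
          _ ≤ 15 * w := by linarith
          _ = 135 * r⁻¹ := by rw [hw]; ring
      linarith
    have a7 : r⁻¹ = x ^ (-(1 / 2) : ℝ) := by rw [hr, Real.rpow_neg hx0.le]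
    have a8 : x ^ (ρ / 8) * x ^ ((1 / 2 : ℝ) * -(ρ / 2)) ≤ x ^ (-(ρ ^ 2 / 16)) := by
      rw [← Real.rpow_add hx0]
      exact hpow (by nlinarith)
    have a9 : x ^ (ρ / 8) * x ^ (-(1 / 2) : ℝ) ≤ x ^ (-(ρ ^ 2 / 16)) := by
      rw [← Real.rpow_add hx0]
      exact hpow (by nlinarith)
    have a10 : x ^ (ρ / 8 * -(ρ / 2)) = x ^ (-(ρ ^ 2 / 16)) := by congr 1; ring
    rw [a7] at a6
    rw [a10] at a2
    have p1 : 0 ≤ x ^ ((1 / 2 : ℝ) * -(ρ / 2)) := by positivity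
    have p2 : 0 ≤ x ^ (-(1 / 2) : ℝ) := by positivity
    calc _ ≤ x ^ (ρ / 8) * (2 * x ^ ((1 / 2 : ℝ) * -(ρ / 2)) + 135 * x ^ (-(1 / 2) : ℝ)) +
          2 * x ^ (-(ρ ^ 2 / 16)) := by
          refine add_le_add ((mul_le_mul_of_nonneg_left (add_le_add a1 a6)
            (Nat.cast_nonneg _)).trans (mul_le_mul_of_nonneg_right a3 (by positivity))) a2
      _ ≤ _ := by linarith
  · calc (h : ℝ) ^ (-(1 + ρ)) ≤ (x / 3) ^ (-(1 + ρ)) :=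
          Real.rpow_le_rpow_of_nonpos (by linarith) hxh (by linarith)
      _ = (3 : ℝ) ^ (1 + ρ) * x ^ (-(1 + ρ)) := by
          rw [Real.div_rpow (by linarith) (by norm_num), Real.rpow_neg (by norm_num : (0 : ℝ) ≤ 3),
            div_inv_eq_mul, mul_comm]
      _ ≤ 9 * x ^ (-(1 + ρ)) := by
          refine mul_le_mul_of_nonneg_right ?_ (by positivity)
          calc (3 : ℝ) ^ (1 + ρ) ≤ 3 ^ (2 : ℝ) :=
                Real.rpow_le_rpow_of_exponent_le (by norm_num) (by linarith)
            _ = 9 := by norm_num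

theorem eventually_mul_rpow_le (A : ℝ) {a b : ℝ} (hab : a < b) {δ : ℝ} (hδ : 0 < δ) :
    ∀ᶠ L : ℕ in Filter.atTop, A * (L : ℝ) ^ a ≤ δ * (L : ℝ) ^ b := by
  have h1 : Filter.Tendsto (fun L : ℕ => A * (L : ℝ) ^ (-(b - a))) Filter.atTop (nhds (A * 0)) :=
    ((tendsto_rpow_neg_atTop (sub_pos.2 hab)).comp tendsto_natCast_atTop_atTop).const_mul A
  rw [mul_zero] at h1
  filter_upwards [h1.eventually_lt_const hδ, Filter.eventually_ge_atTop 1] with L hL hL1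
  have hL0 : (0 : ℝ) < L := by exact_mod_cast hL1
  have e : (L : ℝ) ^ a = (L : ℝ) ^ (-(b - a)) * (L : ℝ) ^ b := by
    rw [← Real.rpow_add hL0]; congr 1; ring
  rw [e, ← mul_assoc]
  exact mul_le_mul_of_nonneg_right hL.le (by positivity)

end Scales

/-! ### The recursive inequality -/

section BoxTimes

/-- After `j` contraction times of the box, the influence of the initial condition on each of its
sites is at most `n ^ (1 - j β)`. -/
theorem boxMixed_of_contractionTime {ρ lam β : ℝ} (hρ : 0 < ρ) (hlam : 0 < lam) {n : ℕ} (hn : 1 ≤ n)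
    (hT : contractionTimeLen ρ lam β n < ∞) {ε : ℝ} (hε : 0 < ε) (j : ℕ) :
    BoxMixed ρ lam n (j * ((contractionTimeLen ρ lam β n).toReal + ε))
      ((n : ℝ) ^ (1 - j * β)) := by
  intro τ x σ σ'
  have hn0 : (0 : ℝ) < n := by exact_mod_cast hn
  obtain ⟨t₀, ht₀, hc⟩ := exists_contractsAt hT hε τ
  refine (hc.osc_evolve_occ hρ hlam (by positivity)
    (mul_le_mul_of_nonneg_left ht₀ (Nat.cast_nonneg j)) x σ σ').trans_eq ?_
  rw [Int.card_Icc, one_div, ← Real.rpow_neg hn0.le, ← Real.rpow_natCast, ← Real.rpow_mul hn0.le,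
    Real.rpow_sub hn0, Real.rpow_one]
  have e1 : (((n : ℤ) + 1 - 1).toNat : ℝ) = n := by simp
  rw [e1, show -β * (j : ℝ) = -(j * β) by ring, Real.rpow_neg hn0.le]
  field_simp

theorem eventually_floor_mul_rpow {c ζ : ℝ} (hc : 0 < c) (hζ0 : 0 < ζ) (hζ1 : ζ < 1) :
    ∀ᶠ L : ℕ in Filter.atTop, 100 ≤ ⌊c * (L : ℝ) ^ ζ⌋₊ ∧ ⌊c * (L : ℝ) ^ ζ⌋₊ ≤ L ∧
      c / 2 * (L : ℝ) ^ ζ ≤ ⌊c * (L : ℝ) ^ ζ⌋₊ := by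
  have h1 : Filter.Tendsto (fun L : ℕ => c * (L : ℝ) ^ ζ) Filter.atTop Filter.atTop :=
    ((tendsto_rpow_atTop hζ0).comp tendsto_natCast_atTop_atTop).const_mul_atTop hc
  filter_upwards [h1.eventually_ge_atTop 100, eventually_mul_rpow_le c hζ1 one_pos] with L hL hL'
  rw [Real.rpow_one, one_mul] at hL'
  refine ⟨Nat.le_floor (by exact_mod_cast hL), ?_, ?_⟩
  · exact_mod_cast (Nat.floor_le (by linarith)).trans hL'
  · have := half_le_floor (show 1 ≤ c * (L : ℝ) ^ ζ by linarith)
    linarith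

end BoxTimes

theorem proposition6p2 (ρ : ℝ) (hρ0 : 0 < ρ) (hρ1 : ρ < 1)
    (ζ : ℝ) (hζ0 : 1 / (1 + ρ) < ζ) (hζ1 : ζ < 1) :
    ∃ β₀ : ℝ, 0 < β₀ ∧ β₀ ≤ ζ * (1 + ρ) - 1 ∧
      ∀ β : ℝ, 0 < β → β < β₀ →
        ∃ C₄ : ℝ, 0 < C₄ ∧
          ∀ lam : ℝ, 0 < lam → lam < 1 →
            ∀ c₂ : ℝ, 0 < c₂ →
              ∃ L₀ : ℕ, ∀ L : ℕ, L₀ ≤ L →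
                contractionTimeLen ρ lam β L ≤
                    ENNReal.ofReal C₄ * contractionTimeLen ρ lam β ⌊c₂ * (L : ℝ) ^ ζ⌋₊ ∧
                  contractionTimeLen ρ lam β ⌊c₂ * (L : ℝ) ^ ζ⌋₊ < ∞ := by
  have hζ : 0 < ζ := lt_trans (by positivity) hζ0
  have hζρ : 1 < ζ * (1 + ρ) := by rwa [div_lt_iff₀ (by linarith)] at hζ0
  refine ⟨min (ζ * (1 + ρ) - 1) (ζ * (ρ ^ 2 / 16)), lt_min (by linarith) (by positivity),
    min_le_left _ _, fun β hβ hββ => ?_⟩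
  have hβ1 := hββ.trans_le (min_le_left _ _)
  have hβ2 := hββ.trans_le (min_le_right _ _)
  -- `j` contraction times of the box reduce the memory of the initial condition, summed over the
  -- sites of the box, to less than `L ^ (-(1 + β))`.
  obtain ⟨j, hj⟩ := exists_nat_gt (((1 + β) / ζ + 1) / β)
  have hj0 : (0 : ℝ) < j := lt_trans (by positivity) hj
  rw [div_lt_iff₀ hβ] at hj
  have hjβ : 1 + β < ζ * (j * β - 1) := by
    have : (1 + β) / ζ < j * β - 1 := by linarith
    rw [div_lt_iff₀ hζ] at this
    linarith
  have hjβ1 : 1 - j * β < 0 := by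
    have : 0 < (1 + β) / ζ := by positivity
    linarith
  refine ⟨j, hj0, fun lam hlam hlam1 c hc => ?_⟩
  obtain ⟨C, hC, hsum⟩ := exists_sum_discrepancy_le hρ0 hρ1 hlam hlam1
  have e1 := eventually_mul_rpow_le (C * (139 * (c / 2) ^ (-(ρ ^ 2 / 16))))
    (show ζ * -(ρ ^ 2 / 16) < -β by linarith) (show (0 : ℝ) < 1 / 3 by norm_num)
  have e2 := eventually_mul_rpow_le (C * (9 * (c / 2) ^ (-(1 + ρ))))
    (show 1 + ζ * -(1 + ρ) < -β by linarith) (show (0 : ℝ) < 1 / 3 by norm_num)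
  have e3 := eventually_mul_rpow_le (2 * (c / 2) ^ (1 - j * β))
    (show 1 + ζ * (1 - j * β) < -β by linarith) (show (0 : ℝ) < 1 / 3 by norm_num)
  obtain ⟨L₀, hL₀⟩ := Filter.eventually_atTop.1 (((e1.and e2).and e3).and
    ((eventually_floor_mul_rpow hc hζ hζ1).and (Filter.eventually_ge_atTop 1)))
  refine ⟨L₀, fun L hL => ?_⟩
  obtain ⟨⟨⟨e1, e2⟩, e3⟩, ⟨hn100, hnL, hn⟩, hL1⟩ := hL₀ L hL
  set n := ⌊c * (L : ℝ) ^ ζ⌋₊ with hndef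
  have hT : contractionTimeLen ρ lam β n < ∞ :=
    contractionTimeLen_lt_top hρ0 hρ1 hlam β (by omega)
  refine ⟨?_, hT⟩
  have hL0 : (0 : ℝ) < L := by exact_mod_cast hL1
  have hpow : ∀ {a : ℝ}, a < 0 → (n : ℝ) ^ a ≤ (c / 2) ^ a * (L : ℝ) ^ (ζ * a) := by
    intro a ha
    rw [Real.rpow_mul hL0.le, ← Real.mul_rpow (by positivity) (by positivity)]
    exact Real.rpow_le_rpow_of_nonpos (by positivity) hn ha.le
  refine ENNReal.le_of_forall_pos_le_add fun ε hε _ => ?_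
  have hε' : (0 : ℝ) < ε / j := div_pos (by exact_mod_cast hε) hj0
  have ht : 0 < j * ((contractionTimeLen ρ lam β n).toReal + ε / j) := by positivity
  calc contractionTimeLen ρ lam β L ≤
        ENNReal.ofReal (j * ((contractionTimeLen ρ lam β n).toReal + ε / j)) := by
        refine contractionTimeLen_le fun τ => contractsAt_of_evolve_occ hρ0 hlam ht ?_
        obtain ⟨k, m, hk, hkm, hm, hsc, hsc'⟩ := exists_scales hρ0 hρ1 hn100
        refine (hsum n L τ _ _ ht.le (boxMixed_of_contractionTime hρ0 hlam (by omega) hT hε' j)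
          hnL k m hk hkm hm).trans ?_
        have a1 : (n : ℝ) ^ (-(ρ ^ 2 / 16)) ≤ _ := hpow (by
          have : 0 < ρ ^ 2 := by positivity
          linarith)
        have a2 : (n : ℝ) ^ (-(1 + ρ)) ≤ _ := hpow (by linarith)
        have a3 : (n : ℝ) ^ (1 - j * β) ≤ _ := hpow hjβ1
        rw [Real.rpow_add hL0, Real.rpow_one] at e2 e3
        rw [one_div, ← Real.rpow_neg hL0.le]
        have b1 := mul_le_mul_of_nonneg_left (hsc.trans (mul_le_mul_of_nonneg_left a1
          (by norm_num : (0 : ℝ) ≤ 139))) hC.le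
        have b2 := mul_le_mul_of_nonneg_left (mul_le_mul_of_nonneg_left (hsc'.trans
          (mul_le_mul_of_nonneg_left a2 (by norm_num : (0 : ℝ) ≤ 9))) hC.le) hL0.le
        have b3 := mul_le_mul_of_nonneg_left (mul_le_mul_of_nonneg_left a3
          (by norm_num : (0 : ℝ) ≤ 2)) hL0.le
        linarith
    _ = ENNReal.ofReal j * contractionTimeLen ρ lam β n + ε := by
        rw [mul_add, mul_div_cancel₀ _ hj0.ne', ENNReal.ofReal_add (by positivity) (by positivity),
          ENNReal.ofReal_mul hj0.le, ENNReal.ofReal_toReal hT.ne, ENNReal.ofReal_coe_nnreal]
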